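/- All knots are classical knots, considered up to isotopy, and a diagram may be moved by isotopy on the sphere. A knot diagram with $n$ crossings is *straight* if, for a suitable base point (not a crossing) and direction, labelling the crossings $1,2,\dots,n$ in the order in which they are first met makes the sequence of crossings met in one traversal of the knot equal to $(1,2,\dots,n,\sigma(1),\dots,\sigma(n))$ for some permutation $\sigma\in S_n$. The part of the knot running through the first $n$ of these passages is the *straight strand*; it can be drawn as a horizontal segment, and the *extended straight strand* consists of the two rays that continue this segment beyond its ends. The *straight number* $\mathrm{str}(K)$ is the minimum $n$ such that $K$ has a straight diagram with $n$ crossings. The *contained straight number* $\mathrm{cstr}(K)$ is the minimum $n$ such that $K$ has a straight diagram with $n$ crossings in which no arc of the knot crosses the extended straight strand. **Proposition.** Let $K$ be a nontrivial knot with $\mathrm{str}(K)=n$. Then $K$ has a contained straight diagram, and $\mathrm{cstr}(K)\le 4n-8$. -/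

import Mathlib

/-- A passage of a knot through a crossing of its diagram, met while traversing the knot: the label
of the crossing, whether the knot passes over there, and whether the crossing is positive, i.e.
whether (direction of the over strand, direction of the under strand) is a positively oriented
pair in the plane. -/
structure Passage where
  crossing : ℕ
  isOver : Bool
  isPositive : Bool
deriving DecidableEq

/-- The other passage through the same crossing. -/
def Passage.partner (p : Passage) : Passage := ⟨p.crossing, !p.isOver, p.isPositive⟩

/-- A list of passages is an (oriented, based) signed Gauss code if every crossing that occurs in it
is passed exactly twice, once over and once under, and with one and the same sign. -/
structure IsGaussCode (w : List Passage) : Prop where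
  nodup : w.Nodup
  partner_mem : ∀ p ∈ w, p.partner ∈ w
  sign_eq : ∀ p ∈ w, ∀ q ∈ w, p.crossing = q.crossing → p.isPositive = q.isPositive

/-- The number of crossings of a Gauss code. -/
def numCrossings (w : List Passage) : ℕ := w.length / 2

/-- The passage that follows `p` in the cyclic word `w`. -/
def nextPassage (w : List Passage) (p : Passage) : Passage :=
  if h : p ∈ w then w.next p h else p

/-- The passage that precedes `p` in the cyclic word `w`. -/
def prevPassage (w : List Passage) (p : Passage) : Passage :=
  if h : p ∈ w then w.prev p h else p

/-- A directed edge of the 4-valent graph underlying the diagram. `(p, true)` is the edge that leaves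
the passage `p`, in the direction of the knot; `(p, false)` is the edge that arrives at `p`,
traversed from `p` backwards. A directed edge also stands for the side of the edge on its left. -/
abbrev Dart : Type := Passage × Bool

/-- The next directed edge on the boundary of the face on the left of `d`: follow `d` to its end, the
passage `q`, and turn left there, into the other strand of that crossing. If we arrive in the
direction of the knot, the other strand runs from our right to our left when
`q.isOver = q.isPositive`, and from our left to our right otherwise. -/
def faceNext (w : List Passage) (d : Dart) : Dart :=
  let q := if d.2 then nextPassage w d.1 else prevPassage w d.1
  (q.partner, d.2 == (q.isOver == q.isPositive))

/-- The face on the left of `d`, as the set of the directed edges which have it on their left. -/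
def face (w : List Passage) (d : Dart) : Set Dart := {e | ∃ k : ℕ, (faceNext w)^[k] d = e}

/-- The faces of a Gauss code: the complementary regions of the 4-valent graph in the closed
oriented surface that is obtained by gluing a disc to each face boundary. -/
def faces (w : List Passage) : Set (Set Dart) := {F | ∃ d : Dart, d.1 ∈ w ∧ F = face w d}

/-- The surface carrying the code is a sphere: as there are `n` crossings and `2 n` edges, its Euler
characteristic is `(faces w).ncard - n`. The code without crossings is the round circle. -/
def IsPlanar (w : List Passage) : Prop :=
  w = [] ∨ (faces w).ncard = numCrossings w + 2

/-- A (classical) knot diagram on the sphere, up to isotopy, with a base point, a direction and a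
labelling of its crossings, given by its signed Gauss code. -/
structure KnotDiagram where
  code : List Passage
  isGaussCode : IsGaussCode code
  isPlanar : IsPlanar code

/-- Two consecutive passages `p`, `q`, met in this order if `b = true` and in the opposite order
if `b = false`. -/
def seg (b : Bool) (p q : Passage) : List Passage := if b then [p, q] else [q, p]

/-- The Reidemeister moves on signed Gauss codes, together with the changes of the base point, of the
direction and of the labels. That the labels of new crossings are fresh follows from both sides
being Gauss codes. -/
inductive ReidemeisterMove : List Passage → List Passage → Prop
  | rotate (u v : List Passage) : ReidemeisterMove (u ++ v) (v ++ u)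
  | reverse (w : List Passage) : ReidemeisterMove w w.reverse
  | relabel (f : ℕ → ℕ) (hf : Function.Injective f) (w : List Passage) :
      ReidemeisterMove w (w.map fun p => ⟨f p.crossing, p.isOver, p.isPositive⟩)
  /-- Type I: a kink, of any sign and with either strand on top. -/
  | r1 (p : Passage) (u : List Passage) : ReidemeisterMove u ([p, p.partner] ++ u)
  /-- Type II: one strand is pushed over another one, which runs in the same direction if
  `b = true` and in the opposite direction if `b = false`. -/
  | r2 (b : Bool) (p q : Passage) (ho : p.isOver = q.isOver) (hs : p.isPositive ≠ q.isPositive)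
      (u v : List Passage) :
      ReidemeisterMove (u ++ v) ([p, q] ++ u ++ seg b p.partner q.partner ++ v)
  /-- Type III: the top, the middle and the bottom strand cross pairwise at `x` (top and middle),
  `y` (top and bottom) and `z` (middle and bottom), at the corners of a triangular face, and
  the move reverses the order of the two crossings on each strand. The two conditions on the signs
  say that three straight lines oriented like the strands have crossings of these signs. -/
  | r3 (t m b : Bool) (x y z : Passage) (hx : x.isOver = true) (hy : y.isOver = true)
      (hz : z.isOver = true) (hxy : x.isPositive = y.isPositive ↔ m = b)
      (hxz : x.isPositive = z.isPositive ↔ t = b) (u v s : List Passage) :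
      ReidemeisterMove
        (seg t x y ++ u ++ seg m x.partner z ++ v ++ seg b y.partner z.partner ++ s)
        (seg (!t) x y ++ u ++ seg (!m) x.partner z ++ v ++ seg (!b) y.partner z.partner ++ s)
  /-- Type III, with the three strands met in the other cyclic order. -/
  | r3' (t m b : Bool) (x y z : Passage) (hx : x.isOver = true) (hy : y.isOver = true)
      (hz : z.isOver = true) (hxy : x.isPositive = y.isPositive ↔ m = b)
      (hxz : x.isPositive = z.isPositive ↔ t = b) (u v s : List Passage) :
      ReidemeisterMove
        (seg t x y ++ u ++ seg b y.partner z.partner ++ v ++ seg m x.partner z ++ s)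
        (seg (!t) x y ++ u ++ seg (!b) y.partner z.partner ++ v ++ seg (!m) x.partner z ++ s)

/-- Knots (unoriented, in the 3-sphere, up to ambient isotopy), as classes of knot diagrams under the
equivalence relation generated by the Reidemeister moves. -/
def Knot : Type := Quot fun D D' : KnotDiagram => ReidemeisterMove D.code D'.code

/-- The knot of which `D` is a diagram. -/
def KnotDiagram.knot (D : KnotDiagram) : Knot := Quot.mk _ D

/-- The diagram without crossings. -/
def trivialDiagram : KnotDiagram where
  code := []
  isGaussCode := ⟨List.nodup_nil, by simp, by simp⟩
  isPlanar := Or.inl rfl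

/-- The trivial knot. -/
def Knot.unknot : Knot := trivialDiagram.knot

namespace KnotDiagram

/-- The number of crossings of a diagram. -/
def crossings (D : KnotDiagram) : ℕ := numCrossings D.code

/-- The diagram (with its base point, direction and labels) is straight: its knot word is
`(1, 2, …, n, σ(1), …, σ(n))` with a permutation `σ` of `{1, …, n}`. The straight strand is the part of
the knot from just before the first to just after the `n`-th passage. -/
def IsStraight (D : KnotDiagram) : Prop :=
  ∃ σ : List ℕ, σ.Perm (List.range' 1 D.crossings) ∧
    D.code.map Passage.crossing = List.range' 1 D.crossings ++ σ

/-- The two sides of the edge that leaves the passage `p`. -/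
def edgeSides (D : KnotDiagram) (p : Passage) : Set Dart :=
  {(p, true), (nextPassage D.code p, false)}

/-- No arc crosses the extended straight strand. The extension of the straight strand beyond its
right end and beyond its left end, joined at infinity, is an arc on the sphere from the right end,
on the edge that leaves the `n`-th passage `q`, to the left end, on the edge that leaves the last
passage `p`. It can be drawn without meeting the diagram elsewhere if and only if these two
edges have a common face. (Without crossings there is nothing to require.) -/
def IsContained (D : KnotDiagram) : Prop :=
  ∀ p q : Passage, D.code.getLast? = some p → D.code[D.crossings - 1]? = some q →
    ∃ d ∈ D.edgeSides p, ∃ e ∈ D.edgeSides q, e ∈ face D.code d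

end KnotDiagram

/-- The straight number of `K`: the minimum number of crossings of a straight diagram of `K`
(`⊤` if there were none). -/
noncomputable def Knot.str (K : Knot) : ℕ∞ :=
  ⨅ (D : KnotDiagram) (_ : D.knot = K ∧ D.IsStraight), (D.crossings : ℕ∞)

/-- The contained straight number of `K`: the minimum number of crossings of a straight diagram of
`K` in which no arc crosses the extended straight strand (`⊤` if there were none). -/
noncomputable def Knot.cstr (K : Knot) : ℕ∞ :=
  ⨅ (D : KnotDiagram) (_ : D.knot = K ∧ D.IsStraight ∧ D.IsContained), (D.crossings : ℕ∞)

/-!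
Draw a minimal straight diagram with the straight strand horizontal, and let `x` be the crossing at
which the other strand `x :: C` begins. The straight strand is `A ++ x.partner :: B`, with `A`
before and `B` after the crossing. The crossing `x` is moved along the straight strand, backwards,
past all of `A` and around its end (`Overpass.flip`), which creates `2 |A|` crossings of the moved
strand, all of them over or all of them under. In the new diagram (`exists_overpass`) the code is
`L ++ O ++ R`, where `L` and `R` have no crossings of their own and `O` is the half of the moved
strand from `x` on, say an overpass. Without `O` the two ends of `L` would lie in one face (`SameRegion`),
because `O` begins at the end of `L` with a crossing with the very first passage of `L`.

Since `O` lies above everything, it can be replaced by any other path between its ends. First its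
crossings with `R` are pushed off the end of `R`, onto `L` (`Overpass.exists_disjoint`). Then
monogons and bigons between `O` and `L` are removed, until no two crossings with `O` are consecutive
on `L` (`Overpass.exists_reduced`). After that `L` has at most twice as many crossings as `L₀`, the
part of it without the crossings with `O`, and `|L₀| = 2 |A| + |B|`. Labelling the crossings along
`L` gives a straight diagram. It is contained because the ends of `L` are still in a common face
(`Overpass.not_separated`): a set of faces that separates them, intersected with a set that has `O`
on its boundary only before the first crossing of `O`, would separate the ends of `L₀` once `O` is
removed. The crossings are at most `2 (2 |A| + |B|) = 4 (n - 1) - 2 |B|`, and `|B|` is at least `2`: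
it is even (`even_length_of_isSeparating`), and `B = []` would give a kink, whose removal yields a
smaller straight diagram.

All planar topology is done with mod 2 colourings of the faces. By Euler's formula a Gauss code is
planar if and only if every mod 2 cycle of the diagram is the boundary of a set of faces
(`isPlanar_iff_isSeparating`). In this form planarity is easily seen to be preserved by the moves,
and the Jordan curve theorem is available as the existence of colourings. In particular the
existence of an innermost bigon (`exists_adjacent_crossings`) is proved by evaluating the colouring
of a loop formed by `L` and `O`.
-/

/-! ### Face colourings -/

/-- Whether the other strand at the crossing of `p` runs from the right of `p` to its left. -/
def Passage.leftward (p : Passage) : Bool := p.isOver == p.isPositive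

/-- Colours (left, right) of the two sides of an edge of a diagram. -/
abbrev SideColors : Type := ZMod 2 × ZMod 2

/-- The colours of the four corners of a crossing, indexed by compass directions. The crossing is
drawn so that the strand whose passage is `leftward` runs north and the other strand runs west. -/
structure Corners where
  sw : ZMod 2
  se : ZMod 2
  nw : ZMod 2
  ne : ZMod 2

/-- The sum of the colours of the four corners. -/
def Corners.total (k : Corners) : ZMod 2 := k.sw + k.se + k.nw + k.ne

/-- The colours of the two sides of the edge that arrives at the passage `p`. -/
def sidesIn (κ : ℕ → Corners) (p : Passage) : SideColors :=
  if p.leftward then ((κ p.crossing).sw, (κ p.crossing).se)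
  else ((κ p.crossing).se, (κ p.crossing).ne)

/-- The colours of the two sides of the edge that leaves the passage `p`. -/
def sidesOut (κ : ℕ → Corners) (p : Passage) : SideColors :=
  if p.leftward then ((κ p.crossing).nw, (κ p.crossing).ne)
  else ((κ p.crossing).sw, (κ p.crossing).nw)

/-- The corner colours `κ` fit along the strand `w`, with the side colours `s` before its first
passage and `s'` after its last one. -/
def Fits (κ : ℕ → Corners) : SideColors → List Passage → SideColors → Prop
  | s, [], s' => s = s'
  | s, p :: l, s' => sidesIn κ p = s ∧ Fits κ (sidesOut κ p) l s'

/-- Every mod 2 cycle of the diagram is the boundary of a set of faces: there is a colouring of the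
faces with prescribed parities at the crossings and a prescribed jump across the first edge. -/
def IsSeparating (w : List Passage) : Prop :=
  ∀ (u : ℕ → ZMod 2) (z : ZMod 2), ∃ (κ : ℕ → Corners) (s : SideColors), Fits κ s w s ∧
    (∀ p ∈ w, (κ p.crossing).total = u p.crossing) ∧ s.1 + s.2 = z

@[simp] theorem Passage.partner_crossing (p : Passage) : p.partner.crossing = p.crossing := rfl
@[simp] theorem Passage.partner_isOver (p : Passage) : p.partner.isOver = !p.isOver := rfl
@[simp] theorem Passage.partner_isPositive (p : Passage) : p.partner.isPositive = p.isPositive := rfl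
@[simp] theorem Passage.partner_partner (p : Passage) : p.partner.partner = p := by
  cases p; simp [Passage.partner]
@[simp] theorem Passage.partner_leftward (p : Passage) : p.partner.leftward = !p.leftward := by
  rcases p with ⟨c, _ | _, _ | _⟩ <;> rfl
theorem Passage.partner_ne (p : Passage) : p.partner ≠ p := by
  intro h; have := congrArg Passage.isOver h; simp at this
theorem Passage.partner_injective : Function.Injective Passage.partner :=
  Function.LeftInverse.injective Passage.partner_partner

@[simp] theorem fits_nil (κ : ℕ → Corners) (s s' : SideColors) : Fits κ s [] s' ↔ s = s' := Iff.rfl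
@[simp] theorem fits_cons (κ : ℕ → Corners) (s s' : SideColors) (p : Passage) (l : List Passage) :
    Fits κ s (p :: l) s' ↔ sidesIn κ p = s ∧ Fits κ (sidesOut κ p) l s' := Iff.rfl

theorem fits_append (κ : ℕ → Corners) (s s' : SideColors) (u v : List Passage) :
    Fits κ s (u ++ v) s' ↔ ∃ t, Fits κ s u t ∧ Fits κ t v s' := by
  induction u generalizing s with
  | nil => simp
  | cons p u ih => simp [ih, and_assoc]

theorem fits_congr {κ κ' : ℕ → Corners} {l : List Passage}
    (h : ∀ p ∈ l, κ p.crossing = κ' p.crossing) (s s' : SideColors) :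
    Fits κ s l s' ↔ Fits κ' s l s' := by
  induction l generalizing s with
  | nil => simp
  | cons p l ih =>
    simp only [List.mem_cons, forall_eq_or_imp] at h
    simp [ih h.2, sidesIn, sidesOut, h.1]

/-- The jump of the colour across an edge. -/
def SideColors.jump (s : SideColors) : ZMod 2 := s.1 + s.2

theorem jump_sidesOut (κ : ℕ → Corners) (p : Passage) :
    (sidesOut κ p).jump = (sidesIn κ p).jump + (κ p.crossing).total := by
  unfold sidesOut sidesIn SideColors.jump Corners.total
  split <;> grind

theorem Fits.jump_eq {κ : ℕ → Corners} {s t : SideColors} {l : List Passage} (h : Fits κ s l t)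
    {u : ℕ → ZMod 2} (hu : ∀ p ∈ l, (κ p.crossing).total = u p.crossing) :
    t.jump = s.jump + (l.map fun p => u p.crossing).sum := by
  induction l generalizing s with
  | nil => simp_all
  | cons p l ih =>
    obtain ⟨rfl, h⟩ := h
    rw [ih h (fun q hq => hu q (by simp [hq])), jump_sidesOut, hu p (by simp)]
    simp [add_assoc]

theorem fits_iff_getElem (κ : ℕ → Corners) (s s' : SideColors) (l : List Passage) :
    Fits κ s l s' ↔ ∃ st : ℕ → SideColors, st 0 = s ∧ st l.length = s' ∧
      ∀ (i : ℕ) (hi : i < l.length), sidesIn κ l[i] = st i ∧ sidesOut κ l[i] = st (i + 1) := by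
  induction l generalizing s with
  | nil => exact ⟨fun h => ⟨fun _ => s, rfl, h, by simp⟩, by rintro ⟨st, rfl, h, -⟩; exact h⟩
  | cons p l ih =>
    rw [fits_cons, ih]
    constructor
    · rintro ⟨rfl, st, h0, h1, h2⟩
      refine ⟨fun i => if i = 0 then sidesIn κ p else st (i - 1), by simp, by simp [h1], ?_⟩
      rintro (_ | i) hi
      · simp [h0]
      · simpa using h2 i (by simpa using hi)
    · rintro ⟨st, rfl, h1, h2⟩
      refine ⟨(h2 0 (by simp)).1, fun i => st (i + 1), (h2 0 (by simp)).2.symm, by simpa using h1, ?_⟩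
      intro i hi
      exact h2 (i + 1) (by simpa using hi)

theorem IsSeparating.rotate {u v : List Passage} (h : IsSeparating (u ++ v)) :
    IsSeparating (v ++ u) := by
  intro c z
  -- the jump at the new base point is the old one plus the total of `u`
  obtain ⟨κ, s, hκ, hc, hs⟩ := h c (z + (u.map fun p => c p.crossing).sum)
  obtain ⟨t, h1, h2⟩ := (fits_append ..).1 hκ
  refine ⟨κ, t, (fits_append ..).2 ⟨s, h2, h1⟩, fun p hp => hc p (by grind), ?_⟩
  have := h1.jump_eq (fun p hp => hc p (by grind))
  unfold SideColors.jump at this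
  rw [this, hs]
  grind

/-! ### Planarity as a separation property -/

/-- The colour of the face on the left of a dart. -/
def dartColor (κ : ℕ → Corners) (d : Dart) : ZMod 2 :=
  if d.2 then (sidesOut κ d.1).1 else (sidesIn κ d.1).2

theorem nextPassage_getElem {w : List Passage} (hw : w.Nodup) (i : ℕ) (hi : i < w.length) :
    nextPassage w w[i] = w[(i + 1) % w.length]'(Nat.mod_lt _ (by omega)) := by
  simp [nextPassage, List.next_getElem _ hw]

theorem nextPassage_mem {w : List Passage} {p : Passage} (hp : p ∈ w) : nextPassage w p ∈ w := by
  simp [nextPassage, hp, List.next_mem]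

theorem prevPassage_mem {w : List Passage} {p : Passage} (hp : p ∈ w) : prevPassage w p ∈ w := by
  simp [prevPassage, hp, List.prev_mem]

theorem next_prevPassage {w : List Passage} (hw : w.Nodup) {p : Passage} (hp : p ∈ w) :
    nextPassage w (prevPassage w p) = p := by
  simp [nextPassage, prevPassage, hp, List.prev_mem, List.next_prev _ hw]

theorem prev_nextPassage {w : List Passage} (hw : w.Nodup) {p : Passage} (hp : p ∈ w) :
    prevPassage w (nextPassage w p) = p := by
  simp [nextPassage, prevPassage, hp, List.next_mem, List.prev_next _ hw]

theorem fits_iff_nextPassage {w : List Passage} (hw : w.Nodup) (h0 : w ≠ []) (κ : ℕ → Corners)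
    (s : SideColors) :
    Fits κ s w s ↔ sidesIn κ (w.head h0) = s ∧
      ∀ p ∈ w, sidesOut κ p = sidesIn κ (nextPassage w p) := by
  have hl : 0 < w.length := List.length_pos_iff.2 h0
  rw [fits_iff_getElem]
  constructor
  · rintro ⟨st, h1, h2, h3⟩
    refine ⟨by rw [List.head_eq_getElem, (h3 0 hl).1, h1], fun p hp => ?_⟩
    obtain ⟨i, hi, rfl⟩ := List.getElem_of_mem hp
    rw [nextPassage_getElem hw, (h3 i hi).2]
    rcases Nat.lt_or_ge (i + 1) w.length with h | h
    · simp only [Nat.mod_eq_of_lt h, (h3 _ h).1]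
    · have : i + 1 = w.length := by omega
      simp only [this, Nat.mod_self, (h3 0 hl).1, h1, h2]
  · rintro ⟨h1, h2⟩
    refine ⟨fun i => sidesIn κ (w[i % w.length]'(Nat.mod_lt _ hl)), ?_, ?_, fun i hi => ⟨?_, ?_⟩⟩
    · simpa [List.head_eq_getElem] using h1
    · simpa [List.head_eq_getElem] using h1
    · simp only [Nat.mod_eq_of_lt hi]
    · rw [h2 _ (List.getElem_mem hi), nextPassage_getElem hw]

theorem faceNext_true (w : List Passage) (p : Passage) : faceNext w (p, true) =
    ((nextPassage w p).partner, (nextPassage w p).leftward) := by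
  simp [faceNext, Passage.leftward]

theorem faceNext_false (w : List Passage) (p : Passage) : faceNext w (p, false) =
    ((prevPassage w p).partner, !(prevPassage w p).leftward) := by
  simp [faceNext, Passage.leftward]

theorem sidesIn_eq_dartColor (κ : ℕ → Corners) (p : Passage) :
    sidesIn κ p = (dartColor κ (p.partner, p.leftward), dartColor κ (p, false)) := by
  unfold dartColor sidesIn sidesOut
  cases h : p.leftward <;> simp [h]

theorem sidesOut_eq_dartColor (κ : ℕ → Corners) (p : Passage) :
    sidesOut κ p = (dartColor κ (p, true), dartColor κ (p.partner, !p.leftward)) := by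
  unfold dartColor sidesIn sidesOut
  cases h : p.leftward <;> simp [h]

theorem total_eq_dartColor (κ : ℕ → Corners) (p : Passage) :
    (κ p.crossing).total = dartColor κ (p, true) + dartColor κ (p, false) +
      dartColor κ (p.partner, true) + dartColor κ (p.partner, false) := by
  unfold dartColor sidesIn sidesOut Corners.total
  cases h : p.leftward <;> simp [h] <;> ring

theorem faceNext_mem {w : List Passage} (hw : IsGaussCode w) {d : Dart} (hd : d.1 ∈ w) :
    (faceNext w d).1 ∈ w := by
  rcases d with ⟨p, _ | _⟩
  · exact faceNext_false w p ▸ hw.partner_mem _ (prevPassage_mem hd)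
  · exact faceNext_true w p ▸ hw.partner_mem _ (nextPassage_mem hd)

/-- Colours that fit along the closed strand are constant on faces. -/
theorem dartColor_faceNext {w : List Passage} (hw : IsGaussCode w) (h0 : w ≠ []) {κ : ℕ → Corners}
    {s : SideColors} (h : Fits κ s w s) {d : Dart} (hd : d.1 ∈ w) :
    dartColor κ (faceNext w d) = dartColor κ d := by
  have h2 := ((fits_iff_nextPassage hw.nodup h0 κ s).1 h).2
  rcases d with ⟨p, _ | _⟩
  · have := h2 _ (prevPassage_mem hd)
    rw [next_prevPassage hw.nodup hd, sidesIn_eq_dartColor, sidesOut_eq_dartColor] at this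
    rw [faceNext_false]
    exact (Prod.ext_iff.1 this).2
  · have := h2 _ hd
    rw [sidesIn_eq_dartColor, sidesOut_eq_dartColor] at this
    rw [faceNext_true]
    exact (Prod.ext_iff.1 this).1.symm

/-- A function on the darts that is constant on faces comes from corner colours. -/
theorem exists_corners {w : List Passage} (hw : IsGaussCode w) (h0 : w ≠ []) (χ : Dart → ZMod 2)
    (hχ : ∀ d : Dart, d.1 ∈ w → χ (faceNext w d) = χ d) :
    ∃ κ : ℕ → Corners, (∀ d : Dart, d.1 ∈ w → dartColor κ d = χ d) ∧
      Fits κ (sidesIn κ (w.head h0)) w (sidesIn κ (w.head h0)) := by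
  classical
  -- the northward passage of a crossing
  let g : ℕ → Passage := fun c => if ⟨c, true, true⟩ ∈ w then ⟨c, true, true⟩ else ⟨c, false, false⟩
  let κ : ℕ → Corners := fun c =>
    ⟨χ ((g c).partner, true), χ (g c, false), χ (g c, true), χ ((g c).partner, false)⟩
  have hg : ∀ p ∈ w, p.leftward = true → g p.crossing = p := by
    rintro ⟨c, _ | _, _ | _⟩ hp hl <;> simp only [Passage.leftward] at hl <;> try cases hl
    · have : (⟨c, true, true⟩ : Passage) ∉ w := fun h => by
        simpa using hw.sign_eq _ hp _ h rfl
      simp [g, this]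
    · simp [g, hp]
  have hκ : ∀ d : Dart, d.1 ∈ w → dartColor κ d = χ d := by
    rintro ⟨p, b⟩ hp
    cases hl : p.leftward
    · have := hg _ (hw.partner_mem _ hp) (by simp [hl])
      simp only [Passage.partner_crossing] at this
      cases b <;> simp [dartColor, sidesIn, sidesOut, hl, κ, this]
    · have := hg _ hp hl
      cases b <;> simp [dartColor, sidesIn, sidesOut, hl, κ, this]
  refine ⟨κ, hκ, (fits_iff_nextPassage hw.nodup h0 κ _).2 ⟨rfl, fun p hp => ?_⟩⟩
  have hq := nextPassage_mem hp
  have h1 := hχ (p, true) hp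
  have h2 := hχ (nextPassage w p, false) hq
  rw [faceNext_true] at h1
  rw [faceNext_false, prev_nextPassage hw.nodup hp] at h2
  rw [sidesIn_eq_dartColor, sidesOut_eq_dartColor, hκ (p, true) hp,
    hκ (p.partner, _) (hw.partner_mem _ hp), hκ (nextPassage w p, false) hq,
    hκ ((nextPassage w p).partner, _) (hw.partner_mem _ hq), h1, h2]

theorem faceNext_injOn {w : List Passage} (hw : IsGaussCode w) :
    Set.InjOn (faceNext w) {d | d.1 ∈ w} := by
  rintro ⟨p, b⟩ hp ⟨q, c⟩ hq h
  simp only [Set.mem_ofPred_eq] at hp hq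
  cases b <;> cases c <;> simp only [faceNext_true, faceNext_false, Prod.mk.injEq] at h <;>
    have h1 := Passage.partner_injective h.1 <;> simp only [h1] at h
  · rw [← next_prevPassage hw.nodup hp, h1, next_prevPassage hw.nodup hq]
  · simp at h
  · simp at h
  · rw [← prev_nextPassage hw.nodup hp, h1, prev_nextPassage hw.nodup hq]

theorem mem_face_self (w : List Passage) (d : Dart) : d ∈ face w d := ⟨0, rfl⟩

theorem iterate_faceNext_mem {w : List Passage} (hw : IsGaussCode w) {d : Dart} (hd : d.1 ∈ w)
    (k : ℕ) : ((faceNext w)^[k] d).1 ∈ w := by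
  induction k generalizing d with
  | zero => exact hd
  | succ k ih => exact ih (faceNext_mem hw hd)

theorem finite_darts (w : List Passage) : {d : Dart | d.1 ∈ w}.Finite := by
  refine ((w.toFinset ×ˢ (Finset.univ : Finset Bool)).finite_toSet).subset fun d hd => ?_
  simpa using hd

theorem face_symm {w : List Passage} (hw : IsGaussCode w) {d e : Dart} (hd : d.1 ∈ w)
    (he : e ∈ face w d) : d ∈ face w e := by
  -- the orbits of an injective map of a finite set are cycles
  have hm : Set.MapsTo (faceNext w) {d | d.1 ∈ w} {d | d.1 ∈ w} := fun d hd => faceNext_mem hw hd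
  have : Finite {d : Dart | d.1 ∈ w} := finite_darts w
  let f := hm.restrict
  have hf : Function.Injective f := hm.restrict_inj.2 (faceNext_injOn hw)
  have hit : ∀ k (x : {d : Dart | d.1 ∈ w}), ((f^[k] x : _) : Dart) = (faceNext w)^[k] x := by
    intro k
    induction k with
    | zero => intro x; rfl
    | succ k ih => intro x; rw [Function.iterate_succ_apply, Function.iterate_succ_apply, ih]; rfl
  obtain ⟨k, rfl⟩ := he
  obtain ⟨m, hm0, hmp⟩ := (hf.mem_periodicPts (⟨d, hd⟩ : {d : Dart | d.1 ∈ w}))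
  have hp : ∀ j, (faceNext w)^[m * j] d = d := fun j => by
    have := (hmp.mul_const j)
    have h2 := congrArg Subtype.val (this : f^[m * j] _ = _)
    rwa [hit] at h2
  refine ⟨m * k - k, ?_⟩
  rw [← Function.iterate_add_apply, Nat.sub_add_cancel (Nat.le_mul_of_pos_left k hm0)]
  exact hp k

theorem face_eq {w : List Passage} (hw : IsGaussCode w) {d e : Dart} (hd : d.1 ∈ w)
    (he : e ∈ face w d) : face w e = face w d := by
  have key : ∀ {d e : Dart}, e ∈ face w d → face w e ⊆ face w d := by
    rintro d _ ⟨k, rfl⟩ _ ⟨l, rfl⟩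
    exact ⟨l + k, Function.iterate_add_apply ..⟩
  exact (key he).antisymm (key (face_symm hw hd he))

theorem apply_eq_of_mem_face {w : List Passage} (hw : IsGaussCode w) {χ : Dart → ZMod 2}
    (hχ : ∀ d : Dart, d.1 ∈ w → χ (faceNext w d) = χ d) {d e : Dart} (hd : d.1 ∈ w)
    (he : e ∈ face w d) : χ e = χ d := by
  obtain ⟨k, rfl⟩ := he
  induction k generalizing d with
  | zero => rfl
  | succ k ih => rw [Function.iterate_succ_apply, ih (faceNext_mem hw hd), hχ d hd]

/-- The darts of a diagram. -/
abbrev Darts (w : List Passage) : Type := {d : Dart // d.1 ∈ w}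

/-- The crossings of a diagram, each represented by its over passage. -/
abbrev OverPassages (w : List Passage) : Type := {p : Passage // p ∈ w ∧ p.isOver = true}

theorem card_overPassages {w : List Passage} (hw : IsGaussCode w) :
    Nat.card (OverPassages w) = numCrossings w := by
  classical
  have h1 : (w.toFinset.filter fun p => p.isOver = true).card =
      (w.toFinset.filter fun p => ¬ p.isOver = true).card := by
    refine Finset.card_bij (fun p _ => p.partner) ?_ (fun _ _ _ _ h => Passage.partner_injective h) ?_
    · intro p hp
      simp only [Finset.mem_filter, List.mem_toFinset] at hp ⊢
      exact ⟨hw.partner_mem _ hp.1, by simp [hp.2]⟩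
    · intro p hp
      simp only [Finset.mem_filter, List.mem_toFinset] at hp
      exact ⟨p.partner, by simpa using ⟨hw.partner_mem _ hp.1, by simpa using hp.2⟩, by simp⟩
  have h2 := Finset.card_filter_add_card_filter_not (s := w.toFinset) (fun p => p.isOver = true)
  rw [← h1, List.toFinset_card_of_nodup hw.nodup] at h2
  have h3 : Nat.card (OverPassages w) = (w.toFinset.filter fun p => p.isOver = true).card := by
    rw [← Nat.card_eq_finsetCard]
    exact Nat.card_congr (Equiv.subtypeEquivRight fun p => by simp)
  rw [h3, numCrossings]
  omega

/-- The face of a dart of the diagram, as an element of the set of faces. -/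
def faceOf (w : List Passage) (d : Darts w) : faces w := ⟨face w d, d.1, d.2, rfl⟩

/-- The boundary of a set of faces (given by its indicator function): the parity of its corners at
each crossing, and its jump across the edge that closes up the word. -/
noncomputable def faceBoundary {w : List Passage} (hw : IsGaussCode w) (h0 : w ≠ []) :
    (faces w → ZMod 2) →ₗ[ZMod 2] (OverPassages w → ZMod 2) × ZMod 2 where
  toFun φ := (fun p => φ (faceOf w ⟨(p.1, true), p.2.1⟩) + φ (faceOf w ⟨(p.1, false), p.2.1⟩) +
      φ (faceOf w ⟨(p.1.partner, true), hw.partner_mem _ p.2.1⟩) +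
      φ (faceOf w ⟨(p.1.partner, false), hw.partner_mem _ p.2.1⟩),
    φ (faceOf w ⟨((w.head h0).partner, (w.head h0).leftward),
        hw.partner_mem _ (List.head_mem h0)⟩) +
      φ (faceOf w ⟨(w.head h0, false), List.head_mem h0⟩))
  map_add' φ ψ := by
    ext <;> simp only [Pi.add_apply, Prod.fst_add, Prod.snd_add] <;> ring
  map_smul' a φ := by
    ext <;> simp only [Pi.smul_apply, Prod.smul_fst, Prod.smul_snd, smul_eq_mul, RingHom.id_apply] <;>
      ring

/-- Corner colours with a given colouring of the faces. -/
theorem exists_corners_of_faces {w : List Passage} (hw : IsGaussCode w) (h0 : w ≠ [])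
    (φ : faces w → ZMod 2) :
    ∃ (κ : ℕ → Corners) (s : SideColors), Fits κ s w s ∧
      ∀ d : Darts w, dartColor κ d = φ (faceOf w d) := by
  classical
  obtain ⟨κ, h1, h2⟩ := exists_corners hw h0
    (fun d => if h : d.1 ∈ w then φ (faceOf w ⟨d, h⟩) else 0) (by
      intro d hd
      have : faceOf w ⟨faceNext w d, faceNext_mem hw hd⟩ = faceOf w ⟨d, hd⟩ :=
        Subtype.ext (face_eq hw hd ⟨1, rfl⟩)
      simp [hd, faceNext_mem hw hd, this])
  refine ⟨κ, _, h2, fun d => ?_⟩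
  rw [h1 _ d.2]
  simp [d.2]

theorem exists_faces_of_corners {w : List Passage} (hw : IsGaussCode w) (h0 : w ≠ [])
    {κ : ℕ → Corners} {s : SideColors} (h : Fits κ s w s) :
    ∃ φ : faces w → ZMod 2, ∀ d : Darts w, φ (faceOf w d) = dartColor κ d := by
  refine ⟨fun F => dartColor κ F.2.choose, fun d => ?_⟩
  have hs := (faceOf w d).2.choose_spec
  refine apply_eq_of_mem_face hw (fun d hd => dartColor_faceNext hw h0 h hd) d.2 ?_
  have : face w d = face w ((faceOf w d).2.choose) := hs.2
  rw [this]
  exact mem_face_self ..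

theorem faceBoundary_apply {w : List Passage} (hw : IsGaussCode w) (h0 : w ≠ [])
    {κ : ℕ → Corners} {s : SideColors} (h : Fits κ s w s) {φ : faces w → ZMod 2}
    (hφ : ∀ d : Darts w, dartColor κ d = φ (faceOf w d)) :
    faceBoundary hw h0 φ = (fun p => (κ p.1.crossing).total, s.jump) := by
  have hs : sidesIn κ (w.head h0) = s := ((fits_iff_nextPassage hw.nodup h0 κ s).1 h).1
  ext p
  · simp only [faceBoundary, LinearMap.coe_mk, AddHom.coe_mk, ← hφ, total_eq_dartColor]
  · simp only [faceBoundary, LinearMap.coe_mk, AddHom.coe_mk, ← hφ, ← hs, sidesIn_eq_dartColor,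
      SideColors.jump]

/-- At a crossing with zero total, the colours beside a strand change by the jump across the other
strand. -/
theorem sidesOut_of_total_eq_zero {κ : ℕ → Corners} {p : Passage} (hp : (κ p.crossing).total = 0) :
    sidesOut κ p = (sidesIn κ p).map (· + (sidesIn κ p.partner).jump)
      (· + (sidesIn κ p.partner).jump) := by
  revert hp
  unfold sidesOut sidesIn SideColors.jump Corners.total
  cases h : p.leftward <;> simp [h] <;> intros <;> constructor <;> grind

theorem jump_eq_zero_iff {s : SideColors} : s.jump = 0 ↔ s.1 = s.2 := by
  unfold SideColors.jump
  constructor <;> intro <;> grind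

theorem Fits.sides_eq {κ : ℕ → Corners} {s t : SideColors} {l : List Passage} (h : Fits κ s l t)
    (hs : s.jump = 0) (hl : ∀ p ∈ l, (κ p.crossing).total = 0) :
    ∀ p ∈ l, (sidesIn κ p).jump = 0 := by
  induction l generalizing s with
  | nil => simp
  | cons p l ih =>
    obtain ⟨rfl, h⟩ := h
    simp only [List.mem_cons, forall_eq_or_imp] at hl ⊢
    exact ⟨hs, ih h (by rw [jump_sidesOut, hs, hl.1, add_zero]) hl.2⟩

/-- A strand does not change its colours if its crossings have zero total and the strands that it
crosses have no jump there. -/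
theorem Fits.sides_const {κ : ℕ → Corners} {s t : SideColors} {l : List Passage} (h : Fits κ s l t)
    (hl : ∀ p ∈ l, (κ p.crossing).total = 0) (hp : ∀ p ∈ l, (sidesIn κ p.partner).jump = 0) :
    t = s ∧ ∀ p ∈ l, sidesIn κ p = s ∧ sidesOut κ p = s := by
  induction l generalizing s with
  | nil => simp_all
  | cons p l ih =>
    obtain ⟨rfl, h⟩ := h
    simp only [List.mem_cons, forall_eq_or_imp] at hl hp ⊢
    have : sidesOut κ p = sidesIn κ p := by
      rw [sidesOut_of_total_eq_zero hl.1, hp.1]; simp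
    rw [this] at h
    exact ⟨(ih h hl.2 hp.2).1, ⟨trivial, this⟩, (ih h hl.2 hp.2).2⟩

/-- Only constant colourings have zero boundary: the diagram is connected. -/
theorem finrank_ker_faceBoundary {w : List Passage} (hw : IsGaussCode w) (h0 : w ≠ []) :
    Module.finrank (ZMod 2) (LinearMap.ker (faceBoundary hw h0)) = 1 := by
  have hne : Nonempty (faces w) := ⟨faceOf w ⟨(w.head h0, true), List.head_mem h0⟩⟩
  have : LinearMap.ker (faceBoundary hw h0) =
      Submodule.span (ZMod 2) {(fun _ => 1 : faces w → ZMod 2)} := by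
    apply le_antisymm
    · intro φ hφ
      obtain ⟨κ, s, h1, h2⟩ := exists_corners_of_faces hw h0 φ
      rw [LinearMap.mem_ker, faceBoundary_apply hw h0 h1 h2, Prod.mk_eq_zero] at hφ
      have ht : ∀ p ∈ w, (κ p.crossing).total = 0 := by
        intro p hp
        cases ho : p.isOver
        · exact congrFun hφ.1 ⟨p.partner, hw.partner_mem _ hp, by simp [ho]⟩
        · exact congrFun hφ.1 ⟨p, hp, ho⟩
      have hj := h1.sides_eq hφ.2 ht
      have hc := (h1.sides_const ht fun p hp => hj _ (hw.partner_mem _ hp)).2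
      have h12 := jump_eq_zero_iff.1 hφ.2
      refine Submodule.mem_span_singleton.2 ⟨s.1, funext fun F => ?_⟩
      obtain ⟨_, d, hd, rfl⟩ := F
      have hφd : dartColor κ d = φ ⟨face w d, d, hd, rfl⟩ := h2 ⟨d, hd⟩
      rw [← hφd]
      rcases d with ⟨p, _ | _⟩
      · simp [dartColor, (hc p hd).1, h12]
      · simp [dartColor, (hc p hd).2]
    · rw [Submodule.span_singleton_le_iff_mem, LinearMap.mem_ker]
      ext <;> simp [faceBoundary] <;> grind
  rw [this, finrank_span_singleton]
  exact fun h => one_ne_zero (congrFun h hne.some)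

/-- A Gauss code is planar if and only if every cycle bounds: by rank–nullity, the boundaries of
sets of faces are all cycles exactly when there are `n + 2` faces. -/
theorem isPlanar_iff_isSeparating {w : List Passage} (hw : IsGaussCode w) :
    IsPlanar w ↔ IsSeparating w := by
  classical
  rcases eq_or_ne w [] with rfl | h0
  · refine iff_of_true (Or.inl rfl) fun u z => ⟨fun _ => ⟨0, 0, 0, 0⟩, (z, 0), rfl, by simp, by simp⟩
  have : Finite (faces w) := by
    refine ((finite_darts w).image (face w)).subset ?_
    rintro _ ⟨d, hd, rfl⟩
    exact ⟨d, hd, rfl⟩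
  have : Finite (OverPassages w) := by
    refine Set.Finite.subset (w.toFinset.finite_toSet) fun p hp => ?_
    simpa using hp.1
  have := Fintype.ofFinite (faces w)
  have := Fintype.ofFinite (OverPassages w)
  have h1 := LinearMap.finrank_range_add_finrank_ker (faceBoundary hw h0)
  have h2 : Module.finrank (ZMod 2) ((OverPassages w → ZMod 2) × ZMod 2) = numCrossings w + 1 := by
    rw [Module.finrank_prod, Module.finrank_pi, Module.finrank_self, ← Nat.card_eq_fintype_card,
      card_overPassages hw]
  have h3 : Module.finrank (ZMod 2) (faces w → ZMod 2) = (faces w).ncard := by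
    rw [Module.finrank_pi, ← Nat.card_eq_fintype_card, Nat.card_coe_set_eq]
  rw [finrank_ker_faceBoundary, h3] at h1
  have h4 : IsPlanar w ↔ Function.Surjective (faceBoundary hw h0) := by
    rw [← LinearMap.range_eq_top, IsPlanar, or_iff_right h0]
    constructor
    · intro h
      exact Submodule.eq_top_of_finrank_eq (by rw [h2]; omega)
    · intro h
      rw [h, finrank_top, h2] at h1
      omega
  rw [h4]
  constructor
  · intro h u z
    obtain ⟨φ, hφ⟩ := h (fun p => u p.1.crossing, z)
    obtain ⟨κ, s, hf, hd⟩ := exists_corners_of_faces hw h0 φ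
    rw [faceBoundary_apply hw h0 hf hd, Prod.mk.injEq] at hφ
    refine ⟨κ, s, hf, fun p hp => ?_, hφ.2⟩
    cases ho : p.isOver
    · exact congrFun hφ.1 ⟨p.partner, hw.partner_mem _ hp, by simp [ho]⟩
    · exact congrFun hφ.1 ⟨p, hp, ho⟩
  · rintro h ⟨u, z⟩
    let f : ℕ → ZMod 2 := fun c =>
      if h : ∃ p : OverPassages w, p.1.crossing = c then u h.choose else 0
    obtain ⟨κ, s, hf, ht, hz⟩ := h f z
    obtain ⟨φ, hφ⟩ := exists_faces_of_corners hw h0 hf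
    refine ⟨φ, ?_⟩
    rw [faceBoundary_apply hw h0 hf fun d => (hφ d).symm]
    refine Prod.ext (funext fun p => ?_) hz
    have hex : ∃ q : OverPassages w, q.1.crossing = p.1.crossing := ⟨p, rfl⟩
    have hch : hex.choose = p := by
      have hq := hex.choose_spec
      have hs := hw.sign_eq _ hex.choose.2.1 _ p.2.1 hq
      apply Subtype.ext
      have ho := hex.choose.2.2
      have ho' := p.2.2
      rcases hx : hex.choose.1 with ⟨a, b, c⟩
      rcases hy : p.1 with ⟨a', b', c'⟩
      simp_all
    change (κ p.1.crossing).total = u p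
    rw [ht _ p.2.1]
    simp only [f, dif_pos hex, hch]

/-! ### Gauss codes and the knots they represent -/

theorem IsGaussCode.of_perm {w w' : List Passage} (hw : IsGaussCode w) (h : w.Perm w') :
    IsGaussCode w' where
  nodup := h.nodup_iff.1 hw.nodup
  partner_mem p hp := h.mem_iff.1 (hw.partner_mem p (h.mem_iff.2 hp))
  sign_eq p hp q hq := hw.sign_eq p (h.mem_iff.2 hp) q (h.mem_iff.2 hq)

theorem IsGaussCode.eq_or_eq_partner {w : List Passage} (hw : IsGaussCode w) {p q : Passage}
    (hp : p ∈ w) (hq : q ∈ w) (h : p.crossing = q.crossing) : p = q ∨ p = q.partner := by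
  have := hw.sign_eq p hp q hq h
  rcases p with ⟨c, o, s⟩
  rcases q with ⟨c', o', s'⟩
  cases o <;> cases o' <;> simp_all [Passage.partner]

theorem IsGaussCode.cons_cons {w : List Passage} (hw : IsGaussCode w) {p : Passage}
    (hp : ∀ q ∈ w, q.crossing ≠ p.crossing) : IsGaussCode (p :: p.partner :: w) where
  nodup := by
    have h1 : p ∉ w := fun h => hp _ h rfl
    have h2 : p.partner ∉ w := fun h => hp _ h rfl
    simp [h1, h2, hw.nodup, (Passage.partner_ne p).symm]
  partner_mem q hq := by
    simp only [List.mem_cons] at hq ⊢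
    rcases hq with rfl | rfl | hq
    · simp
    · simp
    · exact Or.inr (Or.inr (hw.partner_mem _ hq))
  sign_eq q hq r hr h := by
    simp only [List.mem_cons] at hq hr
    rcases hq with rfl | rfl | hq <;> rcases hr with rfl | rfl | hr
    any_goals rfl
    · exact absurd h.symm (hp _ hr)
    · exact absurd h.symm (hp _ hr)
    · exact absurd h (hp _ hq)
    · exact absurd h (hp _ hq)
    · exact hw.sign_eq _ hq _ hr h

theorem IsGaussCode.of_cons_cons {w : List Passage} {p : Passage}
    (hw : IsGaussCode (p :: p.partner :: w)) :
    IsGaussCode w ∧ ∀ q ∈ w, q.crossing ≠ p.crossing := by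
  have hn := hw.nodup
  simp only [List.nodup_cons, List.mem_cons, not_or] at hn
  have hc : ∀ q ∈ w, q.crossing ≠ p.crossing := fun q hq h => by
    rcases hw.eq_or_eq_partner (p := q) (q := p) (by simp [hq]) (by simp) h with rfl | rfl
    · exact hn.1.2 hq
    · exact hn.2.1 hq
  refine ⟨⟨hn.2.2, fun q hq => ?_, fun q hq r hr => hw.sign_eq q (by simp [hq]) r (by simp [hr])⟩, hc⟩
  have := hw.partner_mem q (by simp [hq])
  simp only [List.mem_cons] at this
  rcases this with h | h | h
  · exact absurd (congrArg Passage.crossing h) (hc q hq)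
  · exact absurd (congrArg Passage.crossing h) (hc q hq)
  · exact h

/-- The planar Gauss code `w` is a diagram of the knot `K`. -/
def Represents (w : List Passage) (K : Knot) : Prop :=
  ∃ D : KnotDiagram, D.code = w ∧ D.knot = K

theorem Represents.isGaussCode {w : List Passage} {K : Knot} (h : Represents w K) :
    IsGaussCode w := by
  obtain ⟨D, rfl, -⟩ := h; exact D.isGaussCode

theorem Represents.isSeparating {w : List Passage} {K : Knot} (h : Represents w K) :
    IsSeparating w := by
  obtain ⟨D, rfl, -⟩ := h; exact (isPlanar_iff_isSeparating D.isGaussCode).1 D.isPlanar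

theorem Represents.move {w w' : List Passage} {K : Knot} (h : Represents w K)
    (hm : ReidemeisterMove w w' ∨ ReidemeisterMove w' w) (hg : IsGaussCode w')
    (hs : IsSeparating w') : Represents w' K := by
  obtain ⟨D, rfl, rfl⟩ := h
  refine ⟨⟨w', hg, (isPlanar_iff_isSeparating hg).2 hs⟩, rfl, ?_⟩
  rcases hm with hm | hm
  · exact (Quot.sound (r := fun D D' : KnotDiagram => ReidemeisterMove D.code D'.code) hm).symm
  · exact Quot.sound (r := fun D D' : KnotDiagram => ReidemeisterMove D.code D'.code) hm

theorem Represents.rotate {u v : List Passage} {K : Knot} (h : Represents (u ++ v) K) :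
    Represents (v ++ u) K :=
  h.move (Or.inl (.rotate u v)) (h.isGaussCode.of_perm List.perm_append_comm) h.isSeparating.rotate

/-- The corners of a crossing after reversing both strands. -/
def Corners.turn (k : Corners) : Corners := ⟨k.ne, k.nw, k.se, k.sw⟩

theorem fits_reverse (κ : ℕ → Corners) (s s' : SideColors) (w : List Passage) :
    Fits (fun c => (κ c).turn) s'.swap w.reverse s.swap ↔ Fits κ s w s' := by
  induction w generalizing s with
  | nil => simp [Prod.swap_inj, eq_comm]
  | cons p w ih =>
    have h1 : sidesIn (fun c => (κ c).turn) p = (sidesOut κ p).swap := by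
      unfold sidesIn sidesOut Corners.turn; split <;> rfl
    have h2 : sidesOut (fun c => (κ c).turn) p = (sidesIn κ p).swap := by
      unfold sidesIn sidesOut Corners.turn; split <;> rfl
    simp only [List.reverse_cons, fits_append, fits_cons, fits_nil, h1, h2, Prod.swap_inj]
    constructor
    · rintro ⟨t, h, rfl, h'⟩
      exact ⟨h', (ih _).1 h⟩
    · rintro ⟨h', h⟩
      exact ⟨_, (ih _).2 h, rfl, h'⟩

theorem IsSeparating.reverse {w : List Passage} (h : IsSeparating w) : IsSeparating w.reverse := by
  intro u z
  obtain ⟨κ, s, h1, h2, h3⟩ := h u z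
  refine ⟨_, _, (fits_reverse κ s s w).2 h1, fun p hp => ?_, by rw [← h3, add_comm]; rfl⟩
  rw [← h2 p (by simpa using hp)]
  unfold Corners.turn Corners.total
  ring

theorem Represents.reverse {w : List Passage} {K : Knot} (h : Represents w K) :
    Represents w.reverse K :=
  h.move (Or.inl (.reverse w)) (h.isGaussCode.of_perm (List.reverse_perm w).symm)
    h.isSeparating.reverse

/-- The passage with its crossing relabelled by `f`. -/
def Passage.relabel (f : ℕ → ℕ) (p : Passage) : Passage := ⟨f p.crossing, p.isOver, p.isPositive⟩

theorem fits_relabel (f : ℕ → ℕ) (κ : ℕ → Corners) (s s' : SideColors) (w : List Passage) :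
    Fits κ s (w.map (Passage.relabel f)) s' ↔ Fits (κ ∘ f) s w s' := by
  induction w generalizing s with
  | nil => simp
  | cons p w ih => simp [ih, sidesIn, sidesOut, Passage.relabel, Passage.leftward]

theorem Represents.relabel {w : List Passage} {K : Knot} (h : Represents w K) {f : ℕ → ℕ}
    (hf : Function.Injective f) : Represents (w.map (Passage.relabel f)) K := by
  have hi : Function.Injective (Passage.relabel f) := by
    rintro ⟨a, b, c⟩ ⟨a', b', c'⟩ h
    simpa [Passage.relabel, hf.eq_iff] using h
  refine h.move (Or.inl (.relabel f hf w)) ⟨h.isGaussCode.nodup.map hi, ?_, ?_⟩ ?_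
  · intro p hp
    obtain ⟨q, hq, rfl⟩ := List.mem_map.1 hp
    exact List.mem_map.2 ⟨q.partner, h.isGaussCode.partner_mem q hq, rfl⟩
  · intro p hp q hq hpq
    obtain ⟨p', hp', rfl⟩ := List.mem_map.1 hp
    obtain ⟨q', hq', rfl⟩ := List.mem_map.1 hq
    exact h.isGaussCode.sign_eq p' hp' q' hq' (hf hpq)
  · intro u z
    obtain ⟨κ, s, h1, h2, h3⟩ := h.isSeparating (u ∘ f) z
    obtain ⟨g, hg⟩ := hf.hasLeftInverse
    have hκ : (κ ∘ g) ∘ f = κ := funext fun c => congrArg κ (hg c)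
    refine ⟨κ ∘ g, s, (fits_relabel f _ s s w).2 (by rwa [hκ]), fun p hp => ?_, h3⟩
    obtain ⟨q, hq, rfl⟩ := List.mem_map.1 hp
    have := h2 q hq
    simpa [Passage.relabel, hg q.crossing] using this

/-! ### Removing kinks and bigons -/

theorem IsSeparating.remove_kink {u v : List Passage} {p : Passage}
    (h : IsSeparating (u ++ p :: p.partner :: v))
    (hp : ∀ q ∈ u ++ v, q.crossing ≠ p.crossing) : IsSeparating (u ++ v) := by
  intro c z
  obtain ⟨κ, s, h1, h2, h3⟩ := h (Function.update c p.crossing 0) z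
  refine ⟨κ, s, ?_, fun q hq => ?_, h3⟩
  · simp only [fits_append, fits_cons] at h1 ⊢
    obtain ⟨t, h4, rfl, h5, h6⟩ := h1
    have h0 : (κ p.crossing).total = 0 := by rw [h2 p (by simp)]; simp
    refine ⟨_, h4, ?_⟩
    convert h6 using 1
    revert h0 h5
    unfold sidesIn sidesOut Corners.total
    cases hl : p.leftward <;> simp [hl] <;> grind
  · rw [h2 q (by grind), Function.update_of_ne (hp q hq)]

theorem Represents.remove_kink {u v : List Passage} {p : Passage} {K : Knot}
    (h : Represents (u ++ p :: p.partner :: v) K) : Represents (u ++ v) K := by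
  have hg := (h.isGaussCode.of_perm (w' := p :: p.partner :: (u ++ v)) (by grind)).of_cons_cons
  have h1 : Represents ([p, p.partner] ++ (v ++ u)) K := by
    simpa using h.rotate
  have hs : IsSeparating (v ++ u) := (h.isSeparating.remove_kink hg.2).rotate
  exact (h1.move (Or.inr (.r1 p _)) (hg.1.of_perm List.perm_append_comm) hs).rotate

theorem IsSeparating.remove_bigon {u v x : List Passage} {b : Bool} {p q : Passage}
    (ho : p.isOver = q.isOver) (hs : p.isPositive ≠ q.isPositive)
    (h : IsSeparating (u ++ [p, q] ++ v ++ seg b p.partner q.partner ++ x))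
    (hp : ∀ r ∈ u ++ v ++ x, r.crossing ≠ p.crossing ∧ r.crossing ≠ q.crossing) :
    IsSeparating (u ++ v ++ x) := by
  intro c z
  obtain ⟨κ, s, h1, h2, h3⟩ :=
    h (Function.update (Function.update c p.crossing 0) q.crossing 0) z
  refine ⟨κ, s, ?_, fun r hr => ?_, h3⟩
  · have hp0 : (κ p.crossing).total = 0 := by
      rw [h2 p (by simp)]
      by_cases hpq : p.crossing = q.crossing
      · simp [hpq]
      · simp [Function.update_of_ne hpq]
    have hq0 : (κ q.crossing).total = 0 := by
      rw [h2 q (by simp)]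
      simp
    have hl : p.leftward = !q.leftward := by
      revert ho hs
      unfold Passage.leftward
      cases p.isOver <;> cases q.isOver <;> cases p.isPositive <;> cases q.isPositive <;> simp
    simp only [List.append_assoc, fits_append] at h1 ⊢
    obtain ⟨s1, h4, s2, h5, s3, h6, s4, h7, h8⟩ := h1
    have : s1 = s2 ∧ s3 = s4 := by
      revert h5 h7 hp0 hq0
      unfold seg Corners.total
      cases b <;> cases hlq : q.leftward <;> simp [hl, hlq, sidesIn, sidesOut] <;>
        (intros; subst_vars; simp only [Prod.ext_iff]; grind)
    obtain ⟨rfl, rfl⟩ := this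
    exact ⟨_, h4, _, h6, h8⟩
  · have := hp r hr
    rw [h2 r (by grind), Function.update_of_ne this.2, Function.update_of_ne this.1]

theorem Represents.remove_bigon {u v x : List Passage} {b : Bool} {p q : Passage} {K : Knot}
    (ho : p.isOver = q.isOver) (hs : p.isPositive ≠ q.isPositive)
    (h : Represents (u ++ [p, q] ++ v ++ seg b p.partner q.partner ++ x) K) :
    Represents (u ++ v ++ x) K := by
  have hb : (seg b p.partner q.partner).Perm [p.partner, q.partner] := by
    cases b
    · exact List.Perm.swap ..
    · rfl
  have hg := (h.isGaussCode.of_perm (w' := p :: p.partner :: q :: q.partner :: (u ++ v ++ x)) (by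
    refine List.Perm.trans (l₂ := u ++ [p, q] ++ v ++ [p.partner, q.partner] ++ x) ?_ (by grind)
    grind)).of_cons_cons
  have hg' := hg.1.of_cons_cons
  have h1 : Represents ([p, q] ++ v ++ seg b p.partner q.partner ++ (x ++ u)) K := by
    have := (h : Represents (u ++ [p, q] ++ v ++ seg b p.partner q.partner ++ x) K)
    simp only [List.append_assoc] at this ⊢
    simpa using this.rotate
  have hsep := h.isSeparating.remove_bigon ho hs fun r hr =>
    ⟨hg.2 r (by grind), hg'.2 r hr⟩
  have h2 : Represents (v ++ (x ++ u)) K := h1.move (Or.inr (.r2 b p q ho hs v (x ++ u)))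
    (hg'.1.of_perm (by grind)) (by
      rw [← List.append_assoc]
      apply IsSeparating.rotate
      simpa using hsep)
  have h3 : Represents (v ++ x ++ u) K := by simpa using h2
  simpa using h3.rotate

/-! ### Sliding a crossing along a strand -/

/-- The corners of the crossing of `p` when the strand of `p` has side colours `i` before it and
`o` after it. -/
def cornersAt (p : Passage) (i o : SideColors) : Corners :=
  if p.leftward then ⟨i.1, i.2, o.1, o.2⟩ else ⟨o.1, i.1, o.2, i.2⟩

/-- When the crossing of a strand with the strand of `b` is moved past the crossing of `b`, the
moved strand crosses the strand of `b.partner` twice. This is the first of these two passages, with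
label `a` and height `o`; its sign is determined by the direction of `b`. -/
def slideFst (a : ℕ) (o : Bool) (b : Passage) : Passage := ⟨a, o, o == b.leftward⟩

/-- The second of the two passages described at `slideFst`. -/
def slideSnd (a : ℕ) (o : Bool) (b : Passage) : Passage := ⟨a, o, o == !b.leftward⟩

@[simp] theorem slideFst_leftward (a : ℕ) (o : Bool) (b : Passage) :
    (slideFst a o b).leftward = b.leftward := by
  cases o <;> simp [slideFst, Passage.leftward]
@[simp] theorem slideSnd_leftward (a : ℕ) (o : Bool) (b : Passage) :
    (slideSnd a o b).leftward = !b.leftward := by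
  cases o <;> simp [slideSnd, Passage.leftward]
@[simp] theorem slideFst_crossing (a : ℕ) (o : Bool) (b : Passage) :
    (slideFst a o b).crossing = a := rfl
@[simp] theorem slideSnd_crossing (a : ℕ) (o : Bool) (b : Passage) :
    (slideSnd a o b).crossing = a := rfl
@[simp] theorem slideFst_isOver (a : ℕ) (o : Bool) (b : Passage) :
    (slideFst a o b).isOver = o := rfl
@[simp] theorem slideSnd_isOver (a : ℕ) (o : Bool) (b : Passage) :
    (slideSnd a o b).isOver = o := rfl

/-- Planarity after the crossing of `q` has been moved past the crossing of `b`: the strand of `q`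
now passes `p`, `q`, `p'`, where `p` and `p'` are on either side of `b.partner` on the strand of
`b.partner`. -/
theorem IsSeparating.slide {A B C D : List Passage} {b q p p' : Passage} {o : Bool} {a a' : ℕ}
    (haa : a ≠ a') (hqa : q.crossing ≠ a) (hqa' : q.crossing ≠ a') (hba : b.crossing ≠ a)
    (hba' : b.crossing ≠ a') (hqb : q.crossing ≠ b.crossing)
    (hp : p = slideFst a o b) (hp' : p' = slideSnd a' o b)
    (hr : ∀ r ∈ A ++ B ++ C ++ D, r.crossing ≠ a ∧ r.crossing ≠ a' ∧ r.crossing ≠ q.crossing ∧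
      r.crossing ≠ b.crossing)
    (h : IsSeparating (A ++ b.partner :: (B ++ q :: (C ++ q.partner :: b :: D)))) :
    IsSeparating (A ++ ((if q.leftward = b.leftward then [p'.partner, b.partner, p.partner] else
      [p.partner, b.partner, p'.partner]) ++ (B ++ p :: q :: p' :: (C ++ b :: q.partner :: D)))) := by
  intro u z
  obtain ⟨κ, s, h1, h2, h3⟩ := h (fun c => if c = q.crossing then u q.crossing + u a + u a' else
    if c = b.crossing then u b.crossing + u a + u a' else u c) z
  have hq := h2 q (by simp)
  have hb := h2 b (by simp)
  simp only [if_true, hqb.symm, if_false] at hq hb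
  -- the colours around the triangle of the three strands
  let W := sidesIn κ q.partner
  let M := sidesIn κ b
  let E := sidesOut κ b
  let uN := if q.leftward then u a else u a'
  let uS := if q.leftward then u a' else u a
  let T : SideColors := (uN + M.1 + W.1 + E.1, uS + M.2 + W.2 + E.2)
  let κ' : ℕ → Corners := fun c =>
    if c = a then (if q.leftward then cornersAt p (M.1, W.1) (E.1, T.1)
      else cornersAt p (W.2, M.2) (T.2, E.2))
    else if c = a' then (if q.leftward then cornersAt p' (E.2, T.2) (M.2, W.2)
      else cornersAt p' (T.1, E.1) (W.1, M.1))
    else if c = q.crossing then cornersAt q.partner T E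
    else if c = b.crossing then cornersAt b W T
    else κ c
  have hκ : ∀ r ∈ A ++ B ++ C ++ D, κ r.crossing = κ' r.crossing := by
    intro r h
    have := hr r h
    simp [κ', this]
  have hκa : κ' a = if q.leftward then cornersAt p (M.1, W.1) (E.1, T.1)
      else cornersAt p (W.2, M.2) (T.2, E.2) := by simp [κ']
  have hκa' : κ' a' = if q.leftward then cornersAt p' (E.2, T.2) (M.2, W.2)
      else cornersAt p' (T.1, E.1) (W.1, M.1) := by simp [κ', haa.symm]
  have hκq : κ' q.crossing = cornersAt q.partner T E := by simp [κ', hqa, hqa']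
  have hκb : κ' b.crossing = cornersAt b W T := by simp [κ', hba, hba', hqb.symm]
  have hlp : p.leftward = b.leftward := by simp [hp]
  have hlp' : p'.leftward = !b.leftward := by simp [hp']
  have hcp : p.crossing = a := by simp [hp]
  have hcp' : p'.crossing = a' := by simp [hp']
  clear_value κ'
  have h4 := h1
  simp only [fits_append, fits_cons] at h4
  obtain ⟨s1, hA, hb', s2, hB, hq', s3, hC, hqq, hqb', hD⟩ := h4
  clear h1 h
  refine ⟨κ', s, ?_, ?_, h3⟩
  · rw [fits_congr (κ' := κ') (fun r h => hκ r (by simp [h]))] at hA hB hC hD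
    subst hb' hq' hqq
    simp only [fits_append, fits_cons]
    clear hr h2 h3
    have e1 : Fits κ' (sidesIn κ b.partner) (if q.leftward = b.leftward then
        [p'.partner, b.partner, p.partner] else [p.partner, b.partner, p'.partner])
        (sidesOut κ b.partner) ∧ sidesIn κ' p = sidesIn κ q ∧ sidesIn κ' q = sidesOut κ' p ∧
        sidesIn κ' p' = sidesOut κ' q ∧ sidesOut κ' p' = sidesOut κ q ∧
        sidesIn κ' b = sidesIn κ q.partner ∧ sidesIn κ' q.partner = sidesOut κ' b ∧
        sidesOut κ' q.partner = sidesOut κ b := by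
      clear hB hC hD
      revert hq hb hqb'
      unfold Corners.total
      cases hlq : q.leftward <;> cases hlb : b.leftward <;>
        simp only [W, M, E, T, uN, uS, fits_cons, fits_nil, sidesIn, sidesOut, hκa, hκa', hκq, hκb,
          hlp, hlp', hlq, hlb, hcp, hcp', cornersAt, Passage.partner_leftward,
          Passage.partner_crossing, Bool.not_true, Bool.not_false, if_true, if_false, Prod.ext_iff,
          Bool.false_eq_true, reduceCtorEq] <;>
        clear hκa hκa' hκq hκb hκ <;> intros <;> grind
    obtain ⟨e0, e1, e2, e3, e4, e5, e6, e7⟩ := e1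
    exact ⟨_, by assumption, _, e0, _, hB, e1, e2, e3, _, e4 ▸ hC, e5, e6, e7 ▸ hD⟩
  · have e : (κ' a).total = u a ∧ (κ' a').total = u a' ∧ (κ' q.crossing).total = u q.crossing ∧
        (κ' b.crossing).total = u b.crossing := by
      clear hb' hB hA hC hD hκ hr h2
      revert hq hb hqb'
      unfold Corners.total
      cases hlq : q.leftward <;> cases hlb : b.leftward <;>
        simp only [W, M, E, T, uN, uS, sidesIn, sidesOut, hκa, hκa', hκq, hκb,
          hlp, hlp', hlq, hlb, cornersAt, Passage.partner_leftward,
          Passage.partner_crossing, Bool.not_true, Bool.not_false, if_true, if_false, Prod.ext_iff,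
          Bool.false_eq_true] <;>
        clear hκa hκa' hκq hκb <;> intros <;> grind
    intro r hr'
    have : r.crossing = a ∨ r.crossing = a' ∨ r.crossing = q.crossing ∨ r.crossing = b.crossing ∨
        r ∈ A ++ B ++ C ++ D := by
      clear hκa hκa' hκq hκb e hκ h2
      split at hr' <;> simp only [List.mem_append, List.mem_cons, List.not_mem_nil, or_false] at hr' ⊢
      all_goals
        rcases hr' with h | (rfl | rfl | rfl) | h | rfl | rfl | rfl | h | rfl | rfl | h <;> simp [*]
    rcases this with h | h | h | h | h
    · rw [h, e.1]
    · rw [h, e.2.1]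
    · rw [h, e.2.2.1]
    · rw [h, e.2.2.2]
    · rw [← hκ r h, h2 r (by simp only [List.mem_append, List.mem_cons] at h ⊢; tauto)]
      have := hr r h
      simp [this]

/-- The bigon that precedes a slide: the strand of `q` is first pushed over the strand of
`b.partner`, on the near side of the strand that both of them cross. -/
theorem IsSeparating.finger {A B C D : List Passage} {b q p p' : Passage} {o : Bool} {a a' : ℕ}
    (haa : a ≠ a') (hqa : q.crossing ≠ a) (hqa' : q.crossing ≠ a') (hba : b.crossing ≠ a)
    (hba' : b.crossing ≠ a') (hqb : q.crossing ≠ b.crossing)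
    (hp : p = slideFst a o b) (hp' : p' = slideSnd a' o b)
    (hr : ∀ r ∈ A ++ B ++ C ++ D, r.crossing ≠ a ∧ r.crossing ≠ a' ∧ r.crossing ≠ q.crossing ∧
      r.crossing ≠ b.crossing)
    (h : IsSeparating (A ++ b.partner :: (B ++ q :: (C ++ q.partner :: b :: D)))) :
    IsSeparating (A ++ ((if q.leftward = b.leftward then [b.partner, p'.partner, p.partner] else
      [p.partner, p'.partner, b.partner]) ++ (B ++ p :: p' :: q :: (C ++ q.partner :: b :: D)))) := by
  intro u z
  obtain ⟨κ, s, h1, h2, h3⟩ := h (fun c => if c = q.crossing then u q.crossing + u a + u a' else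
    if c = b.crossing then u b.crossing + u a + u a' else u c) z
  have hq := h2 q (by simp)
  have hb := h2 b (by simp)
  simp only [if_true, hqb.symm, if_false] at hq hb
  -- the old colours near the site, and the new ones of the bigon and of the triangle
  let W := sidesIn κ q.partner
  let M := sidesIn κ b
  let E := sidesOut κ b
  let T : ZMod 2 := (if q.leftward then M.1 else M.2) + u a + u a'
  let G : ZMod 2 := if q.leftward then u a + M.1 + W.1 + E.1 else u a + M.2 + W.2 + E.2
  let M' : SideColors := if q.leftward then (T, M.2) else (M.1, T)
  let κ' : ℕ → Corners := fun c =>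
    if c = a then (if q.leftward then cornersAt p (M.1, W.1) (E.1, G)
      else cornersAt p (W.2, M.2) (G, E.2))
    else if c = a' then (if q.leftward then cornersAt p' (E.1, G) (T, W.1)
      else cornersAt p' (G, E.2) (W.2, T))
    else if c = q.crossing then cornersAt q.partner W M'
    else if c = b.crossing then cornersAt b M' E
    else κ c
  have hκ : ∀ r ∈ A ++ B ++ C ++ D, κ r.crossing = κ' r.crossing := by
    intro r h
    have := hr r h
    simp [κ', this]
  have hκa : κ' a = if q.leftward then cornersAt p (M.1, W.1) (E.1, G)
      else cornersAt p (W.2, M.2) (G, E.2) := by simp [κ']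
  have hκa' : κ' a' = if q.leftward then cornersAt p' (E.1, G) (T, W.1)
      else cornersAt p' (G, E.2) (W.2, T) := by simp [κ', haa.symm]
  have hκq : κ' q.crossing = cornersAt q.partner W M' := by simp [κ', hqa, hqa']
  have hκb : κ' b.crossing = cornersAt b M' E := by simp [κ', hba, hba', hqb.symm]
  have hlp : p.leftward = b.leftward := by simp [hp]
  have hlp' : p'.leftward = !b.leftward := by simp [hp']
  have hcp : p.crossing = a := by simp [hp]
  have hcp' : p'.crossing = a' := by simp [hp']
  clear_value κ'
  have h4 := h1
  simp only [fits_append, fits_cons] at h4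
  obtain ⟨s1, hA, hb', s2, hB, hq', s3, hC, hqq, hqb', hD⟩ := h4
  clear h1 h
  refine ⟨κ', s, ?_, ?_, h3⟩
  · rw [fits_congr (κ' := κ') (fun r h => hκ r (by simp [h]))] at hA hB hC hD
    subst hb' hq' hqq
    simp only [fits_append, fits_cons]
    clear hr h2 h3
    have e1 : Fits κ' (sidesIn κ b.partner) (if q.leftward = b.leftward then
        [b.partner, p'.partner, p.partner] else [p.partner, p'.partner, b.partner])
        (sidesOut κ b.partner) ∧ sidesIn κ' p = sidesIn κ q ∧ sidesIn κ' p' = sidesOut κ' p ∧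
        sidesIn κ' q = sidesOut κ' p' ∧ sidesOut κ' q = sidesOut κ q ∧
        sidesIn κ' q.partner = sidesIn κ q.partner ∧ sidesIn κ' b = sidesOut κ' q.partner ∧
        sidesOut κ' b = sidesOut κ b := by
      clear hB hC hD
      revert hq hb hqb'
      unfold Corners.total
      cases hlq : q.leftward <;> cases hlb : b.leftward <;>
        simp only [W, M, E, T, G, M', fits_cons, fits_nil, sidesIn, sidesOut, hκa, hκa', hκq, hκb,
          hlp, hlp', hlq, hlb, hcp, hcp', cornersAt, Passage.partner_leftward,
          Passage.partner_crossing, Bool.not_true, Bool.not_false, if_true, if_false, Prod.ext_iff,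
          Bool.false_eq_true, reduceCtorEq] <;>
        clear hκa hκa' hκq hκb hκ <;> intros <;> grind
    obtain ⟨e0, e1, e2, e3, e4, e5, e6, e7⟩ := e1
    exact ⟨_, by assumption, _, e0, _, hB, e1, e2, e3, _, e4 ▸ hC, e5, e6, e7 ▸ hD⟩
  · have e : (κ' a).total = u a ∧ (κ' a').total = u a' ∧ (κ' q.crossing).total = u q.crossing ∧
        (κ' b.crossing).total = u b.crossing := by
      clear hb' hB hA hC hD hκ hr h2
      revert hq hb hqb'
      unfold Corners.total
      cases hlq : q.leftward <;> cases hlb : b.leftward <;>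
        simp only [W, M, E, T, G, M', sidesIn, sidesOut, hκa, hκa', hκq, hκb,
          hlp, hlp', hlq, hlb, cornersAt, Passage.partner_leftward,
          Passage.partner_crossing, Bool.not_true, Bool.not_false, if_true, if_false, Prod.ext_iff,
          Bool.false_eq_true] <;>
        clear hκa hκa' hκq hκb <;> intros <;> grind
    intro r hr'
    have : r.crossing = a ∨ r.crossing = a' ∨ r.crossing = q.crossing ∨ r.crossing = b.crossing ∨
        r ∈ A ++ B ++ C ++ D := by
      clear hκa hκa' hκq hκb e hκ h2
      split at hr' <;> simp only [List.mem_append, List.mem_cons, List.not_mem_nil, or_false] at hr' ⊢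
      all_goals
        rcases hr' with h | (rfl | rfl | rfl) | h | rfl | rfl | rfl | h | rfl | rfl | h <;> simp [*]
    rcases this with h | h | h | h | h
    · rw [h, e.1]
    · rw [h, e.2.1]
    · rw [h, e.2.2.1]
    · rw [h, e.2.2.2]
    · rw [← hκ r h, h2 r (by simp only [List.mem_append, List.mem_cons] at h ⊢; tauto)]
      have := hr r h
      simp [this]

theorem Represents.of_rotate {w w' : List Passage} {K : Knot} (h : Represents w K)
    (u v : List Passage) (h1 : w = u ++ v) (h2 : w' = v ++ u) : Represents w' K := by
  subst h1 h2; exact h.rotate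

theorem IsSeparating.of_rotate {w w' : List Passage} (h : IsSeparating w)
    (u v : List Passage) (h1 : w = u ++ v) (h2 : w' = v ++ u) : IsSeparating w' := by
  subst h1 h2; exact h.rotate

theorem seg_swap (e : Bool) (x y : Passage) : seg e x y = seg (!e) y x := by
  cases e <;> rfl

/-- The move of type III on the triangle of the strands of `q`, `q.partner` and `b.partner`, of
which the first one is on top of the other two or below them. The moves of type III start with the
top strand, so the code has to be rotated when that strand is not the one of `q`. -/
theorem Represents.triangle {C D B : List Passage} {b q p : Passage} {e : Bool} {K : Knot}
    (ho : p.isOver = q.isOver) (hp : p.isPositive = (q.isOver == !b.leftward))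
    (he : e = (q.leftward != b.leftward))
    (h : Represents ([p, q] ++ C ++ [q.partner, b] ++ D ++ seg e p.partner b.partner ++ B) K)
    (hG : IsGaussCode ([q, p] ++ C ++ [b, q.partner] ++ D ++ seg (!e) p.partner b.partner ++ B))
    (hs : IsSeparating ([q, p] ++ C ++ [b, q.partner] ++ D ++ seg (!e) p.partner b.partner ++ B)) :
    Represents ([q, p] ++ C ++ [b, q.partner] ++ D ++ seg (!e) p.partner b.partner ++ B) K := by
  unfold Passage.leftward at hp he
  cases hq : q.isOver <;> cases hb : b.isOver
  -- if the strand of `q` is the bottom one, bring the top strand to the front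
  · have h1 := h.of_rotate (w' := seg (!e) b.partner p.partner ++ B ++ seg true p q ++ C ++
        seg false b q.partner ++ D)
        ([p, q] ++ C ++ [q.partner, b] ++ D) (seg e p.partner b.partner ++ B) (by simp)
        (by rw [seg_swap e]; simp [seg])
    have h2 := h1.move (w' := seg e b.partner p.partner ++ B ++ seg false p q ++ C ++
        seg true b q.partner ++ D) (Or.inl (by
          have := ReidemeisterMove.r3' (!e) false true b.partner p.partner q.partner (by simp [hb])
            (by simp [ho, hq]) (by simp [hq]) (by
              simp only [Passage.partner_isPositive, hp, hq, hb]; cases b.isPositive <;> simp)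
            (by simp only [Passage.partner_isPositive, he, hq, hb]
                cases b.isPositive <;> cases q.isPositive <;> simp) B C D
          simpa using this))
        (hG.of_perm (List.perm_iff_count.2 fun x => by
          rw [seg_swap (!e), Bool.not_not]
          simp only [seg, List.count_append, List.count_cons, List.count_nil, if_true, if_false,
            Bool.false_eq_true]; ring))
        (hs.of_rotate ([q, p] ++ C ++ [b, q.partner] ++ D) (seg (!e) p.partner b.partner ++ B) (by simp)
          (by rw [seg_swap (!e)]; simp [seg]))
    exact h2.of_rotate (seg e b.partner p.partner ++ B)
        (seg false p q ++ C ++ seg true b q.partner ++ D) (by simp)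
        (by rw [seg_swap (!e)]; simp [seg])
  · have h1 := h.of_rotate (w' := seg false b q.partner ++ D ++
        seg (!e) b.partner p.partner ++ B ++ seg false q p ++ C)
        ([p, q] ++ C) ([q.partner, b] ++ D ++ seg e p.partner b.partner ++ B) (by simp)
        (by rw [seg_swap e]; simp [seg])
    have h2 := h1.move (w' := seg true b q.partner ++ D ++
        seg e b.partner p.partner ++ B ++ seg true q p ++ C) (Or.inl (by
          have := ReidemeisterMove.r3 false (!e) false b q.partner p.partner (by simp [hb])
            (by simp [hq]) (by simp [ho, hq])
            (by simp only [Passage.partner_isPositive, he, hq, hb]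
                cases b.isPositive <;> cases q.isPositive <;> simp) (by
              simp only [Passage.partner_isPositive, hp, hq, hb]; cases b.isPositive <;> simp) D B C
          simpa using this))
        (hG.of_perm (List.perm_iff_count.2 fun x => by
          rw [seg_swap (!e), Bool.not_not]
          simp only [seg, List.count_append, List.count_cons, List.count_nil, if_true]; ring))
        (hs.of_rotate ([q, p] ++ C) ([b, q.partner] ++ D ++ seg (!e) p.partner b.partner ++ B)
          (by simp) (by rw [seg_swap (!e)]; simp [seg]))
    exact h2.of_rotate (seg true b q.partner ++ D ++ seg e b.partner p.partner ++ B)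
        (seg true q p ++ C) (by simp) (by rw [seg_swap (!e)]; simp [seg])
  · refine h.move (Or.inl ?_) hG hs
    have := ReidemeisterMove.r3' true e true p q b.partner (by simp [ho, hq]) hq (by simp [hb])
      (by simp only [hp, he, hq, hb]; cases b.isPositive <;> cases q.isPositive <;> simp)
      (by simp only [Passage.partner_isPositive, hp, hq, hb]; cases b.isPositive <;> simp) C D B
    simpa [seg] using this
  · refine h.move (Or.inl ?_) hG hs
    have := ReidemeisterMove.r3 false true e q p b hq (by simp [ho, hq]) hb
      (by simp only [hp, he, hq, hb]; cases b.isPositive <;> cases q.isPositive <;> simp)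
      (by simp only [he, hq, hb]; cases b.isPositive <;> cases q.isPositive <;> simp) C D B
    simpa [seg] using this

/-- The crossing of `q` moves past the crossing of `b` along the strand of `q.partner` and `b`, by a
move of type II followed by a move of type III. -/
theorem Represents.slide {A B C D : List Passage} {b q : Passage} {a a' : ℕ} {K : Knot}
    (h : Represents (A ++ b.partner :: (B ++ q :: (C ++ q.partner :: b :: D))) K) (haa : a ≠ a')
    (hf : ∀ r ∈ A ++ b.partner :: (B ++ q :: (C ++ q.partner :: b :: D)),
      r.crossing ≠ a ∧ r.crossing ≠ a') :
    Represents (A ++ ((if q.leftward = b.leftward then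
        [(slideSnd a' q.isOver b).partner, b.partner, (slideFst a q.isOver b).partner] else
        [(slideFst a q.isOver b).partner, b.partner, (slideSnd a' q.isOver b).partner]) ++
      (B ++ slideFst a q.isOver b :: q :: slideSnd a' q.isOver b ::
        (C ++ b :: q.partner :: D)))) K := by
  have hg := h.isGaussCode
  have hg1 := (hg.of_perm (w' := q :: q.partner :: b :: b.partner :: (A ++ B ++ C ++ D))
    (List.perm_iff_count.2 fun x => by
      simp only [List.count_append, List.count_cons]; ring)).of_cons_cons
  have hg2 := hg1.1.of_cons_cons
  have hq := hf q (by simp)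
  have hb := hf b (by simp)
  have hr : ∀ r ∈ A ++ B ++ C ++ D, r.crossing ≠ a ∧ r.crossing ≠ a' ∧ r.crossing ≠ q.crossing ∧
      r.crossing ≠ b.crossing := fun r hr' => by
    have h1 := hf r (by simp only [List.mem_append, List.mem_cons] at hr' ⊢; tauto)
    exact ⟨h1.1, h1.2, hg1.2 r (List.mem_cons_of_mem _ (List.mem_cons_of_mem _ hr')), hg2.2 r hr'⟩
  have hqb : q.crossing ≠ b.crossing := (hg1.2 b (by simp)).symm
  have hs1 := h.isSeparating.finger haa hq.1 hq.2 hb.1 hb.2 hqb rfl rfl hr (o := q.isOver)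
  have hs2 := h.isSeparating.slide haa hq.1 hq.2 hb.1 hb.2 hqb rfl rfl hr (o := q.isOver)
  have hpp : (slideFst a q.isOver b).isPositive ≠ (slideSnd a' q.isOver b).isPositive := by
    cases h1 : q.isOver <;> cases h2 : b.leftward <;> simp [slideFst, slideSnd, h2]
  have hpo : (slideFst a q.isOver b).isOver = (slideSnd a' q.isOver b).isOver := rfl
  have hG := (hg.cons_cons (p := slideSnd a' q.isOver b) fun r h => (hf r h).2).cons_cons
    (p := slideFst a q.isOver b) (by
      intro r hr
      simp only [List.mem_cons] at hr
      rcases hr with rfl | rfl | hr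
      · exact haa.symm
      · exact haa.symm
      · exact (hf r hr).1)
  have ho' : (slideSnd a' q.isOver b).isOver = q.isOver := rfl
  have hp' : (slideSnd a' q.isOver b).isPositive = (q.isOver == !b.leftward) := rfl
  generalize slideFst a q.isOver b = p at *
  generalize slideSnd a' q.isOver b = p' at *
  by_cases hl : q.leftward = b.leftward
  · simp only [if_pos hl] at hs1 hs2 ⊢
    have h1 := h.of_rotate (w' := (q :: (C ++ q.partner :: b :: (D ++ A ++ [b.partner]))) ++ B)
      (A ++ b.partner :: B) (q :: (C ++ q.partner :: b :: D)) (by simp) (by simp)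
    have h2 := h1.move (Or.inl (.r2 false p p' hpo hpp _ _)) (hG.of_perm (List.perm_iff_count.2
        fun x => by
          simp only [seg, List.count_append, List.count_cons, List.count_nil, if_false,
            Bool.false_eq_true]; ring))
      (hs1.of_rotate (A ++ b.partner :: p'.partner :: p.partner :: B)
        (p :: p' :: q :: (C ++ q.partner :: b :: D)) (by simp) (by simp [seg]))
    have h3 := (h2.of_rotate (w' := [p', q] ++ C ++ [q.partner, b] ++ (D ++ A) ++
        seg false p'.partner b.partner ++ (p.partner :: B ++ [p])) [p]
        (p' :: q :: C ++ q.partner :: b :: (D ++ A ++ b.partner :: p'.partner :: p.partner :: B))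
        (by simp [seg]) (by simp [seg])).triangle ho' hp' (by simp [hl])
      (hG.of_perm (List.perm_iff_count.2 fun x => by
        simp only [seg, List.count_append, List.count_cons, List.count_nil, if_true,
            Bool.not_false]; ring))
      (hs2.of_rotate (A ++ p'.partner :: b.partner :: p.partner :: B ++ [p])
        (q :: p' :: (C ++ b :: q.partner :: D)) (by simp) (by simp [seg]))
    exact h3.of_rotate (q :: p' :: (C ++ b :: q.partner :: D))
      (A ++ p'.partner :: b.partner :: p.partner :: B ++ [p]) (by simp [seg]) (by simp)
  · simp only [if_neg hl] at hs1 hs2 ⊢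
    have h1 := h.of_rotate (w' := (q :: (C ++ q.partner :: b :: (D ++ A))) ++ b.partner :: B)
      (A ++ b.partner :: B) (q :: (C ++ q.partner :: b :: D)) (by simp) (by simp)
    have h2 := h1.move (Or.inl (.r2 true p p' hpo hpp _ _)) (hG.of_perm (List.perm_iff_count.2
        fun x => by
          simp only [seg, List.count_append, List.count_cons, List.count_nil, if_true]; ring))
      (hs1.of_rotate (A ++ p.partner :: p'.partner :: b.partner :: B)
        (p :: p' :: q :: (C ++ q.partner :: b :: D)) (by simp) (by simp [seg]))
    have h3 := (h2.of_rotate (w' := [p', q] ++ C ++ [q.partner, b] ++ (D ++ A ++ [p.partner]) ++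
        seg true p'.partner b.partner ++ (B ++ [p])) [p]
        (p' :: q :: C ++ q.partner :: b :: (D ++ A ++ p.partner :: p'.partner :: b.partner :: B))
        (by simp [seg]) (by simp [seg])).triangle ho' hp' (by
          revert hl; cases q.leftward <;> cases b.leftward <;> simp)
      (hG.of_perm (List.perm_iff_count.2 fun x => by
        simp only [seg, List.count_append, List.count_cons, List.count_nil, if_false,
            Bool.not_true, Bool.false_eq_true]; ring))
      (hs2.of_rotate (A ++ p.partner :: b.partner :: p'.partner :: B ++ [p])
        (q :: p' :: (C ++ b :: q.partner :: D)) (by simp) (by simp [seg]))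
    exact h3.of_rotate (q :: p' :: (C ++ b :: q.partner :: D))
      (A ++ p.partner :: b.partner :: p'.partner :: B ++ [p]) (by simp [seg]) (by simp)

/-! ### Moving an over- or underpass -/

/-- The code `L ++ O ++ R` is a diagram of `K` that consists of two strands `L` and `R` without
crossings of their own, joined by a strand `O` that runs above everything (`o = true`) or below
everything (`o = false`). Removing `O` and its crossings leaves the strands `L₀` and `R₀`. -/
structure Overpass (K : Knot) (o : Bool) (L₀ R₀ L O R : List Passage) : Prop where
  represents : Represents (L ++ O ++ R) K
  isOver_eq : ∀ p ∈ O, p.isOver = o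
  left_simple : ∀ p ∈ L, p.partner ∉ L
  right_simple : ∀ p ∈ R, p.partner ∉ R
  filter_left : L.filter (fun p => p.partner ∉ O) = L₀
  filter_right : R.filter (fun p => p.partner ∉ O) = R₀

theorem exists_fresh (w : List Passage) : ∃ a a' : ℕ, a ≠ a' ∧
    ∀ r ∈ w, r.crossing ≠ a ∧ r.crossing ≠ a' := by
  obtain ⟨a, ha⟩ := Infinite.exists_notMem_finset (w.map Passage.crossing).toFinset
  obtain ⟨a', ha'⟩ := Infinite.exists_notMem_finset (insert a (w.map Passage.crossing).toFinset)
  simp only [List.mem_toFinset, List.mem_map, not_exists, not_and, Finset.mem_insert, not_or] at ha ha'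
  exact ⟨a, a', fun h => ha'.1 h.symm, fun r hr => ⟨ha r hr, ha'.2 r hr⟩⟩

/-- A crossing of the overpass with `R` moves past the following crossing of `R`, if that one is
with `L`. -/
theorem Overpass.slide {K : Knot} {o : Bool} {L₀ R₀ L Oa Ob α β : List Passage} {q b : Passage}
    (h : Overpass K o L₀ R₀ L (Oa ++ q :: Ob) (α ++ q.partner :: b :: β)) (hb : b.partner ∈ L) :
    ∃ (L' : List Passage) (p p' : Passage),
      Overpass K o L₀ R₀ L' (Oa ++ p :: q :: p' :: Ob) (α ++ b :: q.partner :: β) ∧ L ⊆ L' := by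
  obtain ⟨A, B, rfl⟩ := List.append_of_mem hb
  obtain ⟨a, a', haa, hf⟩ := exists_fresh
    (A ++ b.partner :: B ++ (Oa ++ q :: Ob) ++ (α ++ q.partner :: b :: β))
  have hw := h.represents
  have e : A ++ b.partner :: B ++ (Oa ++ q :: Ob) ++ (α ++ q.partner :: b :: β) =
    A ++ b.partner :: (B ++ Oa ++ q :: (Ob ++ α ++ q.partner :: b :: β)) := by simp
  have hf' := hf
  rw [e] at hw hf'
  have hg := hw.isGaussCode.nodup
  have h1 := hw.slide haa hf'
  have hpq : q.isOver = o := h.isOver_eq q (by simp)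
  have hp : (slideFst a q.isOver b).isOver = o := by simp [hpq]
  have hp' : (slideSnd a' q.isOver b).isOver = o := by simp [hpq]
  have hc : ∀ r ∈ A ++ b.partner :: B ++ (Oa ++ q :: Ob) ++ (α ++ q.partner :: b :: β),
      ∀ r', r'.crossing = r.crossing → r' ≠ slideFst a q.isOver b ∧ r' ≠ slideSnd a' q.isOver b ∧
      r' ≠ (slideFst a q.isOver b).partner ∧ r' ≠ (slideSnd a' q.isOver b).partner := by
    intro r hr r' hrr
    have := hf r hr
    rw [← hrr] at this
    refine ⟨?_, ?_, ?_, ?_⟩ <;> rintro rfl <;> simp at this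
  have hpp : slideFst a q.isOver b ≠ (slideSnd a' q.isOver b).partner := fun h =>
    haa (congrArg Passage.crossing h)
  generalize slideFst a q.isOver b = p at *
  generalize slideSnd a' q.isOver b = p' at *
  obtain ⟨M, hM, hrep⟩ : ∃ M, (M = [p'.partner, b.partner, p.partner] ∨
      M = [p.partner, b.partner, p'.partner]) ∧
      Represents (A ++ (M ++ (B ++ Oa ++ p :: q :: p' :: (Ob ++ α ++ b :: q.partner :: β)))) K := by
    refine ⟨_, ?_, h1⟩
    split <;> simp
  have hls := h.left_simple
  have hrs := h.right_simple
  have hfl := h.filter_left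
  have hfr := h.filter_right
  clear h1 hw hf hf'
  have hL : ∀ r, r ∈ A ++ M ++ B ↔ r ∈ A ++ b.partner :: B ∨ r = p.partner ∨ r = p'.partner := by
    intro r
    rcases hM with rfl | rfl <;> simp only [List.mem_append, List.mem_cons, List.not_mem_nil] <;> tauto
  have hO : ∀ r, r ∈ Oa ++ p :: q :: p' :: Ob ↔ r ∈ Oa ++ q :: Ob ∨ r = p ∨ r = p' := by
    intro r
    simp only [List.mem_append, List.mem_cons]; tauto
  have hR : ∀ r, r ∈ α ++ b :: q.partner :: β ↔ r ∈ α ++ q.partner :: b :: β := by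
    intro r
    simp only [List.mem_append, List.mem_cons]; tauto
  have hO' : ∀ r ∈ A ++ b.partner :: B ++ (Oa ++ q :: Ob) ++ (α ++ q.partner :: b :: β),
      (r.partner ∉ Oa ++ p :: q :: p' :: Ob ↔ r.partner ∉ Oa ++ q :: Ob) := by
    intro r hr
    have := hc r hr r.partner rfl
    rw [hO]
    tauto
  refine ⟨A ++ M ++ B, p, p', ⟨by simpa using hrep, ?_, ?_, ?_, ?_, ?_⟩, ?_⟩
  · intro r hr
    rcases (hO r).1 hr with hr | rfl | rfl
    · exact h.isOver_eq r hr
    · exact hp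
    · exact hp'
  · intro r hr hr'
    rw [hL] at hr hr'
    rcases hr with hr | rfl | rfl <;> rcases hr' with hr' | hr' | hr'
    · exact hls r hr hr'
    · exact (hc r (by simp only [List.mem_append] at hr ⊢; tauto) r.partner rfl).2.2.1 hr'
    · exact (hc r (by simp only [List.mem_append] at hr ⊢; tauto) r.partner rfl).2.2.2 hr'
    · exact (hc _ (by simp only [List.mem_append] at hr' ⊢; tauto) _ rfl).1 (by simp)
    · exact Passage.partner_ne _ hr'
    · exact hpp (by simpa using hr')
    · exact (hc _ (by simp only [List.mem_append] at hr' ⊢; tauto) _ rfl).2.1 (by simp)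
    · exact hpp (by simpa using congrArg Passage.partner hr'.symm)
    · exact Passage.partner_ne _ hr'
  · intro r hr hr'
    rw [hR] at hr hr'
    exact hrs r hr hr'
  · have h1 : (A ++ M ++ B).filter (fun r => r.partner ∉ Oa ++ p :: q :: p' :: Ob) =
        (A ++ b.partner :: B).filter (fun r => r.partner ∉ Oa ++ p :: q :: p' :: Ob) := by
      rcases hM with rfl | rfl <;> simp [List.filter_append, List.filter_cons]
    rw [h1, ← hfl]
    refine List.filter_congr fun r hr => ?_
    simp only [decide_eq_decide]
    exact hO' r (by simp only [List.mem_append] at hr ⊢; tauto)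
  · have h1 : (α ++ b :: q.partner :: β).filter (fun r => r.partner ∉ Oa ++ p :: q :: p' :: Ob) =
        (α ++ q.partner :: b :: β).filter (fun r => r.partner ∉ Oa ++ p :: q :: p' :: Ob) := by
      simp [List.filter_append, List.filter_cons]
    rw [h1, ← hfr]
    refine List.filter_congr fun r hr => ?_
    simp only [decide_eq_decide]
    exact hO' r (by simp only [List.mem_append] at hr ⊢; tauto)
  · intro r hr
    exact (hL r).2 (Or.inl hr)

/-- The crossing of `q` moves along `R` to its end, past crossings with `L` only, and then around to
the beginning of `L`. -/
theorem Overpass.flip {K : Knot} {o : Bool} {L₀ R₀ L Oa Ob α β : List Passage} {q : Passage}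
    (h : Overpass K o L₀ R₀ L (Oa ++ q :: Ob) (α ++ q.partner :: β)) (hβ : ∀ b ∈ β, b.partner ∈ L) :
    ∃ L' U V : List Passage, Overpass K o L₀ R₀ (q.partner :: L') (Oa ++ U ++ q :: V ++ Ob) (α ++ β) ∧
      U.length = β.length ∧ V.length = β.length := by
  induction β generalizing L Oa Ob α with
  | nil =>
    have hw := h.represents
    have hg := hw.isGaussCode.nodup
    have hq : q ∉ L ∧ q ∉ α := by grind
    refine ⟨L, [], [], ⟨?_, by simpa using h.isOver_eq, ?_, ?_, ?_, ?_⟩, rfl, rfl⟩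
    · exact hw.of_rotate (L ++ (Oa ++ q :: Ob) ++ α) [q.partner] (by simp) (by simp)
    · have := h.left_simple
      intro p hp hp'
      simp only [List.mem_cons] at hp hp'
      rcases hp with rfl | hp <;> rcases hp' with hp' | hp'
      · exact Passage.partner_ne _ hp'
      · exact hq.1 (by simpa using hp')
      · exact hq.1 (by rwa [← Passage.partner_injective hp'])
      · exact this p hp hp'
    · have := h.right_simple
      grind
    · have := h.filter_left
      simpa [List.filter_cons] using this
    · have := h.filter_right
      simpa [List.filter_append, List.filter_cons] using this
  | cons b β ih =>
    obtain ⟨L', p, p', h1, h2⟩ := h.slide (hβ b (by simp))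
    have h3 : Overpass K o L₀ R₀ L' ((Oa ++ [p]) ++ q :: (p' :: Ob)) ((α ++ [b]) ++ q.partner :: β) := by
      simpa using h1
    obtain ⟨L'', U, V, h4, h5, h6⟩ := ih h3 fun x hx => h2 (hβ x (by simp [hx]))
    exact ⟨L'', p :: U, V ++ [p'], by simpa using h4, by simp [h5], by simp [h6]⟩

theorem Overpass.mem_left_of_mem_right {K : Knot} {o : Bool} {L₀ R₀ L O R : List Passage} {p : Passage}
    (h : Overpass K o L₀ R₀ L O R) (hp : p ∈ R) (hp' : p.partner ∉ O) : p.partner ∈ L := by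
  have h1 := h.represents.isGaussCode.partner_mem p (by simp [hp])
  have h2 := h.right_simple p hp
  simp only [List.mem_append] at h1
  tauto

theorem Overpass.mem_right_of_mem_left {K : Knot} {o : Bool} {L₀ R₀ L O R : List Passage} {p : Passage}
    (h : Overpass K o L₀ R₀ L O R) (hp : p ∈ L) (hp' : p.partner ∉ O) : p.partner ∈ R := by
  have h1 := h.represents.isGaussCode.partner_mem p (by simp [hp])
  have h2 := h.left_simple p hp
  simp only [List.mem_append] at h1
  tauto

/-- All crossings of the overpass with `R` can be moved to `L`. -/
theorem Overpass.exists_disjoint {K : Knot} {o : Bool} {L₀ R₀ L O R : List Passage}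
    (h : Overpass K o L₀ R₀ L O R) : ∃ L' O' : List Passage, Overpass K o L₀ R₀ L' O' R₀ := by
  induction hn : R.length generalizing L O R with
  | zero =>
    have := h.filter_right
    obtain rfl := List.length_eq_zero_iff.1 hn
    simp only [List.filter_nil] at this
    exact ⟨L, O, this ▸ h⟩
  | succ n ih =>
    by_cases hR : ∀ p ∈ R, p.partner ∉ O
    · have : R = R₀ := by
        rw [← h.filter_right, eq_comm, List.filter_eq_self]
        simpa using hR
      exact ⟨L, O, this ▸ h⟩
    -- the last crossing of `R` with the overpass
    obtain ⟨α, q, β, rfl, hq, hβ⟩ : ∃ α q β, R = α ++ q :: β ∧ q.partner ∈ O ∧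
        ∀ b ∈ β, b.partner ∉ O := by
      clear hn ih h
      induction R with
      | nil => simp at hR
      | cons r R ih =>
        by_cases hR' : ∀ p ∈ R, p.partner ∉ O
        · exact ⟨[], r, R, rfl, by_contra fun h => hR (by simpa using ⟨h, hR'⟩), hR'⟩
        · obtain ⟨α, q, β, rfl, h⟩ := ih hR'
          exact ⟨r :: α, q, β, rfl, h⟩
    have hl : ∀ b ∈ β, b.partner ∈ L := fun b hb => h.mem_left_of_mem_right (by simp [hb]) (hβ b hb)
    obtain ⟨Oa, Ob, rfl⟩ := List.append_of_mem hq
    have h' : Overpass K o L₀ R₀ L (Oa ++ q.partner :: Ob) (α ++ q.partner.partner :: β) := by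
      simpa using h
    obtain ⟨L', U, V, h1, -⟩ := h'.flip hl
    exact ih h1 (by simp at hn ⊢; omega)

/-! ### Innermost bigons -/

/-- The side colours at a crossing of two strands, `l`, `l'` before and after it on the first strand
and `o`, `o'` on the second one, agree at the corners. The passage of the second strand is
`leftward` if `ε = true`. -/
def CornersAgree (ε : Bool) (l l' o o' : SideColors) : Prop :=
  if ε then o.1 = l'.1 ∧ o.2 = l.1 ∧ o'.1 = l'.2 ∧ o'.2 = l.2
  else o.1 = l.2 ∧ o.2 = l'.2 ∧ o'.1 = l.1 ∧ o'.2 = l'.1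

/-- Two strands with `ℓ` and `m` passages, joined at the end of the first one, such that the `r`-th
passage of the second strand is through the crossing of the `pos r`-th passage of the first one. The
loop formed by the segments of the two strands between the `i`-th and the `j`-th of these crossings
is the boundary of a set of faces, with side colours `l` and `o` along the two strands. The colour
`a` is that of the faces at the free ends of the two strands and at the crossings of the first
strand with anything else. -/
def LoopColoring (ℓ m : ℕ) (pos : ℕ → ℕ) (ε : ℕ → Bool) (i j : ℕ) : Prop :=
  ∃ (a : ZMod 2) (l o : ℕ → SideColors), l 0 = (a, a) ∧ l ℓ = o 0 ∧ o m = (a, a) ∧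
    (∀ x < ℓ, (∀ r < m, pos r ≠ x) → l x = (a, a) ∧ l (x + 1) = (a, a)) ∧
    (∀ r < m, CornersAgree (ε r) (l (pos r)) (l (pos r + 1)) (o r) (o (r + 1))) ∧
    (∀ y ≤ m, (o y).jump = if i < y ∧ y ≤ j then 1 else 0) ∧
    (∀ x ≤ ℓ, (l x).jump = if (pos i < x ∧ x ≤ pos j) ∨ (pos j < x ∧ x ≤ pos i) then 1 else 0)

/-- All passages of the first strand between the `i`-th and the `j`-th crossing of the second strand
are through crossings with the second strand. -/
def SameGap (m : ℕ) (pos : ℕ → ℕ) (i j : ℕ) : Prop :=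
  ∀ x, (pos i ≤ x ∧ x ≤ pos j) ∨ (pos j ≤ x ∧ x ≤ pos i) → ∃ r < m, pos r = x

theorem SameGap.symm {m i j : ℕ} {pos : ℕ → ℕ} (h : SameGap m pos i j) : SameGap m pos j i :=
  fun x hx => h x hx.symm

theorem SameGap.trans {m i j k : ℕ} {pos : ℕ → ℕ} (h : SameGap m pos i j) (h' : SameGap m pos j k) :
    SameGap m pos i k := by
  intro x hx
  by_cases h1 : (pos i ≤ x ∧ x ≤ pos j) ∨ (pos j ≤ x ∧ x ≤ pos i)
  · exact h x h1
  · exact h' x (by omega)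

theorem CornersAgree.eq_of_jump_eq_zero {ε : Bool} {l l' o o' : SideColors} (h : CornersAgree ε l l' o o')
    (ho : o.jump = 0) (ho' : o'.jump = 0) : l' = l := by
  unfold CornersAgree SideColors.jump at *
  rw [Prod.ext_iff]
  split at h <;> grind

/-- A strand without a jump that crosses the boundary `c` of a set of faces enters the set or leaves
it, depending on its direction. -/
theorem CornersAgree.eq_or_eq {ε : Bool} {c o o' : SideColors} (h : CornersAgree ε c c o o')
    (hc : c.1 + c.2 = 1) (a : ZMod 2) :
    (o = (a, a) ∧ o' = (a + 1, a + 1) ∧ (ε = true ↔ c.1 = a)) ∨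
    (o = (a + 1, a + 1) ∧ o' = (a, a) ∧ (ε = true ↔ c.1 = a + 1)) := by
  rcases c with ⟨c, d⟩
  rcases o with ⟨o1, o2⟩
  rcases o' with ⟨o3, o4⟩
  revert h hc
  unfold CornersAgree
  revert c d o1 o2 o3 o4 a
  cases ε <;> decide

/-- The two corners of a loop that the first strand enters from the outside, where the colour is
`a`. The strands cross there in opposite directions if and only if the first strand is outside again
after the loop. -/
theorem CornersAgree.eq_of_bigon {ε ε' : Bool} {a : ZMod 2} {c d o o₁ o₂ : SideColors}
    (h : CornersAgree ε (a, a) c o o₁) (h' : CornersAgree ε' c d o₁ o₂) (hc : c.jump = 1)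
    (ho₁ : o₁.jump = 1) (ho₂ : o₂.jump = 0) :
    o = (a, a) ∧ (ε ≠ ε' → d = (a, a) ∧ o₂ = (a, a)) ∧ (d = (a, a) → ε ≠ ε') := by
  unfold CornersAgree SideColors.jump at *
  simp only [Prod.ext_iff]
  cases ε <;> cases ε' <;> simp at h h' ⊢ <;> grind

/-- As `CornersAgree.eq_of_bigon`, if the second strand meets the two corners in the opposite order.
-/
theorem CornersAgree.eq_of_bigon' {ε ε' : Bool} {a : ZMod 2} {c d o o₁ o₂ : SideColors}
    (h : CornersAgree ε c d o o₁) (h' : CornersAgree ε' (a, a) c o₁ o₂) (hc : c.jump = 1)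
    (hd : d.jump = 0) (ho : o.jump = 0) (ho₁ : o₁.jump = 1) (ho₂ : o₂.jump = 0) :
    o₂ = (a, a) ∧ (ε ≠ ε' → d = (a, a) ∧ o = (a, a)) ∧ (d = (a, a) → ε ≠ ε') := by
  unfold CornersAgree SideColors.jump at *
  simp only [Prod.ext_iff]
  cases ε <;> cases ε' <;> simp at h h' ⊢ <;> grind

section
variable {ℓ m : ℕ} {pos : ℕ → ℕ} {ε : ℕ → Bool}

/-- The colours along the first strand for the loop between two consecutive crossings `s`, `s + 1`
of the second one: they only change at these two. -/
theorem LoopColoring.consecutive {s : ℕ} {a : ZMod 2} {l o : ℕ → SideColors} (hs : s + 1 < m)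
    (hpos : ∀ r < m, pos r < ℓ) (hl0 : l 0 = (a, a))
    (hT : ∀ x < ℓ, (∀ r < m, pos r ≠ x) → l x = (a, a) ∧ l (x + 1) = (a, a))
    (hc : ∀ r < m, CornersAgree (ε r) (l (pos r)) (l (pos r + 1)) (o r) (o (r + 1)))
    (hoj : ∀ y ≤ m, (o y).jump = if s < y ∧ y ≤ s + 1 then 1 else 0) :
    (∀ y, y ≤ pos s → y ≤ pos (s + 1) → l y = (a, a)) ∧
    (∀ y, (pos s < y ∧ y ≤ pos (s + 1)) → l y = l (pos s + 1)) ∧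
    (∀ y, (pos (s + 1) < y ∧ y ≤ pos s) → l y = l (pos (s + 1) + 1)) ∧
    (∀ y, pos s < y → pos (s + 1) < y → y ≤ ℓ → (∃ x, pos s < x ∧ pos (s + 1) < x ∧ x ≤ ℓ ∧
      l x = (a, a)) → l y = (a, a)) := by
  have hin : ∀ r < m, r ≠ s → r ≠ s + 1 → l (pos r + 1) = l (pos r) := by
    intro r hr hrs hrs'
    refine (hc r hr).eq_of_jump_eq_zero ?_ ?_
    · rw [hoj _ (by omega), if_neg (by omega)]
    · rw [hoj _ (by omega), if_neg (by omega)]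
  have hps := hpos s (by omega)
  have hps' := hpos (s + 1) hs
  have hstep : ∀ x < ℓ, x ≠ pos s → x ≠ pos (s + 1) → l (x + 1) = l x := by
    intro x hx h1 h2
    by_cases hr : ∃ r < m, pos r = x
    · obtain ⟨r, hr, rfl⟩ := hr
      exact hin r hr (by rintro rfl; exact h1 rfl) (by rintro rfl; exact h2 rfl)
    · have := hT x hx (by simpa using hr)
      rw [this.1, this.2]
  have hconst : ∀ x y, x ≤ y → y ≤ ℓ → (∀ z, x ≤ z → z < y → z ≠ pos s ∧ z ≠ pos (s + 1)) →
      l y = l x := by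
    intro x y hxy
    induction y, hxy using Nat.le_induction with
    | base => intros; rfl
    | succ y hy ih =>
      intro h1 h2
      rw [hstep y (by omega) (h2 y hy (by omega)).1 (h2 y hy (by omega)).2,
        ih (by omega) fun z hz hz' => h2 z hz (by omega)]
  refine ⟨fun y h1 h2 => ?_, fun y hy => ?_, fun y hy => ?_, fun y h1 h2 h3 => ?_⟩
  · rw [hconst 0 y (by omega) (by omega) fun z _ _ => by omega, hl0]
  · exact hconst _ y (by omega) (by omega) fun z _ _ => by omega
  · exact hconst _ y (by omega) (by omega) fun z _ _ => by omega
  · rintro ⟨x, hx1, hx2, hx3, hx⟩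
    rcases Nat.le_total x y with h | h
    · rw [hconst x y h h3 fun z _ _ => by omega, hx]
    · rw [← hconst y x h hx3 fun z _ _ => by omega, hx]

/-- If two crossings of the second strand lie in the same gap, then so do two consecutive ones, and
these are in opposite directions, as for a bigon, unless the loop is at the turn from the first
strand to the second one. -/
theorem exists_consecutive_sameGap (h0 : pos 0 + 1 = ℓ) (hpos : ∀ r < m, pos r < ℓ)
    (hinj : ∀ r < m, ∀ s < m, pos r = pos s → r = s)
    (hcol : ∀ i j, i < j → j < m → SameGap m pos i j → LoopColoring ℓ m pos ε i j)
    (hex : ∃ i j, i < j ∧ j < m ∧ SameGap m pos i j) :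
    ∃ s, s + 1 < m ∧ SameGap m pos s (s + 1) ∧ (s = 0 ∨ ε s ≠ ε (s + 1)) := by
  classical
  have hex' : ∃ j, ∃ i, i < j ∧ j < m ∧ SameGap m pos i j := by
    obtain ⟨i, j, h⟩ := hex; exact ⟨j, i, h⟩
  obtain ⟨i, hij, hj, hg⟩ := Nat.find_spec hex'
  have hmin : ∀ r s, r < s → s < Nat.find hex' → ¬ SameGap m pos r s := fun r s hrs hs hg' =>
    Nat.find_min hex' hs ⟨r, hrs, by omega, hg'⟩
  generalize Nat.find hex' = j at *
  -- For the minimal `j`, a crossing `s` strictly between `i` and `j` would be the only one of its gap at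
  -- which the first strand changes its colour, although the colour is `a` at both ends of that gap.
  obtain ⟨a, l, o, hl0, hlo, hom, hT, hc, hoj, hlj⟩ := hcol i j hij hj hg
  have key : ∀ s, i < s → s < j → False := by
    intro s hs hs'
    have hin : ∀ r < m, r ≠ s → SameGap m pos r s → l (pos r + 1) = l (pos r) := by
      intro r hr hrs hg'
      have hrj : j < r := by
        by_contra hle
        rcases Nat.lt_or_ge r s with h | h
        · exact hmin r s h hs' hg'
        · rcases Nat.lt_or_ge r j with h' | h'
          · exact hmin s r (by omega) h' hg'.symm
          · obtain rfl : r = j := by omega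
            exact hmin i s hs hs' (hg.trans hg')
      refine (hc r hr).eq_of_jump_eq_zero ?_ ?_
      · rw [hoj _ (by omega), if_neg (by omega)]
      · rw [hoj _ (by omega), if_neg (by omega)]
    have hsm : s < m := by omega
    have hps := hpos s hsm
    have left : ∀ y ≤ pos s, (∀ x, y ≤ x → x < pos s → ∃ r < m, pos r = x) → l y = (a, a) := by
      intro y
      induction y with
      | zero => intros; exact hl0
      | succ y ih =>
        intro hy hx
        by_cases hyr : ∃ r < m, pos r = y
        · have hall : ∀ x, y ≤ x → x < pos s → ∃ r < m, pos r = x := fun x h1 h2 => by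
            rcases Nat.eq_or_lt_of_le h1 with rfl | h1
            · exact hyr
            · exact hx x h1 h2
          obtain ⟨r, hr, rfl⟩ := hyr
          rw [hin r hr (by rintro rfl; omega), ih (by omega) hall]
          intro x hx'
          rcases Nat.lt_or_ge x (pos s) with h | h
          · exact hall x (by omega) h
          · exact ⟨s, hsm, by omega⟩
        · exact (hT y (by omega) (by simpa using hyr)).2
    have right : ∀ y, pos s < y → y ≤ ℓ → (∀ x, pos s ≤ x → x < y → ∃ r < m, pos r = x) →
        l y = l (pos s + 1) := by
      intro y hy
      induction y, hy using Nat.le_induction with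
      | base => intros; rfl
      | succ y hy ih =>
        intro hy' hx
        obtain ⟨r, hr, rfl⟩ := hx y (by omega) (by omega)
        rw [hin r hr (by rintro rfl; omega), ih (by omega) (fun x h1 h2 => hx x h1 (by omega))]
        exact fun x hx' => hx x (by omega) (by omega)
    have hns : ∃ x, pos s < x ∧ x < ℓ ∧ ¬ ∃ r < m, pos r = x := by
      by_contra hcon
      push Not at hcon
      refine hmin 0 s (by omega) hs' fun x hx => ?_
      rcases Nat.eq_or_lt_of_le (show pos s ≤ x by omega) with rfl | h
      · exact ⟨s, hsm, rfl⟩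
      · exact hcon x h (by omega)
    have hx := Nat.find_spec hns
    have hxm : ∀ x, pos s < x → x < Nat.find hns → ∃ r < m, pos r = x := fun x h1 h2 => by
      by_contra hcon
      exact Nat.find_min hns h2 ⟨h1, by omega, hcon⟩
    generalize Nat.find hns = x at *
    have h1 := left (pos s) le_rfl (by omega)
    have h2 := right x hx.1 hx.2.1.le fun y h1 h2 => by
      rcases Nat.eq_or_lt_of_le h1 with rfl | h1
      · exact ⟨s, hsm, rfl⟩
      · exact hxm y h1 h2
    rw [(hT x hx.2.1 (by simpa using hx.2.2)).1] at h2
    have h3 := hc s hsm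
    rw [h1, ← h2] at h3
    have h4 := hoj s (by omega)
    rw [if_pos (by omega)] at h4
    unfold CornersAgree SideColors.jump at *
    split at h3 <;> grind
  obtain rfl : j = i + 1 := by
    by_contra hne
    exact key (i + 1) (by omega) (by omega)
  refine ⟨i, hj, hg, or_iff_not_imp_left.2 fun hi => ?_⟩
  have hne : pos i ≠ pos (i + 1) := fun h => by
    have := hinj _ (by omega) _ hj h; omega
  obtain ⟨f1, f2, f3, f4⟩ := LoopColoring.consecutive hj hpos hl0 hT hc hoj
  have hp1 := hpos i (by omega)
  have hp2 := hpos (i + 1) hj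
  have hns : ∃ x, pos i < x ∧ pos (i + 1) < x ∧ x ≤ ℓ ∧ l x = (a, a) := by
    by_contra hcon
    refine hmin 0 i (by omega) (by omega) fun x hx => by_contra fun hxr => hcon ?_
    have hx1 : x < ℓ := by omega
    have hx2 : pos i < x := by
      refine lt_of_le_of_ne (by omega) fun h => hxr ⟨i, by omega, h⟩
    refine ⟨x, hx2, not_le.1 fun h => hxr (hg x (by omega)), hx1.le, (hT x hx1 (by simpa using hxr)).1⟩
  have c1 := hc i (by omega)
  have c2 := hc (i + 1) hj
  have j1 := hoj i (by omega)
  have j2 := hoj (i + 1) (by omega)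
  rw [if_neg (by omega)] at j1
  rw [if_pos (by omega)] at j2
  have j4 := hoj (i + 2) (by omega)
  rw [if_neg (by omega)] at j4
  rcases Nat.lt_or_gt_of_ne hne with h | h
  · rw [f4 (pos (i + 1) + 1) (by omega) (by omega) (by omega) hns, f2 (pos (i + 1)) (by omega)] at c2
    rw [f1 (pos i) (by omega) (by omega)] at c1
    have j3 := hlj (pos i + 1) (by omega)
    rw [if_pos (by omega)] at j3
    exact (c1.eq_of_bigon c2 j3 j2 j4).2.2 rfl
  · rw [f4 (pos i + 1) (by omega) (by omega) (by omega) hns, f3 (pos i) (by omega)] at c1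
    rw [f1 (pos (i + 1)) (by omega) (by omega)] at c2
    have j3 := hlj (pos (i + 1) + 1) (by omega)
    rw [if_pos (by omega)] at j3
    exact (c1.eq_of_bigon' c2 j3 (CharTwo.add_self_eq_zero a) j1 j2 j4).2.2 rfl

/-- An innermost loop of two consecutive crossings in the same gap is a bigon (or a monogon, for `s
= 0`): a crossing on its segment of the first strand would be followed or preceded by another one.
-/
theorem exists_adjacent_crossings (h0 : pos 0 + 1 = ℓ) (hpos : ∀ r < m, pos r < ℓ)
    (hinj : ∀ r < m, ∀ s < m, pos r = pos s → r = s)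
    (hcol : ∀ i j, i < j → j < m → SameGap m pos i j → LoopColoring ℓ m pos ε i j)
    (hex : ∃ i j, i < j ∧ j < m ∧ SameGap m pos i j) :
    ∃ s, s + 1 < m ∧ (pos s + 1 = pos (s + 1) ∨ pos (s + 1) + 1 = pos s) ∧
      (s = 0 ∨ ε s ≠ ε (s + 1)) := by
  obtain ⟨s, hs, hg, hε⟩ := exists_consecutive_sameGap h0 hpos hinj hcol hex
  induction hd : (pos s - pos (s + 1)) + (pos (s + 1) - pos s) using Nat.strong_induction_on
    generalizing s with
  | h d ih =>
  obtain ⟨a, l, o, hl0, hlo, hom, hT, hc, hoj, hlj⟩ := hcol s (s + 1) (by omega) hs hg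
  have hne : pos s ≠ pos (s + 1) := fun h => by
    have := hinj _ (by omega) _ hs h; omega
  obtain ⟨f1, f2, f3, f4⟩ := LoopColoring.consecutive hs hpos hl0 hT hc hoj
  have hp1 := hpos s (by omega)
  have hp2 := hpos (s + 1) hs
  obtain ⟨lo, hi, hlohi, hhi, hsg, g1, g2, j3, g3, e1, e2⟩ : ∃ lo hi, lo < hi ∧ hi < ℓ ∧
      ((lo = pos s ∧ hi = pos (s + 1)) ∨ (lo = pos (s + 1) ∧ hi = pos s)) ∧
      (∀ y ≤ lo, l y = (a, a)) ∧ (∀ y, lo < y → y ≤ hi → l y = l (lo + 1)) ∧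
      (l (lo + 1)).jump = 1 ∧ (s ≠ 0 → ∀ y, hi < y → y ≤ ℓ → l y = (a, a)) ∧
      (s ≠ 0 → o s = (a, a)) ∧ o (s + 2) = (a, a) := by
    have c1 := hc s (by omega)
    have c2 := hc (s + 1) hs
    have j1 := hoj s (by omega)
    have j2 := hoj (s + 1) (by omega)
    have j4 := hoj (s + 2) (by omega)
    rw [if_neg (by omega)] at j1 j4
    rw [if_pos (by omega)] at j2
    rcases Nat.lt_or_gt_of_ne hne with h | h
    · have hs0 : s ≠ 0 := by
        rintro rfl; omega
      have j3 := hlj (pos s + 1) (by omega)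
      have j5 := hlj (pos (s + 1) + 1) (by omega)
      rw [if_pos (by omega)] at j3
      rw [if_neg (by omega)] at j5
      rw [f2 (pos (s + 1)) (by omega)] at c2
      rw [f1 (pos s) (by omega) (by omega)] at c1
      have h1 := hε.resolve_left hs0
      have k := c1.eq_of_bigon c2 j3 j2 j4
      have k' := k.2.1 h1
      refine ⟨pos s, pos (s + 1), h, hp2, Or.inl ⟨rfl, rfl⟩, fun y hy => f1 y hy (by omega),
        fun y h1 h2 => f2 y ⟨h1, h2⟩, j3, fun _ y h1 h2 => ?_, fun _ => k.1, k'.2⟩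
      exact f4 y (by omega) h1 h2 ⟨_, by omega, by omega, by omega, k'.1⟩
    · have j3 := hlj (pos (s + 1) + 1) (by omega)
      have j5 := hlj (pos s + 1) (by omega)
      rw [if_pos (by omega)] at j3
      rw [if_neg (by omega)] at j5
      rw [f3 (pos s) (by omega)] at c1
      rw [f1 (pos (s + 1)) (by omega) (by omega)] at c2
      have k := c1.eq_of_bigon' c2 j3 j5 j1 j2 j4
      have k' := fun hs0 => k.2.1 (hε.resolve_left hs0)
      refine ⟨pos (s + 1), pos s, h, hp1, Or.inr ⟨rfl, rfl⟩, fun y hy => f1 y (by omega) hy,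
        fun y h1 h2 => f3 y ⟨h1, h2⟩, j3, fun hs0 y h1 h2 => ?_, fun hs0 => (k' hs0).2, k.1⟩
      exact f4 y h1 (by omega) h2 ⟨_, by omega, by omega, by omega, (k' hs0).1⟩
  clear f1 f2 f3 f4
  have hne2 : ∀ x a : ZMod 2, ¬ (x = a ↔ x = a + 1) := by decide
  by_contra hcon
  have hinner : ∀ r < m, lo < pos r → pos r < hi → r ≠ s ∧ r ≠ s + 1 := by
    rintro r hr h1 h2
    constructor <;> rintro rfl <;> omega
  -- a crossing `r + 1` that is reached from inside the loop is on the segment of the loop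
  have hinner' : ∀ r < m, r ≠ s → r ≠ s + 1 → (o r = (a + 1, a + 1) ∨ o (r + 1) = (a + 1, a + 1)) →
      lo < pos r ∧ pos r < hi := by
    intro r hr h1 h2 ho
    have := hc r hr
    have p1 : pos r ≠ pos s := fun h => h1 (hinj r hr s (by omega) h)
    have p2 : pos r ≠ pos (s + 1) := fun h => h2 (hinj r hr (s + 1) (by omega) h)
    have p3 : pos r ≠ pos 0 ∨ s ≠ 0 := by
      by_contra hc; push Not at hc; obtain ⟨hc, rfl⟩ := hc; exact p1 hc
    have p4 := hpos r hr
    by_contra hcon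
    rcases Nat.lt_or_ge (pos r) lo with h | h
    · rw [g1 _ h.le, g1 _ h] at this
      unfold CornersAgree at this
      clear hT hc hoj hlj hcol ih hl0
      grind
    · have hs0 : s ≠ 0 := by
        rintro rfl; omega
      rw [g3 hs0 _ (by omega) (by omega), g3 hs0 _ (by omega) (by omega)] at this
      unfold CornersAgree at this
      clear hT hc hoj hlj hcol ih hl0
      grind
  obtain ⟨r, hr, hx⟩ := hg (lo + 1) (by omega)
  have hr1 : lo < pos r := by omega
  have hr2 : pos r < hi := by
    have : ¬ (pos s + 1 = pos (s + 1) ∨ pos (s + 1) + 1 = pos s) := fun h => hcon ⟨s, hs, h, hε⟩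
    omega
  obtain ⟨hrs, hrs'⟩ := hinner r hr hr1 hr2
  -- consecutive crossings on the segment bound a smaller loop
  have hsmall : ∀ t, t + 1 < m → (lo < pos t ∧ pos t < hi) → (lo < pos (t + 1) ∧ pos (t + 1) < hi) →
      ε t ≠ ε (t + 1) → False := fun t ht h1 h2 h3 =>
    hcon (ih _ (by omega) t ht (fun x hx => hg x (by omega)) (Or.inr h3) rfl)
  have hcr : ∀ t < m, lo < pos t → pos t < hi →
      CornersAgree (ε t) (l (lo + 1)) (l (lo + 1)) (o t) (o (t + 1)) := fun t ht h1 h2 => by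
    have := hc t ht
    rwa [g2 _ h1 h2.le, g2 (pos t + 1) (by omega) h2] at this
  have k0 := hcr r hr hr1 hr2
  have hcase : o r = (a + 1, a + 1) ∨ o (r + 1) = (a + 1, a + 1) := by
    rcases k0.eq_or_eq j3 a with h | h
    · exact Or.inr h.2.1
    · exact Or.inl h.1
  rcases hcase with h | h
  · -- the second strand enters the loop before its crossing `r`
    obtain _ | t := r
    · omega
    have ht1 : t ≠ s := fun h => hrs' (by rw [h])
    have ht2 : t ≠ s + 1 := by
      rintro rfl
      rw [e2] at h
      simp at h
    have hi' := hinner' t (by omega) ht1 ht2 (Or.inr h)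
    refine hsmall t hr hi' ⟨hr1, hr2⟩ fun hε' => ?_
    have k1 := hcr t (by omega) hi'.1 hi'.2
    rcases k0.eq_or_eq j3 a with h0 | h0
    · rw [h0.1] at h; simp at h
    · rcases k1.eq_or_eq j3 a with h1 | h1
      · rw [hε', h0.2.2] at h1; exact absurd h1.2.2.symm (hne2 _ _)
      · rw [h0.1] at h1; simp at h1
  · have hrm : r + 1 < m := by
      refine lt_of_le_of_ne hr fun hrm => ?_
      rw [hrm, hom] at h
      simp at h
    have ht1 : r + 1 ≠ s := fun hrs => by
      rw [hrs, e1 (by omega)] at h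
      simp at h
    have hi' := hinner' (r + 1) hrm ht1 (by omega) (Or.inl h)
    refine hsmall r hrm ⟨hr1, hr2⟩ hi' fun hε' => ?_
    have k1 := hcr (r + 1) hrm hi'.1 hi'.2
    rcases k0.eq_or_eq j3 a with h0 | h0
    · rcases k1.eq_or_eq j3 a with h1 | h1
      · rw [h0.2.1] at h1; simp at h1
      · rw [← hε', h0.2.2] at h1; exact absurd h1.2.2 (hne2 _ _)
    · rw [h0.2.1] at h; simp at h
end

/-! ### Reducing the overpass -/

theorem IsSeparating.add_kink {u v : List Passage} {p : Passage} (h : IsSeparating (u ++ v))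
    (hp : ∀ q ∈ u ++ v, q.crossing ≠ p.crossing) : IsSeparating (u ++ p :: p.partner :: v) := by
  intro c z
  obtain ⟨κ, s, h1, h2, h3⟩ := h c z
  obtain ⟨t, h4, h5⟩ := (fits_append ..).1 h1
  let k : Corners := if p.leftward then ⟨t.1, t.2, t.2, c p.crossing + t.1⟩
    else ⟨c p.crossing + t.2, t.1, t.1, t.2⟩
  let κ' := Function.update κ p.crossing k
  have hκ : ∀ q ∈ u ++ v, κ q.crossing = κ' q.crossing := fun q hq => by
    simp only [κ', Function.update_of_ne (hp q hq)]
  have hκp : κ' p.crossing = k := by simp [κ']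
  refine ⟨κ', s, ?_, ?_, h3⟩
  · rw [fits_congr fun q hq => hκ q (by simp [hq])] at h4 h5
    rw [fits_append]
    refine ⟨t, h4, ?_⟩
    have e1 : sidesIn κ' p = t := by
      unfold sidesIn; rw [hκp]; cases hl : p.leftward <;> simp [k, hl]
    have e2 : sidesIn κ' p.partner = sidesOut κ' p := by
      unfold sidesIn sidesOut
      rw [Passage.partner_crossing, hκp]; cases hl : p.leftward <;> simp [k, hl]
    have e3 : sidesOut κ' p.partner = t := by
      unfold sidesOut
      rw [Passage.partner_crossing, hκp]; cases hl : p.leftward <;> simp [k, hl]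
    exact ⟨e1, e2, e3 ▸ h5⟩
  · have e : (κ' p.crossing).total = c p.crossing := by
      rw [hκp]
      unfold Corners.total
      cases hl : p.leftward <;> simp [k, hl] <;> grind
    intro q hq
    by_cases hqp : q.crossing = p.crossing
    · rw [hqp, e]
    · have : q ∈ u ++ v := by
        simp only [List.mem_append, List.mem_cons] at hq ⊢
        rcases hq with hq | rfl | rfl | hq
        · exact Or.inl hq
        · exact absurd rfl hqp
        · exact absurd rfl hqp
        · exact Or.inr hq
      rw [← hκ q this, h2 q this]

theorem cornersAgree_partner (κ : ℕ → Corners) (p : Passage) :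
    CornersAgree p.leftward (sidesIn κ p.partner) (sidesOut κ p.partner) (sidesIn κ p)
      (sidesOut κ p) := by
  unfold CornersAgree sidesIn sidesOut
  cases h : p.leftward <;> simp [h]

/-- If no strand has a jump at a crossing with zero total, then all its corners have one colour. -/
theorem sides_eq_of_partner {κ : ℕ → Corners} {p : Passage} {a : ZMod 2}
    (ht : (κ p.crossing).total = 0) (hj : (sidesIn κ p).jump = 0) (hp : sidesIn κ p.partner = (a, a)) :
    sidesIn κ p = (a, a) ∧ sidesOut κ p = (a, a) := by
  revert ht hj hp
  unfold sidesIn sidesOut SideColors.jump Corners.total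
  cases h : p.leftward <;> simp [h] <;> intros <;> grind

/-- In a planar diagram every loop formed by `L` and `O` within a gap has a colouring. -/
theorem loopColoring_of_isSeparating {L O R : List Passage} (hG : IsGaussCode (L ++ O ++ R))
    (hs : IsSeparating (L ++ O ++ R)) (hLs : ∀ p ∈ L, p.partner ∉ L)
    (hO : ∀ p ∈ O, p.partner ∈ L) (hR : ∀ p ∈ R, p.partner ∈ L)
    (d : Passage) {i j : ℕ} (hij : i < j) (hj : j < O.length)
    (hg : SameGap O.length (fun r => L.idxOf (O.getD r d).partner) i j) :
    LoopColoring L.length O.length (fun r => L.idxOf (O.getD r d).partner)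
      (fun r => (O.getD r d).leftward) i j := by
  have hn := hG.nodup
  have hnL : L.Nodup := by grind
  have hnO : O.Nodup := by grind
  have hOL : ∀ p ∈ O, p ∉ L := by grind
  have hRO : ∀ p ∈ R, p ∉ O := by grind
  have hget : ∀ r (hr : r < O.length), O.getD r d = O[r] := fun r hr => by simp [hr]
  have hidx : ∀ r (hr : r < O.length), L.idxOf (O.getD r d).partner < L.length := fun r hr => by
    rw [List.idxOf_lt_length_iff, hget r hr]; exact hO _ (List.getElem_mem hr)
  have hposL : ∀ r (hr : r < O.length), L[L.idxOf (O.getD r d).partner]'(hidx r hr) = O[r].partner :=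
    fun r hr => by simp [hr]
  have hpos_iff : ∀ r < O.length, ∀ x (hx : x < L.length),
      L.idxOf (O.getD r d).partner = x ↔ L[x] = (O.getD r d).partner := by
    intro r hr x hx
    constructor
    · rintro rfl; rw [hposL r hr, hget r hr]
    · intro h; rw [← h, hnL.idxOf_getElem]
  set pos : ℕ → ℕ := fun r => L.idxOf (O.getD r d).partner with hpos
  let u : ℕ → ZMod 2 := fun c =>
    (if c = (O.getD i d).crossing then 1 else 0) + (if c = (O.getD j d).crossing then 1 else 0)
  obtain ⟨κ, s, h1, h2, h3⟩ := hs u 0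
  simp only [fits_append] at h1
  obtain ⟨t', ⟨t, hL, hO'⟩, hR'⟩ := h1
  obtain ⟨l, hl0, hlℓ, hl⟩ := (fits_iff_getElem ..).1 hL
  obtain ⟨o, ho0, hom, ho⟩ := (fits_iff_getElem ..).1 hO'
  have hs0 : s.jump = 0 := h3
  have hOcr : ∀ r < O.length, ∀ p ∈ L ++ O ++ R, p.crossing = (O.getD r d).crossing ↔
      p = O.getD r d ∨ p = (O.getD r d).partner := by
    intro r hr p hp
    constructor
    · exact hG.eq_or_eq_partner hp (by rw [hget r hr]; simp)
    · rintro (rfl | rfl) <;> rfl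
  have hmem : ∀ r < O.length, O.getD r d ∈ O := fun r hr => by rw [hget r hr]; exact List.getElem_mem hr
  have huL : ∀ x (hx : x < L.length), (κ L[x].crossing).total =
      (if pos i = x then 1 else 0) + (if pos j = x then 1 else 0) := by
    intro x hx
    have hxL : L[x] ∈ L := List.getElem_mem hx
    have : ∀ r < O.length, L[x].crossing = (O.getD r d).crossing ↔ pos r = x := fun r hr => by
      rw [hOcr r hr _ (by simp), hpos_iff r hr x hx]
      exact or_iff_right fun h => hOL _ (hmem r hr) (h ▸ hxL)
    rw [h2 _ (by simp)]
    simp only [u, this i (by omega), this j hj]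
  have huO : ∀ r (hr : r < O.length), (κ O[r].crossing).total =
      (if i = r then 1 else 0) + (if j = r then 1 else 0) := by
    intro x hx
    have : ∀ r (hr : r < O.length), O[x].crossing = (O.getD r d).crossing ↔ r = x := fun r hr => by
      rw [hOcr r hr _ (by simp), hget r hr, hnO.getElem_inj_iff, eq_comm (a := r)]
      refine or_iff_left fun h => ?_
      have h' := hO _ (List.getElem_mem hr)
      rw [← h] at h'
      exact hOL _ (List.getElem_mem hx) h'
    rw [h2 _ (by simp)]
    simp only [u, this i (by omega), this j hj]
  have hlj : ∀ x ≤ L.length, (l x).jump = (if pos i < x then 1 else 0) + (if pos j < x then 1 else 0) := by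
    intro x
    induction x with
    | zero => intro; simp [hl0, hs0]
    | succ x ih =>
      intro hx
      rw [← (hl x hx).2, jump_sidesOut, (hl x hx).1, ih (by omega), huL x hx]
      clear ih
      split_ifs <;> first | omega | simp
  have hoj : ∀ y ≤ O.length, (o y).jump = (if i < y then 1 else 0) + (if j < y then 1 else 0) := by
    intro y
    induction y with
    | zero =>
      intro
      rw [ho0, ← hlℓ, hlj _ le_rfl, if_pos (hidx i (by omega)), if_pos (hidx j hj)]
      simp [CharTwo.add_self_eq_zero]
    | succ y ih =>
      intro hy
      rw [← (ho y hy).2, jump_sidesOut, (ho y hy).1, ih (by omega), huO y hy]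
      clear ih
      split_ifs <;> first | omega | simp
  -- the crossings outside of the overpass
  have hout : ∀ x (hx : x < L.length), (∀ r < O.length, pos r ≠ x) →
      (l x).jump = 0 ∧ (κ L[x].crossing).total = 0 := by
    intro x hx h
    have hi := h i (by omega)
    have hj' := h j hj
    refine ⟨?_, by rw [huL x hx, if_neg hi, if_neg hj', add_zero]⟩
    rw [hlj x hx.le]
    have : ¬ ((pos i ≤ x ∧ x ≤ pos j) ∨ (pos j ≤ x ∧ x ≤ pos i)) := fun hc => by
      obtain ⟨r, hr, hr'⟩ := hg x hc
      exact h r hr hr'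
    split_ifs <;> first | omega | simp [CharTwo.add_self_eq_zero]
  have hRx : ∀ p ∈ R, ∃ x, ∃ hx : x < L.length, L[x] = p.partner ∧ ∀ r < O.length, pos r ≠ x := by
    intro p hp
    obtain ⟨x, hx, h⟩ := List.getElem_of_mem (hR p hp)
    refine ⟨x, hx, h, fun r hr h' => ?_⟩
    rw [hpos_iff r hr x hx, h] at h'
    exact hRO p hp (Passage.partner_injective h' ▸ hmem r hr)
  obtain ⟨rfl, hRc⟩ := hR'.sides_const (fun p hp => by
      obtain ⟨x, hx, h, h'⟩ := hRx p hp
      have := (hout x hx h').2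
      rwa [h] at this) fun p hp => by
      obtain ⟨x, hx, h, h'⟩ := hRx p hp
      have := (hout x hx h').1
      rwa [← (hl x hx).1, h] at this
  obtain ⟨a, rfl⟩ : ∃ a, s = (a, a) := ⟨s.1, Prod.ext rfl (jump_eq_zero_iff.1 hs0).symm⟩
  refine ⟨a, l, o, hl0, by rw [hlℓ, ho0], hom, fun x hx hxr => ?_, fun r hr => ?_, fun y hy => ?_,
    fun x hx => ?_⟩
  · have hp : L[x].partner ∈ R := by
      have h1 := hG.partner_mem L[x] (by simp)
      have h2 := hLs _ (List.getElem_mem hx)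
      have h3 : L[x].partner ∉ O := fun h => by
        obtain ⟨r, hr, h⟩ := List.getElem_of_mem h
        exact hxr r hr ((hpos_iff r hr x hx).2 (by rw [hget r hr, h, Passage.partner_partner]))
      simp only [List.mem_append] at h1
      tauto
    rw [← (hl x hx).1, ← (hl x hx).2]
    have := hout x hx hxr
    rw [← (hl x hx).1] at this
    exact sides_eq_of_partner this.2 this.1 (hRc _ hp).1
  · have h1 := hl (pos r) (hidx r hr)
    rw [hposL r hr] at h1
    rw [← h1.1, ← h1.2, ← (ho r hr).1, ← (ho r hr).2]
    simp only [hget r hr]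
    exact cornersAgree_partner κ _
  · rw [hoj y hy]
    split_ifs <;> first | omega | simp [CharTwo.add_self_eq_zero]
  · rw [hlj x hx]
    split_ifs <;> first | omega | simp [CharTwo.add_self_eq_zero]

/-- If two consecutive passages of `L` are through crossings with `O`, then `L` and `O` bound a
bigon, or a monogon with a corner at the turn from `L` to `O`. -/
theorem exists_bigon {L O R : List Passage} (hG : IsGaussCode (L ++ O ++ R))
    (hs : IsSeparating (L ++ O ++ R)) (hLs : ∀ p ∈ L, p.partner ∉ L)
    (hO : ∀ p ∈ O, p.partner ∈ L) (hR : ∀ p ∈ R, p.partner ∈ L) {y : ℕ} (hy : y + 1 < L.length)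
    (hy1 : L[y].partner ∈ O) (hy2 : L[y + 1].partner ∈ O) {k : Passage} (hkL : L.getLast? = some k)
    (hkO : O.head? = some k.partner) :
    ∃ s, ∃ hs : s + 1 < O.length, ∃ x, ∃ hx : x + 1 < L.length,
      ((L[x] = O[s].partner ∧ L[x + 1] = O[s + 1].partner) ∨
        (L[x] = O[s + 1].partner ∧ L[x + 1] = O[s].partner)) ∧
      (s = 0 ∨ O[s].leftward ≠ O[s + 1].leftward) := by
  have hn := hG.nodup
  have hnL : L.Nodup := by grind
  have hnO : O.Nodup := by grind
  have hget : ∀ r (hr : r < O.length), O.getD r k = O[r] := fun r hr => List.getD_eq_getElem _ _ hr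
  have hidx : ∀ r < O.length, L.idxOf (O.getD r k).partner < L.length := fun r hr => by
    rw [List.idxOf_lt_length_iff, hget r hr]; exact hO _ (List.getElem_mem hr)
  have hpos_iff : ∀ r (hr : r < O.length) x (hx : x < L.length),
      L.idxOf (O.getD r k).partner = x ↔ L[x] = O[r].partner := by
    intro r hr x hx
    constructor
    · rintro rfl; simp only [List.getElem_idxOf, hget r hr]
    · intro h; rw [hget r hr, ← h, hnL.idxOf_getElem]
  have hcol := fun i j (hij : i < j) hj => loopColoring_of_isSeparating hG hs hLs hO hR k hij hj
  set pos : ℕ → ℕ := fun r => L.idxOf (O.getD r k).partner with hpos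
  have hinj : ∀ r < O.length, ∀ t < O.length, pos r = pos t → r = t := by
    intro r hr t ht h
    have h1 := (hpos_iff r hr (pos t) (hidx t ht)).1 h
    rw [(hpos_iff t ht (pos t) (hidx t ht)).1 rfl] at h1
    exact (hnO.getElem_inj_iff.1 (Passage.partner_injective h1)).symm
  have h0 : pos 0 + 1 = L.length := by
    have h1 : 0 < O.length := List.length_pos_iff.2 (by rintro rfl; simp at hkO)
    have h2 : pos 0 = L.length - 1 := by
      refine (hpos_iff 0 h1 (L.length - 1) (by omega)).2 ?_
      rw [List.getLast?_eq_getElem?, List.getElem?_eq_some_iff] at hkL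
      rw [List.head?_eq_getElem?, List.getElem?_eq_some_iff] at hkO
      rw [hkO.2, hkL.2, Passage.partner_partner]
    have := hidx 0 h1
    omega
  have hex : ∃ i j, i < j ∧ j < O.length ∧ SameGap O.length pos i j := by
    obtain ⟨i, hi, h1⟩ := List.getElem_of_mem hy1
    obtain ⟨j, hj, h2⟩ := List.getElem_of_mem hy2
    have h1 := (hpos_iff i hi y (by omega)).2 (by rw [h1, Passage.partner_partner])
    have h2 := (hpos_iff j hj (y + 1) hy).2 (by rw [h2, Passage.partner_partner])
    have hg : SameGap O.length pos i j := by
      intro x hx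
      change (pos i ≤ x ∧ x ≤ pos j) ∨ _ at hx
      by_cases h : x = y
      · exact ⟨i, hi, h1.trans h.symm⟩
      · refine ⟨j, hj, h2.trans ?_⟩
        have h1' : pos i = y := h1
        have h2' : pos j = y + 1 := h2
        omega
    rcases Nat.lt_trichotomy i j with h | h | h
    · exact ⟨i, j, h, hj, hg⟩
    · subst h; omega
    · exact ⟨j, i, h, hi, hg.symm⟩
  obtain ⟨s, hs', h1, h2⟩ := exists_adjacent_crossings h0 hidx hinj hcol hex
  rw [hget _ (by omega), hget _ hs'] at h2
  have e1 := (hpos_iff s (by omega) _ (hidx s (by omega))).1 rfl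
  have e2 := (hpos_iff (s + 1) hs' _ (hidx (s + 1) hs')).1 rfl
  have b1 := hidx s (by omega)
  have b2 := hidx (s + 1) hs'
  rcases h1 with h1 | h1
  · have h1' : L.idxOf (O.getD s k).partner + 1 = L.idxOf (O.getD (s + 1) k).partner := h1
    exact ⟨s, hs', _, by omega, Or.inl ⟨e1, by simp only [h1']; exact e2⟩, h2⟩
  · have h1' : L.idxOf (O.getD (s + 1) k).partner + 1 = L.idxOf (O.getD s k).partner := h1
    exact ⟨s, hs', _, by omega, Or.inr ⟨e2, by simp only [h1']; exact e1⟩, h2⟩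

/-- Along `L`, every crossing with the overpass is followed by a crossing with `R`. -/
def Reduced (L O : List Passage) : Prop :=
  ∀ A x B, L = A ++ x :: B → x.partner ∈ O → ∃ h B', B = h :: B' ∧ h.partner ∉ O

theorem Overpass.right_eq {K : Knot} {o : Bool} {L₀ R L O : List Passage} (h : Overpass K o L₀ R L O R) :
    ∀ p ∈ R, p.partner ∉ O := by
  have := h.filter_right
  rw [List.filter_eq_self] at this
  simpa using this

theorem Overpass.partner_mem_left {K : Knot} {o : Bool} {L₀ R L O : List Passage}
    (h : Overpass K o L₀ R L O R) : ∀ p ∈ O, p.partner ∈ L := by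
  intro p hp
  have h1 := h.represents.isGaussCode.partner_mem p (by simp [hp])
  have h2 : p.partner ∉ O := fun hp' => by
    have h3 := h.isOver_eq p hp
    have h4 := h.isOver_eq _ hp'
    rw [Passage.partner_isOver, h3] at h4
    simp at h4
  have h3 : p.partner ∉ R := fun hp' => h.right_eq _ hp' (by simpa using hp)
  simp only [List.mem_append] at h1
  tauto

/-- Removing crossings of `L` with `O`, those of the passages in `X`, leaves an overpass. -/
theorem Overpass.of_remove {K : Knot} {o : Bool} {L₀ R L O L' O' X : List Passage}
    (h : Overpass K o L₀ R L O R) (hr : Represents (L' ++ O' ++ R) K) (hO : ∀ p, p ∈ O ↔ p ∈ O' ∨ p ∈ X)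
    (hL : L' = L.filter fun p => p.partner ∉ X) : Overpass K o L₀ R L' O' R := by
  refine ⟨hr, fun p hp => h.isOver_eq p ((hO p).2 (Or.inl hp)), fun p hp hp' => ?_, h.right_simple, ?_, ?_⟩
  · rw [hL, List.mem_filter] at hp hp'
    exact h.left_simple p hp.1 hp'.1
  · rw [← h.filter_left, hL, List.filter_filter]
    refine List.filter_congr fun p hp => ?_
    have := hO p.partner
    simp only [this]
    grind
  · rw [List.filter_eq_self]
    intro p hp
    have := h.right_eq p hp
    rw [hO] at this
    simp only [decide_eq_true_eq]
    tauto

theorem List.eq_append_getElem_getElem {α : Type*} (l : List α) {i : ℕ} (hi : i + 1 < l.length) :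
    ∃ u v, l = u ++ l[i] :: l[i + 1] :: v :=
  ⟨l.take i, l.drop (i + 2), by
    rw [List.cons_getElem_drop_succ, List.cons_getElem_drop_succ, List.take_append_drop]⟩

theorem Overpass.remove_kink {K : Knot} {o : Bool} {L₀ R A O : List Passage} {p : Passage}
    (h : Overpass K o L₀ R (A ++ [p.partner]) (p :: O) R) : Overpass K o L₀ R A O R := by
  have hn := h.represents.isGaussCode.nodup
  refine h.of_remove (X := [p]) ?_ (by simp; tauto) ?_
  · have h1 := h.represents
    have h2 : Represents (A ++ p.partner :: p.partner.partner :: (O ++ R)) K := by simpa using h1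
    simpa using h2.remove_kink
  · have h1 : p.partner ∉ A := by grind
    rw [List.filter_append, List.filter_eq_self.2]
    · simp
    · intro r hr
      simp only [List.mem_singleton, decide_eq_true_eq]
      exact fun h => h1 (by rwa [← h, Passage.partner_partner])

theorem Overpass.remove_bigon {K : Knot} {o b : Bool} {L₀ R A B P Q : List Passage} {p q : Passage}
    (h : Overpass K o L₀ R (A ++ (seg b p.partner q.partner ++ B)) (P ++ p :: q :: Q) R)
    (hpq : p.leftward ≠ q.leftward) : Overpass K o L₀ R (A ++ B) (P ++ Q) R := by
  have hn := h.represents.isGaussCode.nodup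
  have ho1 := h.isOver_eq p (by simp)
  have ho2 := h.isOver_eq q (by simp)
  have hpq : p.isPositive ≠ q.isPositive := fun h => hpq (by
    unfold Passage.leftward; rw [ho1, ho2, h])
  refine h.of_remove (X := [p, q]) ?_ (fun r => by simp; tauto) ?_
  · have h2 : Represents ([] ++ [p, q] ++ (Q ++ R ++ A) ++ seg b p.partner q.partner ++ (B ++ P)) K :=
      h.represents.of_rotate (A ++ (seg b p.partner q.partner ++ B) ++ P) ([p, q] ++ Q ++ R)
        (by simp) (by simp)
    exact (h2.remove_bigon (ho1.trans ho2.symm) hpq).of_rotate (Q ++ R) (A ++ B ++ P)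
      (by simp) (by simp)
  · have h1 : ∀ r ∈ A ++ B, r ≠ p.partner ∧ r ≠ q.partner := by
      clear h
      cases b <;> simp only [seg, if_true, if_false, Bool.false_eq_true] at hn <;> grind
    have h2 : ∀ C : List Passage, (∀ r ∈ C, r ∈ A ++ B) → C.filter (fun r => r.partner ∉ [p, q]) = C := by
      intro C hC
      rw [List.filter_eq_self]
      intro r hr
      have := h1 r (hC r hr)
      simp only [List.mem_cons, List.not_mem_nil, or_false, decide_eq_true_eq, not_or]
      exact ⟨fun h => this.1 (by rw [← h, Passage.partner_partner]),
        fun h => this.2 (by rw [← h, Passage.partner_partner])⟩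
    rw [List.filter_append, List.filter_append, h2 A fun r hr => List.mem_append_left _ hr,
      h2 B fun r hr => List.mem_append_right _ hr]
    cases b <;> simp [seg]

/-- An overpass that is not reduced has a monogon or a bigon with `L`, which can be removed. -/
theorem Overpass.exists_shorter {K : Knot} {o : Bool} {L₀ R L O : List Passage}
    (h : Overpass K o L₀ R L O R) (hred : ¬ Reduced L O) :
    ∃ L' O', O'.length < O.length ∧ Overpass K o L₀ R L' O' R := by
  obtain ⟨c, _, -, hc⟩ := exists_fresh (L ++ O ++ R)
  -- with a kink `k` at the end of `L`, a monogon there is a bigon with one corner at `k`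
  obtain ⟨k, hk⟩ : ∃ k : Passage, k.crossing = c := ⟨⟨c, true, true⟩, rfl⟩
  have hkc : ∀ r ∈ L ++ O ++ R, r.crossing ≠ k.crossing := fun r hr => by rw [hk]; exact (hc r hr).1
  have hG := h.represents.isGaussCode
  have hG' : IsGaussCode ((L ++ [k]) ++ (k.partner :: O) ++ R) :=
    (hG.cons_cons hkc).of_perm (List.perm_iff_count.2 fun x => by
      simp only [List.count_append, List.count_cons, List.count_nil]; ring)
  have hs' : IsSeparating ((L ++ [k]) ++ (k.partner :: O) ++ R) := by
    have h1 : IsSeparating (L ++ (O ++ R)) := by simpa using h.represents.isSeparating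
    simpa using h1.add_kink (p := k) (by simpa using hkc)
  have hkmem : ∀ r, r.crossing = k.crossing → r ∉ L ∧ r ∉ O ∧ r ∉ R := fun r hr =>
    ⟨fun h => hkc r (by simp [h]) hr, fun h => hkc r (by simp [h]) hr, fun h => hkc r (by simp [h]) hr⟩
  have hk1 := hkmem k rfl
  have hk2 := hkmem k.partner rfl
  have hLs : ∀ p ∈ L ++ [k], p.partner ∉ L ++ [k] := by
    intro p hp hp'
    simp only [List.mem_append, List.mem_singleton] at hp hp'
    rcases hp with hp | rfl <;> rcases hp' with hp' | hp'
    · exact h.left_simple p hp hp'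
    · exact (hkmem p (by rw [← hp']; rfl)).1 hp
    · exact hk2.1 hp'
    · exact Passage.partner_ne _ hp'
  have hO : ∀ p ∈ k.partner :: O, p.partner ∈ L ++ [k] := by
    intro p hp
    rcases List.mem_cons.1 hp with rfl | hp
    · simp
    · simp [h.partner_mem_left p hp]
  have hR : ∀ p ∈ R, p.partner ∈ L ++ [k] := fun p hp => by
    simp [h.mem_left_of_mem_right hp (h.right_eq p hp)]
  obtain ⟨y, hy, hy1, hy2⟩ : ∃ y, ∃ hy : y + 1 < (L ++ [k]).length,
      (L ++ [k])[y].partner ∈ k.partner :: O ∧ (L ++ [k])[y + 1].partner ∈ k.partner :: O := by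
    unfold Reduced at hred
    push Not at hred
    obtain ⟨A, x, B, rfl, hx, hB⟩ := hred
    refine ⟨A.length, by simp, by simp [hx], ?_⟩
    rcases B with _ | ⟨b, B⟩
    · simp
    · simp [hB b B rfl]
  obtain ⟨s, hs, x, hx, hxs, hε⟩ := exists_bigon hG' hs' hLs hO hR hy hy1 hy2 (k := k) (by simp) (by simp)
  have hn := hG.nodup
  have hxL : ∀ p ∈ O, ∀ y (hy : y < (L ++ [k]).length), (L ++ [k])[y] = p.partner →
      ∃ hy' : y < L.length, L[y] = p.partner := by
    intro p hp y hy h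
    simp only [List.length_append, List.length_singleton] at hy
    rcases Nat.lt_or_ge y L.length with h' | h'
    · exact ⟨h', by rwa [List.getElem_append_left h'] at h⟩
    · obtain rfl : y = L.length := by omega
      rw [List.getElem_concat_length] at h
      · exact absurd hp (hkmem p (congrArg Passage.crossing h).symm).2.1
      · rfl
  have hkx : ∀ y (hy : y < (L ++ [k]).length), (L ++ [k])[y] = k → y = L.length := by
    intro y hy h
    simp only [List.length_append, List.length_singleton] at hy
    by_contra hne
    rw [List.getElem_append_left (by omega)] at h
    exact hk1.1 (h ▸ List.getElem_mem _)
  rcases s with _ | s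
  · -- the crossing `k` is a corner of the bigon
    rcases O with _ | ⟨p, O⟩
    · simp at hs
    simp only [List.getElem_cons_zero, List.getElem_cons_succ, Passage.partner_partner] at hxs
    have hx2 : x + 1 = L.length ∧ (L ++ [k])[x] = p.partner := by
      rcases hxs with h | h
      · have := hkx _ _ h.1
        simp only [List.length_append, List.length_singleton] at hx
        omega
      · exact ⟨hkx _ _ h.2, h.1⟩
    obtain ⟨hx3, hx4⟩ := hxL p (by simp) x (by omega) hx2.2
    obtain ⟨A, rfl⟩ : ∃ A, L = A ++ [p.partner] := by
      refine ⟨L.take x, ?_⟩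
      rw [← hx4, List.take_concat_get', hx2.1, List.take_length]
    exact ⟨A, O, by simp, h.remove_kink⟩
  · simp only [List.getElem_cons_succ] at hxs hε
    have hs2 : s + 1 < O.length := by simpa using hs
    simp only [Nat.add_eq_zero_iff, one_ne_zero, and_false, false_or] at hε
    obtain ⟨P, Q, hPQ⟩ := O.eq_append_getElem_getElem hs2
    obtain ⟨b, A, B, hAB⟩ : ∃ b A B, L = A ++ (seg b O[s].partner O[s + 1].partner ++ B) := by
      rcases hxs with ⟨h1, h2⟩ | ⟨h1, h2⟩
      · obtain ⟨h3, h4⟩ := hxL _ (List.getElem_mem _) _ _ h1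
        obtain ⟨h5, h6⟩ := hxL _ (List.getElem_mem _) _ _ h2
        obtain ⟨A, B, hAB⟩ := L.eq_append_getElem_getElem h5
        exact ⟨true, A, B, by rw [← h4, ← h6]; exact hAB⟩
      · obtain ⟨h3, h4⟩ := hxL _ (List.getElem_mem _) _ _ h1
        obtain ⟨h5, h6⟩ := hxL _ (List.getElem_mem _) _ _ h2
        obtain ⟨A, B, hAB⟩ := L.eq_append_getElem_getElem h5
        exact ⟨false, A, B, by rw [← h4, ← h6]; exact hAB⟩
    generalize O[s] = p at *
    generalize O[s + 1] = q at *
    subst hPQ hAB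
    exact ⟨A ++ B, P ++ Q, by simp, h.remove_bigon hε⟩

theorem Overpass.exists_reduced {K : Knot} {o : Bool} {L₀ R L O : List Passage}
    (h : Overpass K o L₀ R L O R) : ∃ L' O', Overpass K o L₀ R L' O' R ∧ Reduced L' O' := by
  induction hn : O.length using Nat.strong_induction_on generalizing L O with
  | h n ih =>
    by_cases hr : Reduced L O
    · exact ⟨L, O, h, hr⟩
    · obtain ⟨L', O', h1, h2⟩ := h.exists_shorter hr
      exact ih _ (hn ▸ h1) h2 rfl

/-! ### Counting the crossings of the overpass -/

/-- If every element with property `P` is directly followed by one without, then at most half of the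
elements have property `P`. -/
theorem List.length_filter_le_of_isolated {α : Type*} {P : α → Bool} (l : List α)
    (h : ∀ A x B, l = A ++ x :: B → P x → ∃ y B', B = y :: B' ∧ ¬ P y) :
    (l.filter P).length ≤ (l.filter fun x => ! P x).length := by
  induction hn : l.length using Nat.strong_induction_on generalizing l with
  | h n ih =>
    rcases l with _ | ⟨x, l⟩
    · simp
    · by_cases hx : P x
      · obtain ⟨y, l, rfl, hy⟩ := h [] x l rfl hx
        have := ih l.length (by simp at hn; omega) l
          (fun A z B hl => h (x :: y :: A) z B (by simp [hl])) rfl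
        simpa [List.filter_cons, hx, hy] using this
      · have := ih l.length (by simp at hn; omega) l
          (fun A z B hl => h (x :: A) z B (by simp [hl])) rfl
        simp only [List.filter_cons, hx]
        simp only [Bool.not_false, if_true, List.length_cons, Bool.false_eq_true, if_false]
        omega

theorem Overpass.length_le_of_reduced {K : Knot} {o : Bool} {L₀ R₀ L O R : List Passage}
    (h : Overpass K o L₀ R₀ L O R) (hr : Reduced L O) : L.length ≤ 2 * L₀.length := by
  have h1 := L.length_filter_le_of_isolated (P := fun p => decide (p.partner ∈ O)) (by
    simpa [Reduced] using hr)
  have h2 := h.filter_left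
  have h3 := L.length_eq_length_filter_add (fun p => decide (p.partner ∈ O))
  simp only [← decide_not] at h1 h3
  rw [h2] at h1 h3
  omega

/-! ### The ends of the left strand -/

/-- The corners obtained by combining two colours at each corner. -/
def Corners.map₂ (f : ZMod 2 → ZMod 2 → ZMod 2) (k k' : Corners) : Corners :=
  ⟨f k.sw k'.sw, f k.se k'.se, f k.nw k'.nw, f k.ne k'.ne⟩

theorem sidesIn_map₂ (f : ZMod 2 → ZMod 2 → ZMod 2) (κ κ' : ℕ → Corners) (p : Passage) :
    sidesIn (fun c => (κ c).map₂ f (κ' c)) p =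
      (f (sidesIn κ p).1 (sidesIn κ' p).1, f (sidesIn κ p).2 (sidesIn κ' p).2) := by
  unfold sidesIn Corners.map₂; split <;> rfl

theorem sidesOut_map₂ (f : ZMod 2 → ZMod 2 → ZMod 2) (κ κ' : ℕ → Corners) (p : Passage) :
    sidesOut (fun c => (κ c).map₂ f (κ' c)) p =
      (f (sidesOut κ p).1 (sidesOut κ' p).1, f (sidesOut κ p).2 (sidesOut κ' p).2) := by
  unfold sidesOut Corners.map₂; split <;> rfl

theorem Fits.map₂ (f : ZMod 2 → ZMod 2 → ZMod 2) {κ κ' : ℕ → Corners} {l : List Passage}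
    {s s' t t' : SideColors} (h : Fits κ s l t) (h' : Fits κ' s' l t') :
    Fits (fun c => (κ c).map₂ f (κ' c)) (f s.1 s'.1, f s.2 s'.2) l (f t.1 t'.1, f t.2 t'.2) := by
  induction l generalizing s s' with
  | nil => simp_all
  | cons p l ih =>
    obtain ⟨rfl, h⟩ := h
    obtain ⟨rfl, h'⟩ := h'
    refine ⟨sidesIn_map₂ .., ?_⟩
    rw [sidesOut_map₂]
    exact ih h h'

theorem Fits.filter {κ : ℕ → Corners} {l : List Passage} {s t : SideColors} {P : Passage → Bool}
    (h : Fits κ s l t) (hP : ∀ p ∈ l, P p = false → sidesOut κ p = sidesIn κ p) :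
    Fits κ s (l.filter P) t := by
  induction l generalizing s with
  | nil => exact h
  | cons p l ih =>
    obtain ⟨rfl, h⟩ := h
    have := ih h fun q hq => hP q (List.mem_cons_of_mem _ hq)
    cases hp : P p
    · rw [List.filter_cons_of_neg (by simp [hp])]
      rwa [hP p List.mem_cons_self hp] at this
    · rw [List.filter_cons_of_pos (by simp [hp])]
      exact ⟨rfl, this⟩

theorem sidesOut_partner_eq {κ : ℕ → Corners} {p : Passage} (h : (sidesIn κ p).jump = 0)
    (h' : (sidesOut κ p).jump = 0) : sidesOut κ p.partner = sidesIn κ p.partner := by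
  rw [jump_eq_zero_iff] at h h'
  revert h h'
  unfold sidesIn sidesOut
  cases hl : p.leftward <;> simp [hl] <;> intros <;> simp [*]

/-- No colouring of the faces cut out by the strands `L₀` and `R₀`, of which the second one ends
where the first one begins, distinguishes the two ends of `L₀`: these ends lie in the same face.
Nothing is assumed about the colour at the beginning of `R₀`. -/
def SameRegion (L₀ R₀ : List Passage) : Prop :=
  ∀ (κ : ℕ → Corners) (t c : ZMod 2), Fits κ (0, 0) L₀ (t, t) → Fits κ (c, c) R₀ (0, 0) → t = 0

/-- If the strand `O` begins with a crossing with the edge before `L₀`, then it connects the ends of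
`L₀`. -/
theorem Overpass.sameRegion {K : Knot} {o : Bool} {L₀ R₀ U R : List Passage} {x : Passage}
    (h : Overpass K o L₀ R₀ (x.partner :: L₀) (x :: U) R) : SameRegion L₀ R₀ := by
  intro κ t c hL hR
  have hG := h.represents.isGaussCode
  have hn := hG.nodup
  obtain ⟨κ', s, h1, h2, h3⟩ := h.represents.isSeparating
    (fun c => if ∃ p ∈ x :: U, p.crossing = c then 0 else (κ c).total) 0
  have hO0 : ∀ p ∈ x :: U, (κ' p.crossing).total = 0 := fun p hp => by
    rw [h2 p (by simp only [List.mem_append]; tauto), if_pos ⟨p, hp, rfl⟩]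
  have hT : ∀ p ∈ (x.partner :: L₀) ++ R, p.partner ∉ x :: U →
      (κ' p.crossing).total = (κ p.crossing).total := fun p hp hp' => by
    have hpw : p ∈ x.partner :: L₀ ++ x :: U ++ R := by
      simp only [List.mem_append] at hp ⊢; tauto
    rw [h2 p hpw, if_neg]
    rintro ⟨q, hq, hqp⟩
    rcases hG.eq_or_eq_partner (p := q) (q := p) (by simp only [List.mem_append]; tauto) hpw hqp
      with rfl | rfl
    · clear h1 h2 h; grind
    · exact hp' hq
  have hL₀ : ∀ p ∈ L₀, p.partner ∉ x :: U := fun p hp => by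
    rw [← h.filter_left, List.mem_filter] at hp
    simpa using hp.2
  simp only [List.append_assoc, List.cons_append, fits_append, fits_cons] at h1
  obtain ⟨rfl, t2, h4, rfl, t3, h5, h6⟩ := h1
  have htx : (κ' x.crossing).total = 0 := hO0 x (by simp)
  have hs0 : (sidesIn κ' x.partner).jump = 0 := h3
  obtain ⟨a, ha⟩ : ∃ a, sidesIn κ' x.partner = (a, a) :=
    ⟨_, Prod.ext rfl (jump_eq_zero_iff.1 hs0).symm⟩
  have hj : (sidesIn κ' x).jump = 0 := by
    have e1 := h4.jump_eq (u := fun c => (κ c).total) fun p hp => hT p (by simp [hp]) (hL₀ p hp)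
    have e2 := hL.jump_eq (u := fun c => (κ c).total) fun p hp => rfl
    rw [jump_sidesOut, Passage.partner_crossing, htx, hs0] at e1
    rw [e1]
    simpa [SideColors.jump, CharTwo.add_self_eq_zero] using e2.symm
  have hx := sides_eq_of_partner htx hj ha
  have hx' := sides_eq_of_partner (p := x.partner) htx hs0 (by simpa using hx.1)
  rw [hx.1, hx'.2] at h4
  have hOj : ∀ p ∈ x :: U, (sidesIn κ' p).jump = 0 :=
    Fits.sides_eq (s := sidesIn κ' x) (t := t3) ⟨rfl, h5⟩ hj hO0
  have hR' : Fits κ' t3 R₀ (a, a) := by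
    rw [← h.filter_right, ← ha]
    refine h6.filter fun p hp hp' => ?_
    have hp' : p.partner ∈ x :: U := by simpa only [decide_eq_false_iff_not, not_not] using hp'
    rw [sidesOut_of_total_eq_zero (by simpa using hO0 _ hp'), hOj _ hp']
    simp
  have ht3 : t3.jump = 0 := by
    have := h5.jump_eq (u := fun c => 0) fun p hp => hO0 p (by simp [hp])
    simpa [hx.2, SideColors.jump, CharTwo.add_self_eq_zero] using this
  have d1 := hL.map₂ (· + ·) h4
  have d2 := hR.map₂ (· + ·) hR'
  have hR₀ : ∀ p ∈ R₀, p ∈ R ∧ p.partner ∉ x :: U := fun p hp => by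
    rw [← h.filter_right, List.mem_filter] at hp
    simpa using hp
  have hd : ∀ p ∈ (x.partner :: L₀) ++ R, p.partner ∉ x :: U →
      ((κ p.crossing).map₂ (· + ·) (κ' p.crossing)).total = 0 := fun p hp hp' => by
    have := hT p hp hp'
    revert this
    unfold Corners.total Corners.map₂
    intro; grind
  have hj2 := d2.sides_eq (by
    rw [jump_eq_zero_iff] at ht3
    simp only [SideColors.jump, ht3, CharTwo.add_self_eq_zero]) fun p hp =>
      hd p (by simp [(hR₀ p hp).1]) (hR₀ p hp).2
  have hc := d1.sides_const (fun p hp => hd p (by simp [hp]) (hL₀ p hp)) fun p hp => hj2 _ (by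
    rw [← h.filter_right, List.mem_filter]
    refine ⟨h.mem_right_of_mem_left (by simp [hp]) (hL₀ p hp), ?_⟩
    simp only [Passage.partner_partner, decide_eq_true_eq]
    clear h; grind)
  have := congrArg Prod.fst hc.1
  simpa using this

/-- The closed curve that runs along `L` from the passage before the crossing with `p` to the
passage `y` after it, and back along `R`. It turns at the crossings where `u` is `1`, and `z` tells
whether it contains the edge at the base point, which is the case if there is no passage of `L`
before the crossing with `p`. -/
theorem Overpass.exists_cycle {K : Knot} {o : Bool} {L₀ R L O A B : List Passage} {p y : Passage}
    (h : Overpass K o L₀ R L (p :: O) R) (hr : Reduced L (p :: O)) (hL : L = A ++ p.partner :: y :: B)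
    (hy : y.partner ∉ p :: O) : ∃ (u : ℕ → ZMod 2) (z : ZMod 2),
      (∀ q ∈ p :: O, u q.crossing = 0) ∧ z + (A.map fun q => u q.crossing).sum = 1 ∧
      u y.crossing = 1 ∧ (∀ q ∈ B, u q.crossing = 0) ∧
      ∀ A₁ q A₂, A = A₁ ++ q :: A₂ → q.partner ∈ p :: O →
        z + (A₁.map fun q => u q.crossing).sum = 0 := by
  subst hL
  have hn := h.represents.isGaussCode.nodup
  have hG := h.represents.isGaussCode
  have hcL : ∀ q ∈ A ++ p.partner :: y :: B, ∀ q' ∈ A ++ p.partner :: y :: B,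
      q.crossing = q'.crossing → q = q' := fun q hq q' hq' hqq =>
    (hG.eq_or_eq_partner (by simp only [List.mem_append] at hq ⊢; tauto)
      (by simp only [List.mem_append] at hq' ⊢; tauto) hqq).resolve_right fun he =>
        h.left_simple q' hq' (he ▸ hq)
  have hcO : ∀ q ∈ p :: O, ∀ q' ∈ A ++ p.partner :: y :: B, q'.partner ∉ p :: O →
      q.crossing ≠ q'.crossing := fun q hq q' hq' hqO hqq => by
    rcases hG.eq_or_eq_partner (p := q) (q := q') (by simp only [List.mem_append]; tauto)
      (by simp only [List.mem_append] at hq' ⊢; tauto) hqq with rfl | rfl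
    · clear h hr; grind
    · exact hqO hq
  have hnL : (A ++ p.partner :: y :: B).Nodup := by clear h hr hcL hcO; grind
  have hyB : ∀ q ∈ B, q.crossing ≠ y.crossing := fun q hq hqy => by
    have := hcL q (by simp [hq]) y (by simp) hqy
    clear h hr hcL hcO; grind
  rcases List.eq_nil_or_concat' A with rfl | ⟨A', g, rfl⟩
  · refine ⟨fun c => if c = y.crossing then 1 else 0, 1, fun q hq => ?_, by simp, by simp,
      fun q hq => if_neg (hyB q hq), fun A₁ q A₂ hA => by simp at hA⟩
    exact if_neg (hcO q hq y (by simp) hy)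
  · have hgO : g.partner ∉ p :: O := fun hg => by
      obtain ⟨y', B', hB, hy'⟩ := hr A' g (p.partner :: y :: B) (by simp) hg
      obtain ⟨rfl, -⟩ := List.cons_eq_cons.1 hB
      simp at hy'
    have hgy : g.crossing ≠ y.crossing := fun hqy => by
      have := hcL g (by simp) y (by simp) hqy
      clear h hr hcL hcO; grind
    have hA' : ∀ q ∈ A', q.crossing ≠ y.crossing ∧ q.crossing ≠ g.crossing := fun q hq => by
      constructor
      · intro hqy
        have := hcL q (by simp [hq]) y (by simp) hqy
        clear h hr hcL hcO; grind
      · intro hqy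
        have := hcL q (by simp [hq]) g (by simp) hqy
        clear h hr hcL hcO; grind
    have hA0 : ∀ A₁ : List Passage, (∀ q ∈ A₁, q ∈ A') → (A₁.map fun q =>
        if q.crossing = y.crossing ∨ q.crossing = g.crossing then (1 : ZMod 2) else 0).sum = 0 := by
      intro A₁ hA₁
      refine List.sum_eq_zero fun x hx => ?_
      obtain ⟨q, hq, rfl⟩ := List.mem_map.1 hx
      exact if_neg (not_or.2 (hA' q (hA₁ q hq)))
    refine ⟨fun c => if c = y.crossing ∨ c = g.crossing then 1 else 0, 0, fun q hq => ?_, ?_, by simp,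
      fun q hq => ?_, fun A₁ q A₂ hA hq => ?_⟩
    · exact if_neg (not_or.2 ⟨hcO q hq y (by simp) hy, hcO q hq g (by simp) hgO⟩)
    · rw [List.map_append, List.sum_append, hA0 A' fun _ => id]
      simp
    · refine if_neg (not_or.2 ⟨hyB q hq, fun hqg => ?_⟩)
      have := hcL q (by simp [hq]) g (by simp) hqg
      clear h hr hcL hcO; grind
    · rw [zero_add]
      apply hA0
      rcases List.eq_nil_or_concat' A₂ with rfl | ⟨A₃, g', rfl⟩
      · obtain ⟨rfl, hgq⟩ := List.append_inj' hA rfl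
        simp only [List.cons.injEq, and_true] at hgq
        exact absurd (hgq ▸ hq) hgO
      · have hA : A' ++ [g] = (A₁ ++ q :: A₃) ++ [g'] := by simpa using hA
        obtain ⟨rfl, -⟩ := List.append_inj' hA rfl
        intro r hr
        simp [hr]

/-- A set of faces which has the strand `O` on its boundary only before `p`. -/
theorem Overpass.exists_coloring {K : Knot} {o : Bool} {L₀ R L O A B : List Passage} {p y : Passage}
    (h : Overpass K o L₀ R L (p :: O) R) (hr : Reduced L (p :: O)) (hL : L = A ++ p.partner :: y :: B)
    (hy : y.partner ∉ p :: O) : ∃ (χ : ℕ → Corners) (s t : SideColors),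
      Fits χ s L t ∧ Fits χ t (p :: (O ++ R)) s ∧
      (sidesIn χ p.partner).jump = 1 ∧ (∀ q ∈ O, (sidesIn χ q.partner).jump = 0) ∧ t.jump = 0 ∧
      ∀ q ∈ p :: O, (χ q.crossing).total = 0 := by
  obtain ⟨u, z, huO, huA, huy, huB, huA'⟩ := h.exists_cycle hr hL hy
  subst hL
  have hn := h.represents.isGaussCode.nodup
  obtain ⟨χ, s, h1, h2, h3⟩ := h.represents.isSeparating u z
  rw [List.append_assoc, fits_append] at h1
  obtain ⟨t, h4, h5⟩ := h1
  have h4' := h4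
  rw [fits_append] at h4'
  obtain ⟨s', hA, rfl, hy1, hB⟩ := h4'
  have ht : ∀ q ∈ A ++ p.partner :: y :: B, (χ q.crossing).total = u q.crossing := fun q hq =>
    h2 q (by simp only [List.mem_append] at hq ⊢; tauto)
  have hp1 : (sidesIn χ p.partner).jump = 1 := by
    rw [hA.jump_eq fun q hq => ht q (by simp [hq])]
    exact (congrArg (· + _) h3).trans huA
  have hyo : (sidesOut χ y).jump = 0 := by
    rw [jump_sidesOut, hy1, jump_sidesOut, hp1, ht p.partner (by simp), ht y (by simp), huy,
      Passage.partner_crossing, huO p (by simp)]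
    decide
  have hB0 : ∀ B₁ : List Passage, (∀ q ∈ B₁, q ∈ B) → (B₁.map fun q => u q.crossing).sum = 0 := by
    intro B₁ hB₁
    refine List.sum_eq_zero fun x hx => ?_
    obtain ⟨q, hq, rfl⟩ := List.mem_map.1 hx
    exact huB q (hB₁ q hq)
  refine ⟨χ, s, t, h4, h5, hp1, fun q hq => ?_, ?_, fun q hq => ?_⟩
  · have hqL := h.partner_mem_left q (by simp [hq])
    simp only [List.mem_append, List.mem_cons] at hqL
    rcases hqL with hqA | hqp | hqy | hqB
    · obtain ⟨A₁, A₂, rfl⟩ := List.append_of_mem hqA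
      rw [fits_append] at hA
      obtain ⟨s₁, hA₁, rfl, -⟩ := hA
      rw [hA₁.jump_eq fun r hr => ht r (by simp [hr])]
      exact (congrArg (· + _) h3).trans (huA' A₁ _ A₂ rfl (by simp [hq]))
    · have := Passage.partner_injective hqp
      clear h hr; grind
    · exact absurd (by simp [← hqy, hq]) hy
    · obtain ⟨B₁, B₂, rfl⟩ := List.append_of_mem hqB
      rw [fits_append] at hB
      obtain ⟨s₁, hB₁, rfl, -⟩ := hB
      rw [hB₁.jump_eq fun r hr => ht r (by simp [hr]), hyo, hB0 B₁ (by simp +contextual), add_zero]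
  · rw [hB.jump_eq fun r hr => ht r (by simp [hr]), hyo, hB0 B fun _ => id, add_zero]
  · rw [h2 q (by simp only [List.mem_append]; tauto), huO q hq]

/-- After the reduction, no set of faces of the diagram separates the first edge of `L` from the
edge between `L` and `O`. -/
theorem Overpass.not_separated {K : Knot} {o : Bool} {L₀ R L O : List Passage}
    (h : Overpass K o L₀ R L O R) (hr : Reduced L O) (hreg : SameRegion L₀ R) (κ : ℕ → Corners) :
    ¬ (Fits κ (0, 0) L (1, 1) ∧ Fits κ (1, 1) (O ++ R) (0, 0)) := by
  rintro ⟨hL, hOR⟩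
  rcases O with _ | ⟨p, O⟩
  · have := h.filter_left
    rw [List.filter_eq_self.2 (by simp)] at this
    subst this
    exact one_ne_zero (hreg κ 1 1 hL hOR)
  have hpL := h.partner_mem_left p (by simp)
  obtain ⟨A, B, rfl⟩ := List.append_of_mem hpL
  obtain ⟨y, B, rfl, hy⟩ := hr A p.partner B rfl (by simp)
  obtain ⟨χ, s, t, hχ1, hχ2, hχp, hχL, hχO, hχt⟩ := h.exists_coloring hr rfl hy
  obtain ⟨rfl, hχ2⟩ := hχ2
  obtain ⟨hκp, hOR⟩ := hOR
  obtain ⟨b, hb⟩ : ∃ b, sidesIn χ p = (b, b) := ⟨_, Prod.ext rfl (jump_eq_zero_iff.1 hχO).symm⟩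
  have hb' : sidesOut χ p = (b + 1, b + 1) := by
    rw [sidesOut_of_total_eq_zero (hχt p (by simp)), hχp, hb]; rfl
  rw [hb'] at hχ2
  rw [hb] at hχ1
  -- the part of the set `κ` that is in the set `χ + b + 1`
  let f : ZMod 2 → ZMod 2 → ZMod 2 := fun k c => k * (c + b + 1)
  have hf : ∀ k, f k b = k ∧ f k (b + 1) = 0 ∧ f 0 k = 0 := by
    intro k; simp only [f]; refine ⟨?_, ?_, ?_⟩ <;> grind
  have hf1 : ∀ k, f k b = k := fun k => (hf k).1
  have hf2 : ∀ k, f k (b + 1) = 0 := fun k => (hf k).2.1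
  have hf0 : ∀ k, f 0 k = 0 := fun k => (hf k).2.2
  obtain ⟨s', hχO', hχR⟩ := (fits_append ..).1 hχ2
  obtain ⟨t', hκO, hκR⟩ := (fits_append ..).1 hOR
  obtain ⟨rfl, hχc⟩ := hχO'.sides_const (fun q hq => hχt q (by simp [hq])) hχL
  have hR := hκR.map₂ f hχR
  have hL' := hL.map₂ f hχ1
  simp only [hf0, hf1, hf2] at hR hL'
  refine one_ne_zero (hreg _ 1 0 ?_ hR)
  rw [← h.filter_left]
  refine hL'.filter fun q hq hqO => ?_
  have hqO : q.partner ∈ p :: O := by simpa only [decide_eq_false_iff_not, not_not] using hqO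
  rw [← q.partner_partner]
  rcases List.mem_cons.1 hqO with hqp | hqO
  · refine sidesOut_partner_eq ?_ ?_
    · rw [sidesIn_map₂, hqp, hb, hκp]
      simp only [hf1]; rfl
    · rw [sidesOut_map₂, hqp, hb']
      simp only [hf2]; rfl
  · refine sidesOut_partner_eq ?_ ?_
    · rw [sidesIn_map₂, (hχc _ hqO).1]
      simp only [hf2]; rfl
    · rw [sidesOut_map₂, (hχc _ hqO).2]
      simp only [hf2]; rfl

/-! ### Straight diagrams -/

theorem perm_map_partner {L M : List Passage} (hG : IsGaussCode (L ++ M)) (hL : ∀ p ∈ L, p.partner ∉ L)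
    (hM : ∀ p ∈ M, p.partner ∉ M) : (L.map Passage.partner).Perm M := by
  have hn := List.nodup_append.1 hG.nodup
  refine (List.perm_ext_iff_of_nodup (hn.1.map Passage.partner_injective) hn.2.1).2 fun p => ?_
  constructor
  · intro hp
    obtain ⟨q, hq, rfl⟩ := List.mem_map.1 hp
    have := hG.partner_mem q (by simp [hq])
    exact (List.mem_append.1 this).resolve_left (hL q hq)
  · intro hp
    have := hG.partner_mem p (by simp [hp])
    exact List.mem_map.2 ⟨p.partner, (List.mem_append.1 this).resolve_right (hM p hp), by simp⟩

theorem nodup_map_crossing {L M : List Passage} (hG : IsGaussCode (L ++ M))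
    (hL : ∀ p ∈ L, p.partner ∉ L) : (L.map Passage.crossing).Nodup := by
  refine (List.nodup_append.1 hG.nodup).1.map_on fun p hp q hq h => ?_
  refine (hG.eq_or_eq_partner (by simp [hp]) (by simp [hq]) h).resolve_right ?_
  rintro rfl
  exact hL q hq hp

/-- Labelling the crossings in the order in which `L` meets them makes the diagram straight. -/
theorem Represents.exists_straight {L M : List Passage} {K : Knot} (h : Represents (L ++ M) K)
    (hL : ∀ p ∈ L, p.partner ∉ L) (hM : ∀ p ∈ M, p.partner ∉ M) :
    ∃ (f : ℕ → ℕ) (D : KnotDiagram), D.knot = K ∧ D.IsStraight ∧ D.crossings = L.length ∧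
      D.code = L.map (Passage.relabel f) ++ M.map (Passage.relabel f) := by
  have hG := h.isGaussCode
  have hn := nodup_map_crossing hG hL
  let f : ℕ → ℕ := fun c => if c ∈ L.map Passage.crossing then (L.map Passage.crossing).idxOf c + 1
    else c + L.length + 1
  have hf : Function.Injective f := by
    intro c c' hcc
    have h1 := fun h : c ∈ L.map Passage.crossing => List.idxOf_lt_length_iff.2 h
    have h2 := fun h : c' ∈ L.map Passage.crossing => List.idxOf_lt_length_iff.2 h
    rw [List.length_map] at h1 h2
    simp only [f] at hcc
    split_ifs at hcc with h3 h4 h4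
    · exact (List.idxOf_inj h3).1 (by omega)
    · have := h1 h3; omega
    · have := h2 h4; omega
    · omega
  obtain ⟨D, hD, hK⟩ := h.relabel hf
  have hp := perm_map_partner hG hL hM
  have hlen : M.length = L.length := by rw [← hp.length_eq, List.length_map]
  have hc : D.crossings = L.length := by
    rw [KnotDiagram.crossings, numCrossings, hD]
    simp only [List.length_map, List.length_append, hlen]
    omega
  have hLf : (L.map (Passage.relabel f)).map Passage.crossing = List.range' 1 L.length := by
    apply List.ext_getElem (by simp)
    intro i h1 h2
    have hi : i < L.length := by simpa using h2
    have : (L.map Passage.crossing).idxOf L[i].crossing = i := by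
      have := hn.idxOf_getElem i (by simpa using hi)
      simpa using this
    simp only [List.getElem_map, List.getElem_range', Passage.relabel, f]
    rw [if_pos (List.mem_map_of_mem (List.getElem_mem hi)), this]
    omega
  rw [List.map_append] at hD
  refine ⟨f, D, hK, ⟨(M.map (Passage.relabel f)).map Passage.crossing, ?_, ?_⟩, hc, hD⟩
  · rw [hc, ← hLf]
    refine ((hp.symm.map _).map _).trans (List.Perm.of_eq ?_)
    simp [Passage.relabel, Function.comp_def]
  · rw [hD, List.map_append, hLf, hc]

/-- If no set of faces separates the edges at the ends of the first strand, then they have a common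
face. -/
theorem KnotDiagram.isContained_of_not_separated {D : KnotDiagram} {L M : List Passage}
    (hD : D.code = L ++ M) (hL : D.crossings = L.length) (hlen : M.length = L.length)
    (h : ∀ κ : ℕ → Corners, ¬ (Fits κ (0, 0) L (1, 1) ∧ Fits κ (1, 1) M (0, 0))) :
    D.IsContained := by
  classical
  intro p q hp hq
  by_contra hcon
  have hG := D.isGaussCode
  have h0 : D.code ≠ [] := by rintro h0; simp [h0] at hp
  have hpw : p ∈ D.code := List.mem_of_getLast? hp
  have hqw : q ∈ D.code := List.mem_of_getElem? hq
  -- the faces on the two sides of the edge that leaves `q`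
  let χ : Dart → ZMod 2 := fun d =>
    if d ∈ face D.code (q, true) ∨ d ∈ face D.code (nextPassage D.code q, false) then 1 else 0
  have hχ : ∀ d : Dart, d.1 ∈ D.code → χ (faceNext D.code d) = χ d := by
    intro d hd
    have key : ∀ e : Dart, e.1 ∈ D.code → (faceNext D.code d ∈ face D.code e ↔ d ∈ face D.code e) := by
      intro e he
      have h1 : faceNext D.code d ∈ face D.code d := ⟨1, rfl⟩
      constructor
      · intro h2
        rw [← face_eq hG he h2]
        exact face_symm hG hd h1
      · intro h2
        rw [← face_eq hG he h2]
        exact h1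
    simp only [χ, key (q, true) hqw, key (nextPassage D.code q, false) (nextPassage_mem hqw)]
  obtain ⟨κ, hκ, hfit⟩ := exists_corners hG h0 χ hχ
  have hnext := ((fits_iff_nextPassage hG.nodup h0 κ _).1 hfit).2
  have hside : ∀ r ∈ D.code, sidesOut κ r = (χ (r, true), χ (nextPassage D.code r, false)) := by
    intro r hr
    refine Prod.ext ?_ ?_
    · rw [sidesOut_eq_dartColor, hκ _ hr]
    · rw [hnext r hr, sidesIn_eq_dartColor]
      exact hκ (_, false) (nextPassage_mem hr)
  have hq1 : sidesOut κ q = (1, 1) := by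
    rw [hside q hqw]
    simp only [χ, mem_face_self, true_or, or_true, if_true]
  have hp0 : sidesOut κ p = (0, 0) := by
    rw [hside p hpw]
    have key : ∀ d ∈ D.edgeSides p, d.1 ∈ D.code → χ d = 0 := by
      intro d hd hdw
      refine if_neg fun hor => hcon ⟨d, hd, ?_⟩
      rcases hor with h1 | h1
      · exact ⟨(q, true), by simp [KnotDiagram.edgeSides], face_symm hG hqw h1⟩
      · exact ⟨(nextPassage D.code q, false), by simp [KnotDiagram.edgeSides],
          face_symm hG (nextPassage_mem hqw) h1⟩
    rw [key (p, true) (by simp [KnotDiagram.edgeSides]) hpw,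
      key (nextPassage D.code p, false) (by simp [KnotDiagram.edgeSides]) (nextPassage_mem hpw)]
  have hlast : ∀ (l : List Passage) (s t : SideColors) (r : Passage), Fits κ s l t →
      l.getLast? = some r → t = sidesOut κ r := by
    intro l s t r hl hr
    rcases List.eq_nil_or_concat' l with rfl | ⟨l, r', rfl⟩
    · simp at hr
    · simp only [fits_append, fits_cons, fits_nil] at hl
      simp only [List.getLast?_concat, Option.some.injEq] at hr
      obtain ⟨_, _, _, rfl⟩ := hl
      rw [hr]
  have hLn : L ≠ [] := by
    rintro rfl
    obtain rfl := List.length_eq_zero_iff.1 hlen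
    simp [hD] at h0
  have hqL : L.getLast? = some q := by
    rw [List.getLast?_eq_getElem?, ← hq, hL, hD, List.getElem?_append_left]
    have := List.length_pos_iff.2 hLn
    omega
  have hend := hlast _ _ _ p hfit hp
  rw [hp0] at hend
  rw [hend] at hfit
  have hfit' := hfit
  rw [hD, fits_append] at hfit'
  obtain ⟨t, h1, h2⟩ := hfit'
  obtain rfl : t = (1, 1) := (hlast _ _ _ q h1 hqL).trans hq1
  exact h κ ⟨h1, h2⟩

/-! ### From a straight diagram to a contained straight diagram -/

/-- The colours along a strand with zero totals change by the sum of the jumps of the strands it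
crosses. -/
theorem Fits.sides_add {κ : ℕ → Corners} {s t : SideColors} {l : List Passage} (h : Fits κ s l t)
    (hl : ∀ p ∈ l, (κ p.crossing).total = 0) :
    t = s.map (· + (l.map fun p => (sidesIn κ p.partner).jump).sum)
      (· + (l.map fun p => (sidesIn κ p.partner).jump).sum) := by
  induction l generalizing s with
  | nil => subst h; simp
  | cons p l ih =>
    obtain ⟨rfl, h⟩ := h
    rw [ih h fun q hq => hl q (List.mem_cons_of_mem _ hq),
      sidesOut_of_total_eq_zero (hl p List.mem_cons_self)]
    exact Prod.ext (by simp [add_assoc]) (by simp [add_assoc])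

/-- The strand between the two passages of a crossing meets the rest of the diagram an even number
of times. -/
theorem even_length_of_isSeparating {A B C : List Passage} {x : Passage}
    (hG : IsGaussCode (A ++ x.partner :: B ++ x :: C)) (hs : IsSeparating (A ++ x.partner :: B ++ x :: C))
    (hL : ∀ p ∈ A ++ x.partner :: B, p.partner ∉ A ++ x.partner :: B)
    (hM : ∀ p ∈ x :: C, p.partner ∉ x :: C) : Even B.length := by
  have hn := hG.nodup
  have hx : ∀ p ∈ A ++ B ++ C, p.crossing ≠ x.crossing := fun p hp hpx => by
    rcases hG.eq_or_eq_partner (p := p) (q := x) (by simp at hp ⊢; tauto) (by simp) hpx with rfl | rfl <;>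
    clear hs hL hM <;> grind
  obtain ⟨κ, s, h1, h2, h3⟩ := hs (fun c => if c = x.crossing then 1 else 0) 0
  have ht0 : ∀ p ∈ A ++ B ++ C, (κ p.crossing).total = 0 := fun p hp => by
    rw [h2 p (by simp at hp ⊢; tauto), if_neg (hx p hp)]
  have htx : (κ x.crossing).total = 1 := by rw [h2 x (by simp), if_pos rfl]
  simp only [List.append_assoc, List.cons_append, fits_append, fits_cons] at h1
  obtain ⟨s₁, hA, rfl, s₂, hB, rfl, hC⟩ := h1
  have hs0 : s.jump = 0 := h3
  have jA := hA.sides_eq hs0 fun p hp => ht0 p (by simp [hp])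
  have j1 : (sidesIn κ x.partner).jump = 0 := by
    have := hA.jump_eq (u := fun _ => 0) fun p hp => ht0 p (by simp [hp])
    simpa [hs0] using this
  have j2 : (sidesOut κ x.partner).jump = 1 := by
    rw [jump_sidesOut, j1, Passage.partner_crossing, htx, zero_add]
  have jB : ∀ p ∈ B, (sidesIn κ p).jump = 1 := by
    intro p hp
    obtain ⟨B₁, B₂, rfl⟩ := List.append_of_mem hp
    obtain ⟨s', hB₁, rfl, -⟩ := (fits_append ..).1 hB
    have := hB₁.jump_eq (u := fun _ => 0) fun p hp => ht0 p (by simp [hp])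
    simpa [j2] using this
  have j3 : (sidesIn κ x).jump = 1 := by
    have := hB.jump_eq (u := fun _ => 0) fun p hp => ht0 p (by simp [hp])
    simpa [j2] using this
  have j4 : (sidesOut κ x).jump = 0 := by
    rw [jump_sidesOut, j3, htx]; rfl
  have jC := hC.sides_eq j4 fun p hp => ht0 p (by simp [hp])
  have hp := perm_map_partner hG hL hM
  have hCperm : C.Perm ((A ++ B).map Passage.partner) := by
    refine (List.Perm.cons_inv (a := x) (hp.symm.trans (List.perm_iff_count.2 fun y => ?_)))
    simp only [List.map_append, List.map_cons, Passage.partner_partner, List.count_append,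
      List.count_cons]
    ring
  have e1 := hA.sides_add fun p hp => ht0 p (by simp [hp])
  have e2 := hC.sides_add fun p hp => ht0 p (by simp [hp])
  have e3 : (A.map fun p => (sidesIn κ p.partner).jump).sum = 0 := by
    refine List.sum_eq_zero fun y hy => ?_
    obtain ⟨p, hp', rfl⟩ := List.mem_map.1 hy
    refine jC _ (hCperm.mem_iff.2 (List.mem_map_of_mem (by simp [hp'])))
  have e4 : (C.map fun p => (sidesIn κ p.partner).jump).sum = (B.length : ZMod 2) := by
    rw [(hCperm.map _).sum_eq, List.map_map, List.map_append, List.sum_append]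
    have e5 : (A.map ((fun p => (sidesIn κ p.partner).jump) ∘ Passage.partner)).sum = 0 := by
      refine List.sum_eq_zero fun y hy => ?_
      obtain ⟨p, hp', rfl⟩ := List.mem_map.1 hy
      simpa using jA p hp'
    have e6 : B.map ((fun p => (sidesIn κ p.partner).jump) ∘ Passage.partner) = B.map fun _ => 1 :=
      List.map_congr_left fun p hp' => by simpa using jB p hp'
    rw [e5, e6, zero_add]
    simp
  rw [e3] at e1
  rw [e4] at e2
  have e7 : (sidesIn κ x.partner).1 = (sidesOut κ x).1 := by
    clear e1 e2 hA hB hC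
    rw [jump_eq_zero_iff] at j1 j4
    revert j1 j4
    unfold sidesIn sidesOut
    cases hl : x.leftward <;> simp only [hl, Passage.partner_leftward, Passage.partner_crossing] <;>
      simp +contextual
  have e8 : (B.length : ZMod 2) = 0 := by
    have h1 := congrArg Prod.fst e1
    have h2 := congrArg Prod.fst e2
    simp only [Prod.map_fst, add_zero] at h1 h2
    rw [← h1, e7] at h2
    simpa using h2
  exact (ZMod.natCast_eq_zero_iff_even).1 e8

theorem exists_minimal_straight {K : Knot} {n : ℕ} (hn : K.str = n) :
    (∃ D : KnotDiagram, D.knot = K ∧ D.IsStraight ∧ D.crossings = n) ∧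
      ∀ D : KnotDiagram, D.knot = K → D.IsStraight → n ≤ D.crossings := by
  constructor
  · have : Nonempty KnotDiagram := ⟨trivialDiagram⟩
    obtain ⟨D, hD⟩ := ciInf_mem fun D : KnotDiagram =>
      ⨅ (_ : D.knot = K ∧ D.IsStraight), (D.crossings : ℕ∞)
    change _ = K.str at hD
    rw [hn] at hD
    by_cases h : D.knot = K ∧ D.IsStraight
    · simp only [h, and_self, iInf_pos] at hD
      exact ⟨D, h.1, h.2, by exact_mod_cast hD⟩
    · simp [h] at hD
  · intro D h1 h2
    have : K.str ≤ D.crossings := iInf₂_le D ⟨h1, h2⟩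
    rw [hn] at this
    exact_mod_cast this

theorem KnotDiagram.IsStraight.exists_simple {D : KnotDiagram} (h : D.IsStraight) :
    ∃ L M, D.code = L ++ M ∧ L.length = D.crossings ∧ M.length = D.crossings ∧
      (∀ p ∈ L, p.partner ∉ L) ∧ ∀ p ∈ M, p.partner ∉ M := by
  obtain ⟨σ, hσ, hc⟩ := h
  have hlen : D.code.length = D.crossings + D.crossings := by
    have := congrArg List.length hc
    simpa [hσ.length_eq] using this
  have h1 : (D.code.take D.crossings).map Passage.crossing = List.range' 1 D.crossings := by
    rw [List.map_take, hc, List.take_left' (by simp)]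
  have h2 : (D.code.drop D.crossings).map Passage.crossing = σ := by
    rw [List.map_drop, hc, List.drop_left' (by simp)]
  have key : ∀ l : List Passage, (l.map Passage.crossing).Nodup → ∀ p ∈ l, p.partner ∉ l :=
    fun l hl p hp hp' => p.partner_ne (List.inj_on_of_nodup_map hl hp' hp rfl)
  refine ⟨_, _, (List.take_append_drop D.crossings D.code).symm, by simp [hlen], by simp [hlen],
    key _ ?_, key _ ?_⟩
  · rw [h1]; exact List.nodup_range'
  · rw [h2]; exact hσ.nodup_iff.2 List.nodup_range'

/-- The crossing `x` at which the second strand of a straight diagram begins is moved backwards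
along the first strand, past `A`, to the edge at the base point. -/
theorem exists_overpass {K : Knot} {A B C : List Passage} {x : Passage}
    (h : Represents (A ++ x.partner :: B ++ x :: C) K)
    (hL : ∀ p ∈ A ++ x.partner :: B, p.partner ∉ A ++ x.partner :: B)
    (hM : ∀ p ∈ x :: C, p.partner ∉ x :: C) :
    ∃ L₀ R₀ U R, Overpass K x.isOver L₀ R₀ (x.partner :: L₀) (x :: U) R ∧
      L₀.length = 2 * A.length + B.length := by
  have hn := h.isGaussCode.nodup
  have h1 : Overpass K x.isOver C.reverse (B.reverse ++ A.reverse) C.reverse ([] ++ x :: [])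
      (B.reverse ++ x.partner :: A.reverse) := by
    refine ⟨by simpa using h.reverse, by simp, fun p hp hp' => ?_, fun p hp hp' => ?_, ?_, ?_⟩
    · exact hM p (by simp at hp; simp [hp]) (by simp at hp'; simp [hp'])
    · exact hL p (by simp at hp ⊢; tauto) (by simp at hp' ⊢; tauto)
    · rw [List.filter_eq_self]
      intro p hp
      simp only [List.nil_append, List.mem_singleton, decide_eq_true_eq]
      rintro rfl
      exact hM p (by simp at hp; simp [hp]) (by simp)
    · have : ∀ p ∈ B.reverse ++ A.reverse, p.partner ≠ x := by
        rintro p hp rfl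
        clear h hL hM
        rw [Passage.partner_partner] at hn
        grind
      rw [List.filter_append, List.filter_cons_of_neg (by simp), ← List.filter_append,
        List.filter_eq_self]
      intro p hp
      simpa using this p hp
  obtain ⟨L', U, V, h2, hU, hV⟩ := h1.flip fun b hb => h1.mem_left_of_mem_right (by simp at hb ⊢; tauto) (by
    have : b.partner ≠ x := by
      rintro rfl
      clear h hL hM h1
      rw [Passage.partner_partner] at hn
      grind
    simpa using this)
  simp only [List.nil_append, List.append_nil] at h2
  have hr := h2.right_eq
  have hn2 := h2.represents.isGaussCode.nodup
  have hVo : ∀ p ∈ V, p.partner ∉ U ++ x :: V := fun p hp hp' => by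
    have e1 := h2.isOver_eq p (by simp [hp])
    have e2 := h2.isOver_eq _ hp'
    rw [Passage.partner_isOver, e1] at e2
    simp at e2
  have hS : ∀ p, p ∈ A ++ B → p ∈ B.reverse ++ A.reverse := fun p hp => by
    simp only [List.mem_append, List.mem_reverse] at hp ⊢
    tauto
  have hSO : ∀ p ∈ A ++ B, p.partner ∉ U ++ x :: V := fun p hp => hr p (hS p hp)
  have hSS : ∀ p ∈ A ++ B, p.partner ∉ A ++ B := fun p hp hp' =>
    h2.right_simple p (hS p hp) (hS _ hp')
  have hmem : ∀ p ∈ x.partner :: (A ++ B ++ V.reverse), p = x.partner ∨ p ∈ A ++ B ∨ p ∈ V := by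
    intro p hp
    simp only [List.mem_cons, List.mem_append, List.mem_reverse] at hp ⊢
    tauto
  have hx : x ∉ x.partner :: (A ++ B ++ V.reverse) := by
    intro hx
    simp only [List.mem_cons, List.mem_append, List.mem_reverse] at hx
    rcases hx with hx | hx | hx
    · exact x.partner_ne hx.symm
    · clear h hL hM h1 hn; grind
    · clear h hL hM h1 hn; grind
  refine ⟨A ++ B ++ V.reverse, _, U.reverse, L'.reverse, ⟨?_, ?_, ?_, ?_, ?_, rfl⟩, ?_⟩
  · have h3 := h2.represents.reverse
    exact h3.of_rotate (A ++ B ++ V.reverse ++ x :: U.reverse ++ L'.reverse) [x.partner]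
      (by simp) (by simp)
  · intro p hp
    refine h2.isOver_eq p ?_
    simp only [List.mem_cons, List.mem_reverse, List.mem_append] at hp ⊢
    tauto
  · intro p hp hp'
    rcases hmem p hp with rfl | h3 | h3 <;> rcases hmem _ hp' with h4 | h4 | h4
    · exact Passage.partner_ne _ h4
    · exact hx (by simpa using hp')
    · exact hx (by simpa using hp')
    · exact hx (Passage.partner_injective h4 ▸ hp)
    · exact hSS p h3 h4
    · exact hSO p h3 (by simp [h4])
    · exact hx (Passage.partner_injective h4 ▸ hp)
    · exact hSO _ h4 (by simp [h3])
    · exact hVo p h3 (by simp [h4])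
  · intro p hp hp'
    exact h2.left_simple p (by simp at hp; simp [hp]) (by simp at hp'; simp [hp'])
  · rw [List.filter_cons_of_neg (by simp), List.filter_eq_self]
    intro p hp
    simp only [decide_eq_true_eq]
    have hUV : ∀ q, q ∈ x :: U.reverse → q ∈ U ++ x :: V := fun q hq => by
      simp only [List.mem_cons, List.mem_reverse, List.mem_append] at hq ⊢
      tauto
    rw [List.mem_append, List.mem_reverse] at hp
    rcases hp with h3 | h3
    · exact fun hp' => hSO p h3 (hUV _ hp')
    · exact fun hp' => hVo p h3 (hUV _ hp')
  · simp [hV]; ring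

theorem proposition3p3 (K : Knot) (hK : K ≠ Knot.unknot) (n : ℕ) (hn : K.str = (n : ℕ∞)) :
    ∃ m : ℕ, K.cstr = (m : ℕ∞) ∧ (m : ℤ) ≤ 4 * (n : ℤ) - 8 := by
  obtain ⟨⟨D, hDK, hDs, hDn⟩, hmin⟩ := exists_minimal_straight hn
  obtain ⟨S, T, hD, hS, hT, hSs, hTs⟩ := hDs.exists_simple
  rw [hDn] at hS hT
  have hrep : Represents (S ++ T) K := ⟨D, hD, hDK⟩
  obtain _ | ⟨x, C⟩ := T
  · exfalso
    obtain rfl : S = [] := List.length_eq_zero_iff.1 (by rw [hS, ← hT]; rfl)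
    apply hK
    rw [← hDK, Knot.unknot]
    congr 1
    obtain ⟨code, _, _⟩ := D
    obtain rfl : code = [] := hD
    rfl
  have hxS : x.partner ∈ S :=
    (List.mem_append.1 (hrep.isGaussCode.partner_mem x (by simp))).resolve_right (hTs x (by simp))
  obtain ⟨A, B, rfl⟩ := List.append_of_mem hxS
  have hB : 2 ≤ B.length := by
    have heven := even_length_of_isSeparating hrep.isGaussCode hrep.isSeparating hSs hTs
    have hne : B.length ≠ 0 := by
      intro h0
      obtain rfl := List.length_eq_zero_iff.1 h0
      have h1 : Represents (A ++ x.partner :: x.partner.partner :: C) K := by simpa using hrep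
      obtain ⟨_, D', h2, h3, h4, -⟩ := h1.remove_kink.exists_straight
        (fun p hp hp' => hSs p (by simp [hp]) (by simp [hp']))
        (fun p hp hp' => hTs p (by simp [hp]) (by simp [hp']))
      have := hmin D' h2 h3
      simp at hS
      omega
    obtain ⟨k, hk⟩ := heven
    omega
  obtain ⟨L₀, R₀, U, R, h1, hlen⟩ := exists_overpass hrep hSs hTs
  have hreg := h1.sameRegion
  obtain ⟨L₁, O₁, h2⟩ := h1.exists_disjoint
  obtain ⟨L, O, h3, hred⟩ := h2.exists_reduced
  have hrep' : Represents (L ++ (O ++ R₀)) K := by simpa using h3.represents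
  have hM : ∀ p ∈ O ++ R₀, p.partner ∉ O ++ R₀ := by
    intro p hp hp'
    rcases List.mem_append.1 hp with h4 | h4 <;> rcases List.mem_append.1 hp' with h5 | h5
    · have := h3.isOver_eq _ h5
      rw [Passage.partner_isOver, h3.isOver_eq p h4] at this
      simp at this
    · exact h3.right_eq _ h5 (by simpa using h4)
    · exact h3.right_eq _ h4 h5
    · exact h3.right_simple p h4 h5
  obtain ⟨f, D', hK', hst, hcr, hcode⟩ := hrep'.exists_straight h3.left_simple hM
  have hML : (O ++ R₀).length = L.length := by
    rw [← (perm_map_partner hrep'.isGaussCode h3.left_simple hM).length_eq, List.length_map]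
  have hcont : D'.IsContained := by
    refine KnotDiagram.isContained_of_not_separated hcode (by simp [hcr]) (by simpa using hML)
      fun κ => ?_
    rw [fits_relabel, fits_relabel]
    exact h3.not_separated hred hreg _
  have hle : K.cstr ≤ (D'.crossings : ℕ∞) := iInf₂_le D' ⟨hK', hst, hcont⟩
  obtain ⟨m, hm⟩ := ENat.ne_top_iff_exists.1 (ne_top_of_le_ne_top (ENat.natCast_ne_top _) hle)
  refine ⟨m, hm.symm, ?_⟩
  rw [← hm] at hle
  have h4 : m ≤ D'.crossings := by exact_mod_cast hle
  have h5 := h3.length_le_of_reduced hred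
  simp only [List.length_append, List.length_cons] at hS
  omega
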